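/- **Corollary 3.2 (Minimax optimality under correct prior calibration).** *Setting.* Let $d\ge 1$, $\sigma>0$, and let $\mathbb S^d\subset\mathbb R^{d+1}$ carry the uniform probability measure; $L^2(\mathbb S^d)$ and its norm refer to this measure. Let $\lambda_\ell=\ell(\ell+d-1)$, and for every $\ell\ge 0$ let $\{Y_{\ell,m}:1\le m\le M_{d,\ell}\}$ be a real orthonormal basis of the space of spherical harmonics of degree $\ell$. For $f\in L^2(\mathbb S^d)$ put $a_{\ell,m}(f)=\langle f,Y_{\ell,m}\rangle_{L^2}$ and $\|f\|_{H^\beta}^2=\sum_{\ell}(1+\lambda_\ell)^\beta\sum_m a_{\ell,m}(f)^2$, and let $B_\beta(R)=\{f\in L^2(\mathbb S^d):\|f\|_{H^\beta}\le R\}$. One observes $n$ independent pairs $(x_i,y_i)$ with $x_i$ uniform on $\mathbb S^d$ and $y_i=f_0(x_i)+\varepsilon_i$, where the $\varepsilon_i\sim\mathcal N(0,\sigma^2)$ are i.i.d. and independent of the $x_i$; $\mathbb P^{(n)}_{f_0}$ denotes the joint law of the data and $\mathbb E^{(n)}_{f_0}$ its expectation. An estimator is a measurable function of the data with values in $L^2(\mathbb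 S^d)$. *Prior and posterior.* Let $\alpha>d/2$, let $c_1,c_2>0$ and let $c_1(1+\lambda_\ell)^{-\alpha}\le C_\ell\le c_2(1+\lambda_\ell)^{-\alpha}$ for all $\ell\ge0$. Let $L_n\in\mathbb N$ with $L_n\simeq n^{1/(2\alpha+d)}$ as $n\to\infty$. The truncated prior is the law of $f=\sum_{\ell\le L_n}\sum_m a_{\ell,m}Y_{\ell,m}$ with independent $a_{\ell,m}\sim\mathcal N(0,C_\ell)$. Let $\Pi_n(\cdot\mid \boldsymbol y,\boldsymbol x)$ be the posterior given by Bayes' formula from this prior and either * (i) the likelihood in harmonic coordinates, $\prod_{\ell\le L_n}\prod_m\varphi(\hat a_{\ell,m};a_{\ell,m},\sigma^2/n)$, where $\hat a_{\ell,m}=\frac1n\sum_{i=1}^n y_iY_{\ell,m}(x_i)$ and $\varphi(\cdot;\mu,\tau^2)$ is the $\mathcal N(\mu,\tau^2)$ density, or * (ii) the likelihood of the regression model, $\prod_{i=1}^n\varphi(y_i;f(x_i),\sigma^2)$. *Claim.* Suppose $\alpha=\beta$, let $R>0$ and $\rho_n=n^{-\beta/(2\beta+d)}$. Then $\rho_n$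 is the posterior contraction rate and it is minimax-optimal over $B_\beta(R)$ for the $L^2(\mathbb S^d)$ loss, in the following sense. 1. (Minimax rate.) There are constants $c,C>0$, independent of $n$, of the $C_\ell$ and of the $L_n$, such that for all $n\ge1$ $$c\,\rho_n^2\;\le\;\inf_{\hat f_n}\ \sup_{f_0\in B_\beta(R)}\mathbb E^{(n)}_{f_0}\|\hat f_n-f_0\|_{L^2}^2\;\le\; C\,\rho_n^2 ,$$ the infimum being over all estimators. 2. (No faster rate.) For every sequence of estimators $\hat f_n$ and every real sequence $r_n=o(\rho_n)$, one has $\sup_{f_0\in B_\beta(R)}\mathbb E^{(n)}_{f_0}\|\hat f_n-f_0\|_{L^2}^2>r_n^2$ for all sufficiently large $n$. 3. (The posterior attains the rate.) For each of the two posteriors (i), (ii), there is $M_0$ such that for every $M\ge M_0$ $$\sup_{f_0\in B_\beta(R)}\mathbb E^{(n)}_{f_0}\,\Pi_n\big(f:\|f-f_0\|_{L^2}>M\rho_n\,\big|\,\boldsymbol y,\boldsymbol x\big)\longrightarrow0\qquad(n\to\infty).$$ -/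

import Mathlib

open MeasureTheory ProbabilityTheory Filter Topology Asymptotics
open scoped ENNReal NNReal

noncomputable section

namespace SphereRegression

/-- The unit sphere `S^d` of `ℝ^(d+1)`. -/
abbrev Sph (d : ℕ) : Type := Metric.sphere (0 : EuclideanSpace ℝ (Fin (d + 1))) 1

/-- The uniform probability measure on `S^d`: the normalized surface measure. -/
def unif (d : ℕ) : Measure (Sph d) :=
  ((volume : Measure (EuclideanSpace ℝ (Fin (d + 1)))).toSphere Set.univ)⁻¹ •
    (volume : Measure (EuclideanSpace ℝ (Fin (d + 1)))).toSphere

instance isProbabilityMeasure_unif (d : ℕ) : IsProbabilityMeasure (unif d) := by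
  constructor
  have h0 : (volume : Measure (EuclideanSpace ℝ (Fin (d + 1)))).toSphere Set.univ ≠ 0 := by
    exact (isOpen_univ.measure_pos _ ⟨⟨EuclideanSpace.single 0 1, by simp⟩, trivial⟩).ne'
  simp only [unif, Measure.smul_apply, smul_eq_mul]
  exact ENNReal.inv_mul_cancel h0 (measure_ne_top _ _)

/-- `L²(S^d)` for the uniform probability measure. -/
abbrev L2 (d : ℕ) : Type := Lp ℝ 2 (unif d)

/-! ### Spherical harmonics -/

/-- The `i`-th coordinate function on `S^d`. -/
def coord (d : ℕ) (i : Fin (d + 1)) : C(Sph d, ℝ) :=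
  ⟨fun x => (x : EuclideanSpace ℝ (Fin (d + 1))) i, by fun_prop⟩

/-- Restriction of polynomials in `d + 1` variables to `S^d`. -/
def restrictPoly (d : ℕ) : MvPolynomial (Fin (d + 1)) ℝ →ₗ[ℝ] C(Sph d, ℝ) :=
  (MvPolynomial.aeval (coord d)).toLinearMap

/-- The Euclidean Laplacian on polynomials in `d + 1` variables. -/
def polyLaplacian (d : ℕ) :
    MvPolynomial (Fin (d + 1)) ℝ →ₗ[ℝ] MvPolynomial (Fin (d + 1)) ℝ :=
  ∑ i, (MvPolynomial.pderiv i).toLinearMap ∘ₗ (MvPolynomial.pderiv i).toLinearMap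

/-- The spherical harmonics of degree `ℓ`: restrictions to `S^d` of the harmonic homogeneous
polynomials of degree `ℓ`. -/
def harmonicSpace (d ℓ : ℕ) : Submodule ℝ C(Sph d, ℝ) :=
  (MvPolynomial.homogeneousSubmodule (Fin (d + 1)) ℝ ℓ ⊓
    LinearMap.ker (polyLaplacian d)).map (restrictPoly d)

/-- The multiplicity `M_{d,ℓ}`. -/
def mult (d ℓ : ℕ) : ℕ := Module.finrank ℝ (harmonicSpace d ℓ)

/-- The eigenvalue `λ_ℓ = ℓ (ℓ + d - 1)` of the Laplace-Beltrami operator (with its sign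
changed) on spherical harmonics of degree `ℓ`. -/
def eigenval (d ℓ : ℕ) : ℝ := (ℓ : ℝ) * ((ℓ : ℝ) + (d : ℝ) - 1)

/-- A choice of functions `Y_{ℓ,m}`, `ℓ ≥ 0`, `m` in an index set with `M_{d,ℓ}` elements. -/
abbrev HarmonicFamily (d : ℕ) : Type := (ℓ : ℕ) → Fin (mult d ℓ) → C(Sph d, ℝ)

/-- For every `ℓ`, the functions `Y_{ℓ,m}` form an orthonormal basis of the space of spherical
harmonics of degree `ℓ` (they lie in it, are orthonormal, and their number is its dimension). -/
structure IsSphericalHarmonicBasis {d : ℕ} (Y : HarmonicFamily d) : Prop where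
  mem : ∀ ℓ m, Y ℓ m ∈ harmonicSpace d ℓ
  orthonormal : ∀ ℓ m m', ∫ x, Y ℓ m x * Y ℓ m' x ∂(unif d) = if m = m' then 1 else 0

/-- The harmonic coefficient `a_{ℓ,m} = ⟨f, Y_{ℓ,m}⟩` of `f`. -/
def coeff {d : ℕ} (Y : HarmonicFamily d) (f : L2 d) (ℓ : ℕ) (m : Fin (mult d ℓ)) : ℝ :=
  ∫ x, f x * Y ℓ m x ∂(unif d)

/-- The squared Sobolev norm `∑_ℓ (1 + λ_ℓ)^β ∑_m a_{ℓ,m}²`, possibly infinite. -/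
def sobolevNormSq {d : ℕ} (Y : HarmonicFamily d) (β : ℝ) (f : L2 d) : ℝ≥0∞ :=
  ∑' ℓ : ℕ, ENNReal.ofReal ((1 + eigenval d ℓ) ^ β * ∑ m, coeff Y f ℓ m ^ 2)

/-- The ball of radius `R` around `0` in `H^β(S^d)`. -/
def sobolevBall {d : ℕ} (Y : HarmonicFamily d) (β R : ℝ) : Set (L2 d) :=
  {f | sobolevNormSq Y β f ≤ ENNReal.ofReal (R ^ 2)}

/-! ### The regression model -/

/-- The data `(x_i, y_i)`, `i = 1, …, n`. -/
abbrev Data (d n : ℕ) : Type := Fin n → Sph d × ℝ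

/-- The joint law of `n` independent pairs `(x_i, y_i)` with `x_i` uniform on `S^d` and
`y_i = f(x_i) + ε_i`, where `ε_i ∼ N(0, σ²)` is independent of `x_i`.  It depends on `f` only
through its almost everywhere class. -/
def dataLaw {d : ℕ} (σ : ℝ) (f : L2 d) (n : ℕ) : Measure (Data d n) :=
  Measure.pi fun _ : Fin n =>
    ((unif d).prod (gaussianReal 0 (σ ^ 2).toNNReal)).map fun p => (p.1, f p.1 + p.2)

/-- The largest mean squared `L²` error of the estimator `T` over `f ∈ B`. -/
def worstCaseRisk {d : ℕ} (σ : ℝ) (n : ℕ) (B : Set (L2 d)) (T : Data d n → L2 d) : ℝ≥0∞ :=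
  ⨆ f ∈ B, ∫⁻ z, ‖T z - f‖ₑ ^ 2 ∂(dataLaw σ f n)

/-- The minimax risk over `B`.  An estimator is any measurable function of the data with values
in the separable space `L²(S^d)`. -/
def minimaxRisk {d : ℕ} (σ : ℝ) (n : ℕ) (B : Set (L2 d)) : ℝ≥0∞ :=
  ⨅ (T : Data d n → L2 d) (_ : StronglyMeasurable T), worstCaseRisk σ n B T

/-! ### The truncated Gaussian prior and its posterior -/

/-- Coefficient vectors `(a_{ℓ,m})`, `0 ≤ ℓ ≤ L`. -/
abbrev Coeffs (d L : ℕ) : Type := ((i : Fin (L + 1)) × Fin (mult d i)) → ℝ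

/-- The function `∑_{ℓ ≤ L} ∑_m a_{ℓ,m} Y_{ℓ,m}`. -/
def synth {d : ℕ} (Y : HarmonicFamily d) {L : ℕ} (a : Coeffs d L) : C(Sph d, ℝ) :=
  ∑ i, a i • Y i.1 i.2

/-- The truncated prior: independent `a_{ℓ,m} ∼ N(0, C_ℓ)` for `ℓ ≤ L` (all other coefficients
of the random function vanish). -/
def prior (d : ℕ) (C : ℕ → ℝ) (L : ℕ) : Measure (Coeffs d L) :=
  Measure.pi fun i => gaussianReal 0 (C i.1).toNNReal

/-- Bayes' formula: the prior `π` reweighted by the likelihood `lik` and normalized. -/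
def bayes {Θ : Type*} [MeasurableSpace Θ] (π : Measure Θ) (lik : Θ → ℝ≥0∞) : Measure Θ :=
  (∫⁻ a, lik a ∂π)⁻¹ • π.withDensity lik

/-- The empirical harmonic coefficient `n⁻¹ ∑_i y_i Y_{ℓ,m}(x_i)`. -/
def empCoeff {d : ℕ} (Y : HarmonicFamily d) {n : ℕ} (z : Data d n) (ℓ : ℕ)
    (m : Fin (mult d ℓ)) : ℝ :=
  (n : ℝ)⁻¹ * ∑ i, (z i).2 * Y ℓ m (z i).1

/-- The likelihood in harmonic coordinates: the empirical coefficients are treated as independent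
`N(a_{ℓ,m}, σ² / n)` observations. -/
def harmonicLik {d : ℕ} (Y : HarmonicFamily d) (σ : ℝ) {L n : ℕ} (z : Data d n)
    (a : Coeffs d L) : ℝ≥0∞ :=
  ∏ i, gaussianPDF (a i) (σ ^ 2 / n).toNNReal (empCoeff Y z i.1 i.2)

/-- The likelihood of the regression model itself: given the design points, the `y_i` are
independent `N(f(x_i), σ²)`. -/
def regressionLik {d : ℕ} (Y : HarmonicFamily d) (σ : ℝ) {L n : ℕ} (z : Data d n)
    (a : Coeffs d L) : ℝ≥0∞ :=
  ∏ i, gaussianPDF (synth Y a (z i).1) (σ ^ 2).toNNReal (z i).2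

/-- The posterior on coefficient vectors for the likelihood in harmonic coordinates. -/
def harmonicPosterior {d : ℕ} (Y : HarmonicFamily d) (σ : ℝ) (C : ℕ → ℝ) (L : ℕ) {n : ℕ}
    (z : Data d n) : Measure (Coeffs d L) :=
  bayes (prior d C L) (harmonicLik Y σ z)

/-- The posterior on coefficient vectors for the likelihood of the regression model. -/
def regressionPosterior {d : ℕ} (Y : HarmonicFamily d) (σ : ℝ) (C : ℕ → ℝ) (L : ℕ) {n : ℕ}
    (z : Data d n) : Measure (Coeffs d L) :=
  bayes (prior d C L) (regressionLik Y σ z)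

/-- The coefficient vectors whose function has `L²` distance more than `t` from `f₀`. -/
def farFrom {d : ℕ} (Y : HarmonicFamily d) (L : ℕ) (f₀ : L2 d) (t : ℝ) : Set (Coeffs d L) :=
  {a | t < ‖ContinuousMap.toLp (E := ℝ) 2 (unif d) ℝ (synth Y a) - f₀‖}

/-- The posteriors `post n z` contract at rate `ρ`, uniformly over `f₀ ∈ B`: for every
sufficiently large `M`, the expectation under `f₀` of the posterior probability that
`‖f - f₀‖ > M ρ_n` tends to `0`.  (For a random variable with values in `[0, 1]` this is
convergence to `0` in probability.) -/
def ContractsUniformly {d : ℕ} (Y : HarmonicFamily d) (σ : ℝ) (L : ℕ → ℕ)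
    (post : (n : ℕ) → Data d n → Measure (Coeffs d (L n))) (B : Set (L2 d)) (ρ : ℕ → ℝ) : Prop :=
  ∃ M₀ : ℝ, ∀ M ≥ M₀, Tendsto
    (fun n => ⨆ f₀ ∈ B, ∫⁻ z, post n z (farFrom Y (L n) f₀ (M * ρ n)) ∂(dataLaw σ f₀ n))
    atTop (𝓝 0)

end SphereRegression

end

noncomputable section

namespace SphereRegression

/-! ### Rotations of the sphere -/

/-! Put N = n^(1/(2β+d)) (`resolution`), so that N^(2β) N^d = n. About N^d spherical harmonics have
degree at most N. Estimating all their coefficients therefore costs a variance of order N^d / n,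
which equals N^(-2β) = ρ_n², the order of the squared Sobolev tail beyond degree N. All three claims
rest on this balance.

The analysis on the sphere is derived from the infinitesimal rotations x_i ∂_j - x_j ∂_i. Rotation
invariance of the measure makes them antisymmetric. The sum of their squares is symmetric and acts
on harmonics of degree ℓ as -2λ_ℓ, so different degrees are orthogonal. A dimension count then
splits homogeneous polynomials into harmonic ones and multiples of |x|². This yields the
multiplicities, completeness in L² (by Stone-Weierstrass) and the addition theorem
`sum_sq_harmonics`: ∑_m Y_{ℓ,m}(x)² is constant in x. The addition theorem makes all variances
computable and, since β > d/2, bounds the functions of the Sobolev ball uniformly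
(`ae_sq_le_of_mem_sobolevBall`).

Minimax risk. The projection estimator at level N attains the rate (`risk_projEst_le`). The lower
bound is Assouad's (`worstCaseRisk_ge`): put ±δ with δ² of order 1/n on every coefficient of degree
at most N. Flipping one sign changes the law of the data so little that the Hellinger affinity stays
at least 1/2, so every coefficient costs a risk of order δ². A sequence o(ρ_n) is eventually below
this bound.

Posterior. Both posteriors come from Gaussian linear models. Around the true truncated coefficients
the density is proportional to exp(-q(u)/2 + h(u)), with q quadratic and h linear. If q(u) ≥ κ|u|²
and h(u)² ≤ H|u|², the mass of |u|² > t is at most exp(2H/κ - κt/8) 2^(D/2), where D is the number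
of coefficients (`setLIntegral_exp_tail_le`); neither posterior mean nor covariance is needed. Here
κ is of order n, t of order ρ_n² and D of order N^d = nρ_n², so it suffices that H is O(n²ρ_n²). The
prior contributes to H the terms (a/C_ℓ)², which α = β controls. The data contribute the squared
norm of a sum of n centred vectors (`score_concentration`). For the regression likelihood the lower
bound on q requires the empirical Gram matrix to be at least n/2, which holds with probability
tending to one because D² = o(n) (`gram_concentration`, `le_sum_synth_sq`). The constant M stays
fixed, so the exceptional events must have vanishing probability; this is why the scores need a
second-moment bound on the squared norm and not just Markov's inequality. -/

/-- The map of the sphere induced by a linear isometry of the ambient space. -/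
def sphMap {d : ℕ}
    (U : EuclideanSpace ℝ (Fin (d + 1)) ≃ₗᵢ[ℝ] EuclideanSpace ℝ (Fin (d + 1))) :
    Sph d → Sph d :=
  fun x => ⟨U x, by simp⟩

theorem continuous_sphMap {d : ℕ}
    (U : EuclideanSpace ℝ (Fin (d + 1)) ≃ₗᵢ[ℝ] EuclideanSpace ℝ (Fin (d + 1))) :
    Continuous (sphMap U) := by
  unfold sphMap
  fun_prop

-- The surface measure of a set is a multiple of the volume of the cone over it, and a linear
-- isometry maps cones to cones and preserves volume.
open scoped Pointwise in
theorem measurePreserving_sphMap {d : ℕ}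
    (U : EuclideanSpace ℝ (Fin (d + 1)) ≃ₗᵢ[ℝ] EuclideanSpace ℝ (Fin (d + 1))) :
    MeasurePreserving (sphMap U) (unif d) (unif d) := by
  refine MeasurePreserving.smul_measure ⟨(continuous_sphMap U).measurable, ?_⟩ _
  ext s hs
  rw [Measure.map_apply (continuous_sphMap U).measurable hs, Measure.toSphere_apply' _ hs,
    Measure.toSphere_apply' _ ((continuous_sphMap U).measurable hs)]
  congr 1
  refine Eq.trans ?_ (U.measurePreserving.measure_preimage_emb
    U.toHomeomorph.measurableEmbedding (Set.Ioo (0 : ℝ) 1 • ((↑) '' s)))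
  congr 1
  ext v
  simp only [Set.mem_smul, Set.mem_image, Set.mem_preimage]
  constructor
  · rintro ⟨r, hr, _, ⟨x, hx, rfl⟩, rfl⟩
    exact ⟨r, hr, _, ⟨sphMap U x, hx, rfl⟩, by simp [sphMap]⟩
  · rintro ⟨r, hr, _, ⟨x, hx, rfl⟩, h⟩
    refine ⟨r, hr, U.symm x, ⟨sphMap U.symm x, ?_, rfl⟩, U.injective ?_⟩
    · simpa [sphMap] using hx
    · simpa using h

theorem integral_comp_sphMap {d : ℕ}
    (U : EuclideanSpace ℝ (Fin (d + 1)) ≃ₗᵢ[ℝ] EuclideanSpace ℝ (Fin (d + 1)))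
    (f : C(Sph d, ℝ)) : ∫ x, f (sphMap U x) ∂(unif d) = ∫ x, f x ∂(unif d) := by
  have h := integral_map (μ := unif d) (continuous_sphMap U).measurable.aemeasurable
    (f := f) f.continuous.aestronglyMeasurable
  rw [(measurePreserving_sphMap U).map_eq] at h
  exact h.symm

/-- The coordinates of the rotation by the angle `t` in the plane of the axes `i` and `j`. -/
def rotCoord {d : ℕ} (i j : Fin (d + 1)) (t : ℝ) (x : Fin (d + 1) → ℝ) (k : Fin (d + 1)) : ℝ :=
  if k = i then Real.cos t * x i - Real.sin t * x j
  else if k = j then Real.sin t * x i + Real.cos t * x j else x k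

theorem sum_sq_rotCoord {d : ℕ} {i j : Fin (d + 1)} (hij : i ≠ j) (t : ℝ)
    (x : Fin (d + 1) → ℝ) : ∑ k, rotCoord i j t x k ^ 2 = ∑ k, x k ^ 2 := by
  rw [← sub_eq_zero, ← Finset.sum_sub_distrib]
  have h : ∀ k, rotCoord i j t x k ^ 2 - x k ^ 2 =
      (if k = i then (Real.cos t * x i - Real.sin t * x j) ^ 2 - x i ^ 2 else 0) +
      (if k = j then (Real.sin t * x i + Real.cos t * x j) ^ 2 - x j ^ 2 else 0) := by
    intro k
    unfold rotCoord
    by_cases hi : k = i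
    · subst hi; simp [hij]
    · by_cases hj : k = j
      · subst hj; simp [hi]
      · simp [hi, hj]
  simp only [h, Finset.sum_add_distrib, Finset.sum_ite_eq', Finset.mem_univ, if_true]
  have := Real.sin_sq_add_cos_sq t
  linear_combination (x i ^ 2 + x j ^ 2) * this

/-- The rotation by the angle `t` in the plane of the axes `i` and `j`. -/
def planeRot {d : ℕ} {i j : Fin (d + 1)} (hij : i ≠ j) (t : ℝ) :
    EuclideanSpace ℝ (Fin (d + 1)) ≃ₗᵢ[ℝ] EuclideanSpace ℝ (Fin (d + 1)) :=
  LinearIsometry.toLinearIsometryEquiv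
    { toFun := fun x => WithLp.toLp 2 (rotCoord i j t x)
      map_add' := fun x y => by
        ext k
        simp only [rotCoord, PiLp.add_apply]
        split_ifs <;> ring
      map_smul' := fun c x => by
        ext k
        simp only [rotCoord, PiLp.smul_apply, smul_eq_mul, RingHom.id_apply]
        split_ifs <;> ring
      norm_map' := fun x => by
        simp only [LinearMap.coe_mk, AddHom.coe_mk, EuclideanSpace.norm_eq, Real.norm_eq_abs,
          sq_abs]
        rw [sum_sq_rotCoord hij] } rfl

/-! ### Infinitesimal rotations and integration by parts -/

theorem hasDerivAt_eval {σ : Type*} [Fintype σ] (p : MvPolynomial σ ℝ) {c : ℝ → σ → ℝ}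
    {c' : σ → ℝ} {t : ℝ} (hc : ∀ k, HasDerivAt (fun s => c s k) (c' k) t) :
    HasDerivAt (fun s => MvPolynomial.eval (c s) p)
      (∑ k, c' k * MvPolynomial.eval (c t) (MvPolynomial.pderiv k p)) t := by
  classical
  induction p using MvPolynomial.induction_on with
  | C a => simpa using hasDerivAt_const t a
  | add p q hp hq =>
    simp only [map_add, mul_add, Finset.sum_add_distrib]
    exact hp.add hq
  | mul_X p j hp =>
    simp only [map_mul, MvPolynomial.eval_X]
    refine (hp.mul (hc j)).congr_deriv ?_
    simp only [MvPolynomial.pderiv_mul, MvPolynomial.pderiv_X, map_add, map_mul,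
      MvPolynomial.eval_X, mul_add, Finset.sum_add_distrib, Finset.sum_mul]
    congr 1
    · exact Finset.sum_congr rfl fun k _ => by ring
    · rw [Finset.sum_eq_single j]
      · simp; ring
      · intro b _ hb
        simp [hb.symm]
      · simp

/-- The infinitesimal rotation `x_i ∂_j - x_j ∂_i`. -/
def rotGen {d : ℕ} (i j : Fin (d + 1)) :
    Derivation ℝ (MvPolynomial (Fin (d + 1)) ℝ) (MvPolynomial (Fin (d + 1)) ℝ) :=
  (MvPolynomial.X i : MvPolynomial (Fin (d + 1)) ℝ) • MvPolynomial.pderiv j -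
    (MvPolynomial.X j : MvPolynomial (Fin (d + 1)) ℝ) • MvPolynomial.pderiv i

theorem rotGen_apply {d : ℕ} (i j : Fin (d + 1)) (p : MvPolynomial (Fin (d + 1)) ℝ) :
    rotGen i j p = MvPolynomial.X i * MvPolynomial.pderiv j p -
      MvPolynomial.X j * MvPolynomial.pderiv i p := rfl

theorem restrictPoly_apply (d : ℕ) (p : MvPolynomial (Fin (d + 1)) ℝ) (x : Sph d) :
    restrictPoly d p x = MvPolynomial.eval (fun k => (x : EuclideanSpace ℝ (Fin (d + 1))) k) p := by
  have h : restrictPoly d p x = (ContinuousMap.evalAlgHom ℝ ℝ x) (MvPolynomial.aeval (coord d) p) :=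
    rfl
  rw [h, MvPolynomial.comp_aeval_apply, MvPolynomial.aeval_eq_eval]
  rfl

theorem restrictPoly_mul (d : ℕ) (p q : MvPolynomial (Fin (d + 1)) ℝ) :
    restrictPoly d (p * q) = restrictPoly d p * restrictPoly d q := by
  simp [restrictPoly]

theorem hasDerivAt_rotCoord {d : ℕ} {i j : Fin (d + 1)} (hij : i ≠ j)
    (x : Fin (d + 1) → ℝ) (p : MvPolynomial (Fin (d + 1)) ℝ) (t : ℝ) :
    HasDerivAt (fun s => MvPolynomial.eval (rotCoord i j s x) p)
      (MvPolynomial.eval (rotCoord i j t x) (rotGen i j p)) t := by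
  have hc : ∀ k, HasDerivAt (fun s => rotCoord i j s x k)
      ((if k = i then -rotCoord i j t x j else 0) + (if k = j then rotCoord i j t x i else 0)) t := by
    intro k
    unfold rotCoord
    by_cases hi : k = i
    · subst hi
      simp only [if_true, hij, hij.symm, if_false, add_zero]
      refine (((Real.hasDerivAt_cos t).mul_const _).sub
        ((Real.hasDerivAt_sin t).mul_const _)).congr_deriv ?_
      ring
    · by_cases hj : k = j
      · subst hj
        simp only [if_true, hij.symm, if_false, zero_add]
        refine (((Real.hasDerivAt_sin t).mul_const _).add
          ((Real.hasDerivAt_cos t).mul_const _)).congr_deriv ?_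
        ring
      · simpa [hi, hj] using hasDerivAt_const t (x k)
  refine (hasDerivAt_eval p hc).congr_deriv ?_
  simp only [add_mul, Finset.sum_add_distrib, ite_mul, zero_mul, Finset.sum_ite_eq',
    Finset.mem_univ, if_true, rotGen_apply, map_sub, map_mul, MvPolynomial.eval_X]
  ring

/-- The integral of p over the rotated sphere does not depend on the angle. Differentiating under
the integral sign at angle 0 gives the claim. -/
theorem integral_restrictPoly_rotGen {d : ℕ} (i j : Fin (d + 1))
    (p : MvPolynomial (Fin (d + 1)) ℝ) :
    ∫ x, restrictPoly d (rotGen i j p) x ∂(unif d) = 0 := by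
  by_cases hij : i = j
  · subst hij
    simp [rotGen_apply]
  have key : ∀ q : MvPolynomial (Fin (d + 1)) ℝ, ∀ t (x : Sph d),
      restrictPoly d q (sphMap (planeRot hij t) x) =
        MvPolynomial.eval (rotCoord i j t (x : EuclideanSpace ℝ (Fin (d + 1)))) q := by
    intro q t x
    rw [restrictPoly_apply]
    rfl
  have h := hasDerivAt_integral_of_dominated_loc_of_deriv_le (μ := unif d) (x₀ := (0 : ℝ))
    (s := Set.univ)
    (F := fun t x => restrictPoly d p (sphMap (planeRot hij t) x))
    (F' := fun t x => restrictPoly d (rotGen i j p) (sphMap (planeRot hij t) x))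
    (bound := fun _ => ‖restrictPoly d (rotGen i j p)‖) Filter.univ_mem
    (Eventually.of_forall fun t =>
      ((restrictPoly d p).continuous.comp (continuous_sphMap _)).aestronglyMeasurable)
    (((restrictPoly d p).continuous.comp (continuous_sphMap _)).integrable_of_hasCompactSupport
      (HasCompactSupport.of_compactSpace _))
    ((restrictPoly d (rotGen i j p)).continuous.comp (continuous_sphMap _)).aestronglyMeasurable
    (ae_of_all _ fun x t _ => (restrictPoly d (rotGen i j p)).norm_coe_le_norm _)
    (integrable_const _)
    (ae_of_all _ fun x t _ => by
      simp only [key]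
      exact hasDerivAt_rotCoord hij _ p t)
  have h2 := h.2
  simp only [integral_comp_sphMap] at h2
  exact h2.unique (hasDerivAt_const _ _)

theorem integrable_cont {d : ℕ} (f : C(Sph d, ℝ)) : Integrable f (unif d) :=
  f.continuous.integrable_of_hasCompactSupport (HasCompactSupport.of_compactSpace _)

/-- Integration by parts: the generator is a derivation, and its value at the product p * q
integrates to zero. -/
theorem integral_rotGen_mul {d : ℕ} (i j : Fin (d + 1)) (p q : MvPolynomial (Fin (d + 1)) ℝ) :
    ∫ x, restrictPoly d (rotGen i j p) x * restrictPoly d q x ∂(unif d) =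
      -∫ x, restrictPoly d p x * restrictPoly d (rotGen i j q) x ∂(unif d) := by
  have h := integral_restrictPoly_rotGen i j (p * q)
  rw [Derivation.leibniz, smul_eq_mul, smul_eq_mul, map_add, restrictPoly_mul,
    restrictPoly_mul] at h
  simp only [ContinuousMap.add_apply, ContinuousMap.mul_apply] at h
  have hi := fun f g : C(Sph d, ℝ) => integrable_cont (f * g)
  simp only [ContinuousMap.coe_mul, Pi.mul_def] at hi
  rw [integral_add (hi _ _) (hi _ _)] at h
  simp only [mul_comm (restrictPoly d q _)] at h
  linarith

/-! ### The Casimir operator -/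

/-- The sum of the squares of the infinitesimal rotations. -/
def casimir {d : ℕ} (p : MvPolynomial (Fin (d + 1)) ℝ) : MvPolynomial (Fin (d + 1)) ℝ :=
  ∑ i, ∑ j, rotGen i j (rotGen i j p)

theorem integral_casimir_mul {d : ℕ} (p q : MvPolynomial (Fin (d + 1)) ℝ) :
    ∫ x, restrictPoly d (casimir p) x * restrictPoly d q x ∂(unif d) =
      ∫ x, restrictPoly d p x * restrictPoly d (casimir q) x ∂(unif d) := by
  have h : ∀ f g : C(Sph d, ℝ), Integrable (fun x => f x * g x) (unif d) :=
    fun f g => integrable_cont (f * g)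
  simp only [casimir, map_sum, ContinuousMap.sum_apply, Finset.sum_mul, Finset.mul_sum]
  rw [integral_finsetSum _ fun i _ => integrable_finsetSum _ fun j _ => h _ _,
    integral_finsetSum _ fun i _ => integrable_finsetSum _ fun j _ => h _ _]
  refine Finset.sum_congr rfl fun i _ => ?_
  rw [integral_finsetSum _ fun j _ => h _ _, integral_finsetSum _ fun j _ => h _ _]
  refine Finset.sum_congr rfl fun j _ => ?_
  rw [integral_rotGen_mul, integral_rotGen_mul, neg_neg]

theorem polyLaplacian_apply (d : ℕ) (p : MvPolynomial (Fin (d + 1)) ℝ) :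
    polyLaplacian d p = ∑ i, MvPolynomial.pderiv i (MvPolynomial.pderiv i p) := by
  simp [polyLaplacian]

theorem pderiv_comm {σ : Type*} (i j : σ) (p : MvPolynomial σ ℝ) :
    MvPolynomial.pderiv i (MvPolynomial.pderiv j p) =
      MvPolynomial.pderiv j (MvPolynomial.pderiv i p) := by
  classical
  have h : ⁅MvPolynomial.pderiv (R := ℝ) i, MvPolynomial.pderiv (R := ℝ) j⁆ = 0 := by
    ext k
    simp [Derivation.commutator_apply, MvPolynomial.pderiv_X, Pi.single_apply, apply_ite]
  have := congrArg (fun D => D p) h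
  simpa [Derivation.commutator_apply, sub_eq_zero] using this

/-- Expanding the squares leaves terms |x|² Δp, which vanish, and terms in which Euler's identity
replaces x·∇ by the degree. The sum runs over ordered pairs, so each plane counts twice; hence the
factor 2. -/
theorem casimir_eq {d ℓ : ℕ} {p : MvPolynomial (Fin (d + 1)) ℝ} (hp : p.IsHomogeneous ℓ)
    (hΔ : polyLaplacian d p = 0) : casimir p = (-2 * eigenval d ℓ) • p := by
  classical
  have e1 := hp.sum_X_mul_pderiv
  have e2 : ∑ i, MvPolynomial.X i * ∑ j, MvPolynomial.X j *
      MvPolynomial.pderiv j (MvPolynomial.pderiv i p) = (ℓ - 1) • ℓ • p := by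
    rw [← e1, Finset.smul_sum]
    refine Finset.sum_congr rfl fun i _ => ?_
    rw [(hp.pderiv (i := i)).sum_X_mul_pderiv, mul_smul_comm]
  rw [polyLaplacian_apply] at hΔ
  -- The term for i = j restores the value 0 of the generator on the diagonal, so that one formula
  -- covers all pairs.
  have h : ∀ i j : Fin (d + 1), rotGen i j (rotGen i j p) =
      (if i = j then 2 * (MvPolynomial.X i * MvPolynomial.pderiv i p) else 0) +
      (MvPolynomial.X i * MvPolynomial.X i) * MvPolynomial.pderiv j (MvPolynomial.pderiv j p) +
      (MvPolynomial.X j * MvPolynomial.X j) * MvPolynomial.pderiv i (MvPolynomial.pderiv i p)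
      - MvPolynomial.X i * MvPolynomial.pderiv i p - MvPolynomial.X j * MvPolynomial.pderiv j p
      - MvPolynomial.X i * (MvPolynomial.X j *
        MvPolynomial.pderiv j (MvPolynomial.pderiv i p))
      - MvPolynomial.X i * (MvPolynomial.X j *
        MvPolynomial.pderiv j (MvPolynomial.pderiv i p)) := by
    intro i j
    simp only [rotGen_apply, map_sub, MvPolynomial.pderiv_mul, MvPolynomial.pderiv_X_self]
    rw [pderiv_comm i j]
    by_cases hij : i = j
    · subst hij
      simp only [if_true, MvPolynomial.pderiv_X_self]
      ring
    · simp only [if_neg hij, MvPolynomial.pderiv_X_of_ne hij,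
        MvPolynomial.pderiv_X_of_ne (Ne.symm hij)]
      ring
  simp only [casimir, h, Finset.sum_sub_distrib, Finset.sum_add_distrib,
    ← Finset.mul_sum, hΔ, Finset.sum_ite_eq, Finset.mem_univ, if_true, e1, ← Finset.sum_mul,
    Finset.sum_const, Finset.card_univ, Fintype.card_fin, mul_zero, mul_smul_comm,
    ← Finset.smul_sum, e2, eigenval]
  simp only [MvPolynomial.smul_eq_C_mul, nsmul_eq_mul]
  simp only [map_mul, map_sub, map_add, map_neg, map_natCast, map_one, map_ofNat]
  -- The second Euler identity involves the truncated difference ℓ - 1, so degree 0 is separate.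
  rcases ℓ with _ | ℓ
  · simp
  · push_cast
    ring_nf

/-! ### Decomposition of polynomials into harmonic ones -/

instance isOpenPosMeasure_unif (d : ℕ) : (unif d).IsOpenPosMeasure := by
  constructor
  intro U hU hne
  simp only [unif, Measure.smul_apply, smul_eq_mul, ne_eq, mul_eq_zero, not_or,
    ENNReal.inv_eq_zero]
  exact ⟨measure_ne_top _ _, (hU.measure_pos _ hne).ne'⟩

theorem eq_zero_of_integral_mul_self {d : ℕ} (f : C(Sph d, ℝ))
    (h : ∫ x, f x * f x ∂(unif d) = 0) : f = 0 := by
  have h0 := (integral_eq_zero_iff_of_nonneg (μ := unif d) (f := fun x => f x * f x)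
    (fun x => mul_self_nonneg _) (integrable_cont (f * f))).1 h
  have h1 := (Continuous.ae_eq_iff_eq (unif d) (by fun_prop) continuous_zero).1 h0
  ext x
  have := congrFun h1 x
  simpa using this

abbrev Poly (d : ℕ) : Type := MvPolynomial (Fin (d + 1)) ℝ

/-- Homogeneous polynomials of degree `ℓ`. -/
abbrev homPoly (d ℓ : ℕ) : Submodule ℝ (Poly d) :=
  MvPolynomial.homogeneousSubmodule (Fin (d + 1)) ℝ ℓ

instance finite_homPoly (d ℓ : ℕ) : Module.Finite ℝ (homPoly d ℓ) :=
  Module.Finite.iff_fg.2 (MvPolynomial.homogeneousSubmodule_fg _ _ ℓ)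

theorem eval_smul_of_isHomogeneous {σ : Type*} [Fintype σ] {p : MvPolynomial σ ℝ} {ℓ : ℕ}
    (hp : p.IsHomogeneous ℓ) (r : ℝ) (v : σ → ℝ) :
    MvPolynomial.eval (fun k => r * v k) p = r ^ ℓ * MvPolynomial.eval v p := by
  rw [MvPolynomial.eval_eq', MvPolynomial.eval_eq', Finset.mul_sum]
  refine Finset.sum_congr rfl fun m hm => ?_
  have hm' : ∑ i, m i = ℓ := by
    rw [← Finsupp.degree_eq_sum]
    by_contra hne
    exact MvPolynomial.mem_support_iff.1 hm (hp.coeff_eq_zero hne)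
  rw [← hm', ← Finset.prod_pow_eq_pow_sum]
  simp only [mul_pow, Finset.prod_mul_distrib]
  ring

/-- Every vector is a multiple of a point of the sphere, and homogeneity determines the values along
rays. -/
theorem restrictPoly_injOn {d ℓ : ℕ} {p : Poly d} (hp : p.IsHomogeneous ℓ)
    (h : restrictPoly d p = 0) : p = 0 := by
  apply MvPolynomial.funext
  intro v
  obtain ⟨x, hx⟩ : ∃ x : Sph d, WithLp.toLp 2 v = ‖WithLp.toLp 2 v‖ • (x : EuclideanSpace ℝ _) := by
    by_cases hv : WithLp.toLp 2 v = (0 : EuclideanSpace ℝ (Fin (d + 1)))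
    · exact ⟨⟨EuclideanSpace.single 0 1, by simp⟩, by simp [hv]⟩
    · refine ⟨⟨‖WithLp.toLp 2 v‖⁻¹ • WithLp.toLp 2 v, ?_⟩, ?_⟩
      · simp [norm_smul, hv]
      · simp [smul_smul, hv]
  have hv : v = fun k => ‖WithLp.toLp 2 v‖ * (x : EuclideanSpace ℝ (Fin (d + 1))) k := by
    funext k
    have := congrArg (fun w : EuclideanSpace ℝ (Fin (d + 1)) => w k) hx
    simpa using this
  rw [hv, eval_smul_of_isHomogeneous hp, ← restrictPoly_apply, h]
  simp

theorem exists_poly_of_mem_harmonicSpace {d ℓ : ℕ} {f : C(Sph d, ℝ)}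
    (hf : f ∈ harmonicSpace d ℓ) :
    ∃ p : Poly d, p.IsHomogeneous ℓ ∧ polyLaplacian d p = 0 ∧ restrictPoly d p = f := by
  obtain ⟨p, hp, rfl⟩ := hf
  exact ⟨p, hp.1, hp.2, rfl⟩

theorem eigenval_strictMono {d : ℕ} (hd : 1 ≤ d) : StrictMono (eigenval d) := by
  intro a b hab
  have h1 : (a : ℝ) + 1 ≤ b := by exact_mod_cast hab
  have h2 : (1 : ℝ) ≤ d := by exact_mod_cast hd
  have h3 : (0 : ℝ) ≤ a := a.cast_nonneg
  unfold eigenval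
  nlinarith

/-- Eigenvectors of a symmetric operator: f and g have the distinct eigenvalues -2λ_k and -2λ_ℓ for
the Casimir operator. -/
theorem integral_mul_eq_zero_of_ne {d : ℕ} (hd : 1 ≤ d) {k ℓ : ℕ} (hkl : k ≠ ℓ)
    {f g : C(Sph d, ℝ)} (hf : f ∈ harmonicSpace d k) (hg : g ∈ harmonicSpace d ℓ) :
    ∫ x, f x * g x ∂(unif d) = 0 := by
  obtain ⟨p, hp, hp0, rfl⟩ := exists_poly_of_mem_harmonicSpace hf
  obtain ⟨q, hq, hq0, rfl⟩ := exists_poly_of_mem_harmonicSpace hg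
  have h := integral_casimir_mul p q
  rw [casimir_eq hp hp0, casimir_eq hq hq0] at h
  have hr : ∀ c : ℝ, ∀ x, restrictPoly d p x * (c * restrictPoly d q x) =
      c * (restrictPoly d p x * restrictPoly d q x) := fun c x => by ring
  simp only [map_smul, ContinuousMap.smul_apply, smul_eq_mul, hr, mul_assoc (_ * _ : ℝ),
    integral_const_mul] at h
  have hne : eigenval d k ≠ eigenval d ℓ := fun h => hkl ((eigenval_strictMono hd).injective h)
  have : (eigenval d k - eigenval d ℓ) *
      ∫ x, restrictPoly d p x * restrictPoly d q x ∂(unif d) = 0 := by linarith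
  exact (mul_eq_zero.1 this).resolve_left (sub_ne_zero.2 hne)

/-- Sums of spherical harmonics of degree at most `N`. -/
def harmonicSum (d N : ℕ) : Submodule ℝ C(Sph d, ℝ) := ⨆ k ≤ N, harmonicSpace d k

theorem harmonicSpace_le_harmonicSum {d k N : ℕ} (h : k ≤ N) :
    harmonicSpace d k ≤ harmonicSum d N :=
  le_iSup₂_of_le k h le_rfl

theorem harmonicSum_mono {d N N' : ℕ} (h : N ≤ N') : harmonicSum d N ≤ harmonicSum d N' :=
  iSup₂_le fun _ hk => harmonicSpace_le_harmonicSum (hk.trans h)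

theorem integral_mul_eq_zero_of_forall {d N : ℕ} {f : C(Sph d, ℝ)}
    (h : ∀ k ≤ N, ∀ g ∈ harmonicSpace d k, ∫ x, f x * g x ∂(unif d) = 0)
    {g : C(Sph d, ℝ)} (hg : g ∈ harmonicSum d N) : ∫ x, f x * g x ∂(unif d) = 0 := by
  let φ : C(Sph d, ℝ) →ₗ[ℝ] ℝ :=
    { toFun := fun g => ∫ x, f x * g x ∂(unif d)
      map_add' := fun a b => by
        simp only [ContinuousMap.add_apply, mul_add]
        exact integral_add (integrable_cont (f * a)) (integrable_cont (f * b))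
      map_smul' := fun c a => by
        simp only [ContinuousMap.smul_apply, smul_eq_mul, mul_left_comm, integral_const_mul,
          RingHom.id_apply] }
  have : harmonicSum d N ≤ LinearMap.ker φ := iSup₂_le fun k hk g hg => h k hk g hg
  exact this hg

/-- The polynomial `|x|²`. -/
def normSqPoly (d : ℕ) : Poly d := ∑ i, MvPolynomial.X i ^ 2

theorem restrictPoly_normSqPoly (d : ℕ) : restrictPoly d (normSqPoly d) = 1 := by
  ext x
  rw [restrictPoly_apply]
  have h := x.2
  rw [mem_sphere_zero_iff_norm, EuclideanSpace.norm_eq, Real.sqrt_eq_one] at h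
  simpa [normSqPoly] using h

theorem isHomogeneous_normSqPoly (d : ℕ) : (normSqPoly d).IsHomogeneous 2 :=
  MvPolynomial.IsHomogeneous.sum _ _ _ fun i _ => MvPolynomial.isHomogeneous_X_pow i 2

theorem normSqPoly_ne_zero (d : ℕ) : normSqPoly d ≠ 0 := by
  intro h
  have := restrictPoly_normSqPoly d
  rw [h, map_zero] at this
  have h2 := congrArg (fun f : C(Sph d, ℝ) => f ⟨EuclideanSpace.single 0 1, by simp⟩) this
  simp at h2

theorem polyLaplacian_isHomogeneous {d ℓ : ℕ} {p : Poly d} (hp : p.IsHomogeneous (ℓ + 2)) :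
    (polyLaplacian d p).IsHomogeneous ℓ := by
  rw [polyLaplacian_apply]
  exact MvPolynomial.IsHomogeneous.sum _ _ _ fun i _ => (hp.pderiv (i := i)).pderiv (i := i)

theorem polyLaplacian_eq_zero_of_le_one {d ℓ : ℕ} (hℓ : ℓ ≤ 1) {p : Poly d}
    (hp : p.IsHomogeneous ℓ) : polyLaplacian d p = 0 := by
  rw [polyLaplacian_apply]
  refine Finset.sum_eq_zero fun i _ => ?_
  have h := hp.pderiv (i := i)
  rw [Nat.sub_eq_zero_of_le hℓ, ← MvPolynomial.totalDegree_zero_iff_isHomogeneous,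
    MvPolynomial.totalDegree_eq_zero_iff_eq_C] at h
  rw [h, MvPolynomial.pderiv_C]

/-- Harmonic homogeneous polynomials of degree `ℓ`. -/
abbrev harmPoly (d ℓ : ℕ) : Submodule ℝ (Poly d) := homPoly d ℓ ⊓ LinearMap.ker (polyLaplacian d)

/-- The multiples of `|x|²` by homogeneous polynomials of degree `ℓ`. -/
abbrev radialPoly (d ℓ : ℕ) : Submodule ℝ (Poly d) :=
  (homPoly d ℓ).map (LinearMap.mulLeft ℝ (normSqPoly d))

/-- On the sphere |x|² q agrees with q, which by the induction hypothesis is a sum of harmonics of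
degree at most ℓ. If |x|² q is harmonic of degree ℓ + 2, it is orthogonal to those, hence to itself.
-/
theorem harmPoly_inf_radialPoly {d ℓ : ℕ} (hd : 1 ≤ d)
    (h : ∀ p : Poly d, p.IsHomogeneous ℓ → restrictPoly d p ∈ harmonicSum d ℓ) :
    harmPoly d (ℓ + 2) ⊓ radialPoly d ℓ = ⊥ := by
  rw [eq_bot_iff]
  rintro p ⟨⟨hp, hΔ⟩, q, hq, rfl⟩
  rw [LinearMap.mulLeft_apply] at *
  have hr : restrictPoly d (normSqPoly d * q) = restrictPoly d q := by
    rw [restrictPoly_mul, restrictPoly_normSqPoly, one_mul]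
  rw [Submodule.mem_bot]
  refine restrictPoly_injOn hp (eq_zero_of_integral_mul_self _ ?_)
  have hmem : restrictPoly d (normSqPoly d * q) ∈ harmonicSpace d (ℓ + 2) := ⟨_, ⟨hp, hΔ⟩, rfl⟩
  refine integral_mul_eq_zero_of_forall (N := ℓ) (fun k hk g hg => ?_) (hr ▸ h q hq)
  exact integral_mul_eq_zero_of_ne hd (by omega) hmem hg

/-- Rank-nullity for the Laplacian, whose image lies in degree ℓ. Its surjectivity is not needed:
the trivial intersection gives the opposite inequality. -/
theorem finrank_homPoly_le {d ℓ : ℕ} :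
    Module.finrank ℝ (homPoly d (ℓ + 2)) ≤
      Module.finrank ℝ (harmPoly d (ℓ + 2)) + Module.finrank ℝ (homPoly d ℓ) := by
  have h : Module.finrank ℝ (LinearMap.range ((polyLaplacian d).domRestrict (homPoly d (ℓ + 2)))) +
      Module.finrank ℝ (LinearMap.ker ((polyLaplacian d).domRestrict (homPoly d (ℓ + 2)))) =
      Module.finrank ℝ (homPoly d (ℓ + 2)) :=
    LinearMap.finrank_range_add_finrank_ker _
  have h1 : LinearMap.range ((polyLaplacian d).domRestrict (homPoly d (ℓ + 2))) ≤ homPoly d ℓ := by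
    rintro _ ⟨⟨p, hp⟩, rfl⟩
    exact polyLaplacian_isHomogeneous hp
  have h2 : (LinearMap.ker ((polyLaplacian d).domRestrict (homPoly d (ℓ + 2)))).map
      (homPoly d (ℓ + 2)).subtype = harmPoly d (ℓ + 2) := by
    ext p
    constructor
    · rintro ⟨q, hq, rfl⟩
      exact ⟨q.2, hq⟩
    · rintro ⟨hp, hΔ⟩
      exact ⟨⟨p, hp⟩, hΔ, rfl⟩
  have h4 : Module.finrank ℝ (harmPoly d (ℓ + 2)) =
      Module.finrank ℝ (LinearMap.ker ((polyLaplacian d).domRestrict (homPoly d (ℓ + 2)))) := by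
    rw [← h2]
    exact Submodule.finrank_map_subtype_eq _ _
  have h3 : Module.finrank ℝ
      (LinearMap.range ((polyLaplacian d).domRestrict (homPoly d (ℓ + 2)))) ≤
      Module.finrank ℝ (homPoly d ℓ) := Submodule.finrank_mono h1
  omega

theorem finrank_radialPoly (d ℓ : ℕ) :
    Module.finrank ℝ (radialPoly d ℓ) = Module.finrank ℝ (homPoly d ℓ) := by
  refine (Submodule.equivMapOfInjective _ ?_ _).finrank_eq.symm
  intro a b hab
  exact mul_left_cancel₀ (normSqPoly_ne_zero d) hab

theorem harmPoly_sup_radialPoly_le (d ℓ : ℕ) :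
    harmPoly d (ℓ + 2) ⊔ radialPoly d ℓ ≤ homPoly d (ℓ + 2) := by
  refine sup_le inf_le_left ?_
  rintro _ ⟨q, hq, rfl⟩
  have h := (isHomogeneous_normSqPoly d).mul hq
  rwa [add_comm 2 ℓ] at h

instance finite_harmPoly (d ℓ : ℕ) : Module.Finite ℝ (harmPoly d ℓ) :=
  Submodule.finiteDimensional_of_le inf_le_left

/-- The two subspaces meet trivially, and their dimensions add up to at least that of the whole
space. -/
theorem harmPoly_sup_radialPoly {d ℓ : ℕ} (hd : 1 ≤ d)
    (h : ∀ p : Poly d, p.IsHomogeneous ℓ → restrictPoly d p ∈ harmonicSum d ℓ) :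
    harmPoly d (ℓ + 2) ⊔ radialPoly d ℓ = homPoly d (ℓ + 2) := by
  refine Submodule.eq_of_le_of_finrank_le (harmPoly_sup_radialPoly_le d ℓ) ?_
  have h1 := Submodule.finrank_sup_add_finrank_inf_eq (harmPoly d (ℓ + 2)) (radialPoly d ℓ)
  rw [harmPoly_inf_radialPoly hd h, finrank_bot, finrank_radialPoly] at h1
  have h2 := @finrank_homPoly_le d ℓ
  omega

/-- Strong induction in steps of two: split off the harmonic part and drop the factor |x|², which is
1 on the sphere. The hypothesis at ℓ - 2 is used twice, for the splitting itself and for the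
quotient. -/
theorem restrictPoly_mem_harmonicSum {d : ℕ} (hd : 1 ≤ d) (ℓ : ℕ) :
    ∀ p : Poly d, p.IsHomogeneous ℓ → restrictPoly d p ∈ harmonicSum d ℓ := by
  induction ℓ using Nat.strong_induction_on with
  | _ ℓ ih =>
    intro p hp
    by_cases hℓ : ℓ ≤ 1
    · exact harmonicSpace_le_harmonicSum le_rfl
        ⟨p, ⟨hp, polyLaplacian_eq_zero_of_le_one hℓ hp⟩, rfl⟩
    · obtain ⟨k, rfl⟩ : ∃ k, ℓ = k + 2 := ⟨ℓ - 2, by omega⟩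
      have hk := ih k (by omega)
      have hmem : p ∈ harmPoly d (k + 2) ⊔ radialPoly d k := by
        rw [harmPoly_sup_radialPoly hd hk]; exact hp
      obtain ⟨a, ha, _, ⟨q, hq, rfl⟩, rfl⟩ := Submodule.mem_sup.1 hmem
      rw [LinearMap.mulLeft_apply, map_add, restrictPoly_mul, restrictPoly_normSqPoly, one_mul]
      exact Submodule.add_mem _ (harmonicSpace_le_harmonicSum le_rfl ⟨a, ha, rfl⟩)
        (harmonicSum_mono (by omega) (hk q hq))

theorem finrank_harmPoly_add {d : ℕ} (hd : 1 ≤ d) (ℓ : ℕ) :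
    Module.finrank ℝ (harmPoly d (ℓ + 2)) + Module.finrank ℝ (homPoly d ℓ) =
      Module.finrank ℝ (homPoly d (ℓ + 2)) := by
  have h := restrictPoly_mem_harmonicSum hd ℓ
  have h1 := Submodule.finrank_sup_add_finrank_inf_eq (harmPoly d (ℓ + 2)) (radialPoly d ℓ)
  rw [harmPoly_inf_radialPoly hd h, finrank_bot, finrank_radialPoly,
    harmPoly_sup_radialPoly hd h] at h1
  omega

theorem mult_eq (d ℓ : ℕ) : mult d ℓ = Module.finrank ℝ (harmPoly d ℓ) := by
  unfold mult harmonicSpace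
  rw [← LinearMap.range_domRestrict]
  refine LinearMap.finrank_range_of_inj ?_
  rw [← LinearMap.ker_eq_bot, eq_bot_iff]
  intro p hp
  exact Subtype.ext (restrictPoly_injOn p.2.1 hp)

instance finite_harmonicSpace (d ℓ : ℕ) : Module.Finite ℝ (harmonicSpace d ℓ) := by
  unfold harmonicSpace
  infer_instance

theorem finrank_homPoly (d ℓ : ℕ) : Module.finrank ℝ (homPoly d ℓ) = (ℓ + d).choose d := by
  have hs : ({m : Fin (d + 1) →₀ ℕ | m.degree = ℓ} : Set _) =
      (Finset.univ.finsuppAntidiag ℓ : Finset (Fin (d + 1) →₀ ℕ)) := by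
    ext m
    simp [Finsupp.degree_eq_sum]
  have hr : homPoly d ℓ = MvPolynomial.restrictSupport ℝ
      ((Finset.univ.finsuppAntidiag ℓ : Finset (Fin (d + 1) →₀ ℕ)) : Set (Fin (d + 1) →₀ ℕ)) := by
    unfold homPoly
    rw [MvPolynomial.homogeneousSubmodule_eq_finsupp_supported, hs]
    rfl
  rw [hr,
    Module.finrank_eq_card_basis (MvPolynomial.basisRestrictSupport ℝ
      ((Finset.univ.finsuppAntidiag ℓ : Finset (Fin (d + 1) →₀ ℕ)) : Set (Fin (d + 1) →₀ ℕ)))]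
  simp only [Finset.coe_sort_coe, Fintype.card_coe]
  rw [Finset.card_finsuppAntidiag_nat_eq_choose, Finset.card_univ, Fintype.card_fin,
    ← Nat.choose_symm_add]
  congr 1
  omega

/-! ### Multiplicities -/

/-- The number of spherical harmonics of degree at most `L`. -/
def dimLe (d L : ℕ) : ℕ := ∑ ℓ ∈ Finset.range (L + 1), mult d ℓ

theorem mult_zero (d : ℕ) : mult d 0 = 1 := by
  have : harmPoly d 0 = homPoly d 0 :=
    inf_eq_left.2 fun p hp => polyLaplacian_eq_zero_of_le_one (by omega) hp
  rw [mult_eq, this, finrank_homPoly]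
  simp

theorem mult_one (d : ℕ) : mult d 1 = d + 1 := by
  have : harmPoly d 1 = homPoly d 1 :=
    inf_eq_left.2 fun p hp => polyLaplacian_eq_zero_of_le_one (by omega) hp
  rw [mult_eq, this, finrank_homPoly, add_comm]
  simp

theorem mult_add_two {d : ℕ} (hd : 1 ≤ d) (ℓ : ℕ) :
    mult d (ℓ + 2) + (ℓ + d).choose d = (ℓ + 2 + d).choose d := by
  rw [mult_eq, ← finrank_homPoly, ← finrank_homPoly, finrank_harmPoly_add hd]

/-- The multiplicities are differences of binomials two degrees apart, so the sum telescopes and two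
binomials survive. -/
theorem dimLe_succ {d : ℕ} (hd : 1 ≤ d) (L : ℕ) :
    dimLe d (L + 1) = (L + 1 + d).choose d + (L + d).choose d := by
  induction L with
  | zero => simp [dimLe, Finset.sum_range_succ, mult_zero, mult_one, add_comm 1 d]; omega
  | succ L ih =>
    unfold dimLe at *
    rw [Finset.sum_range_succ, ih]
    have := mult_add_two hd L
    have e : L + 1 + 1 + d = L + 2 + d := by omega
    rw [e]
    have e2 : L + 1 + 1 = L + 2 := rfl
    rw [e2]
    omega

theorem choose_le_dimLe {d : ℕ} (hd : 1 ≤ d) (L : ℕ) : (L + d).choose d ≤ dimLe d L := by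
  rcases L with _ | L
  · simp [dimLe, mult_zero]
  · rw [dimLe_succ hd]; omega

theorem pow_le_dimLe {d : ℕ} (hd : 1 ≤ d) (L : ℕ) :
    ((L : ℝ) + 1) ^ d / d.factorial ≤ dimLe d L := by
  have h := Nat.pow_le_choose (α := ℝ) d (L + d)
  have e : L + d + 1 - d = L + 1 := by omega
  rw [e] at h
  push_cast at h
  exact h.trans (by exact_mod_cast choose_le_dimLe hd L)

theorem mult_le {d : ℕ} (hd : 1 ≤ d) (ℓ : ℕ) :
    mult d ℓ ≤ 2 * ((d + 1) * (ℓ + 1)) ^ (d - 1) := by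
  obtain ⟨e, rfl⟩ : ∃ e, d = e + 1 := ⟨d - 1, by omega⟩
  simp only [Nat.add_sub_cancel]
  rcases ℓ with _ | _ | ℓ
  · rw [mult_zero]
    have : 1 ≤ ((e + 1 + 1) * (0 + 1)) ^ e := Nat.one_le_pow _ _ (by omega)
    omega
  · rw [mult_one]
    rcases e with _ | e
    · simp
    · have h : (e + 1 + 1 + 1) * (0 + 1 + 1) ≤ ((e + 1 + 1 + 1) * (0 + 1 + 1)) ^ (e + 1) :=
        Nat.le_self_pow (by omega) _
      omega
  · have h := mult_add_two hd ℓ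
    -- Pascal's rule applied twice writes the multiplicity as two binomials with lower index d - 1,
    -- which gives the exponent d - 1.
    have h1 : (ℓ + 2 + (e + 1)).choose (e + 1) =
        (ℓ + 2 + e).choose e + ((ℓ + 1 + e).choose e + (ℓ + (e + 1)).choose (e + 1)) := by
      have e1 : ℓ + 2 + (e + 1) = (ℓ + 2 + e) + 1 := by omega
      have e2 : ℓ + 2 + e = (ℓ + 1 + e) + 1 := by omega
      have e3 : ℓ + (e + 1) = ℓ + 1 + e := by omega
      rw [e1, Nat.choose_succ_succ, e3]
      congr 1
      rw [e2, Nat.choose_succ_succ]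
    have h2 : (ℓ + 2 + e).choose e ≤ ((e + 1 + 1) * (ℓ + 1 + 1 + 1)) ^ e :=
      (Nat.choose_le_pow _ _).trans (Nat.pow_le_pow_left (by nlinarith) _)
    have h3 : (ℓ + 1 + e).choose e ≤ ((e + 1 + 1) * (ℓ + 1 + 1 + 1)) ^ e :=
      (Nat.choose_le_pow _ _).trans (Nat.pow_le_pow_left (by nlinarith) _)
    have e4 : ℓ + 1 + 1 = ℓ + 2 := rfl
    rw [e4]
    rw [e4] at h2 h3
    omega

theorem dimLe_le {d : ℕ} (hd : 1 ≤ d) (L : ℕ) :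
    dimLe d L ≤ 2 * (d + 1) ^ d * (L + 1) ^ d := by
  obtain ⟨e, rfl⟩ : ∃ e, d = e + 1 := ⟨d - 1, by omega⟩
  calc dimLe (e + 1) L ≤ ∑ ℓ ∈ Finset.range (L + 1), 2 * ((e + 1 + 1) * (L + 1)) ^ e := by
        refine Finset.sum_le_sum fun ℓ hℓ => (mult_le hd ℓ).trans ?_
        have := Finset.mem_range.1 hℓ
        simp only [Nat.add_sub_cancel]
        gcongr
        omega
    _ = 2 * (e + 1 + 1) ^ e * (L + 1) ^ (e + 1) := by
        rw [Finset.sum_const, Finset.card_range, smul_eq_mul, mul_pow]; ring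
    _ ≤ 2 * (e + 1 + 1) ^ (e + 1) * (L + 1) ^ (e + 1) := by
        gcongr
        · omega
        · omega

/-! ### The addition theorem -/

theorem integrable_cont_mul {d : ℕ} (f g : C(Sph d, ℝ)) :
    Integrable (fun x => f x * g x) (unif d) := integrable_cont (f * g)

theorem linearIndependent_harmonics {d : ℕ} {Y : HarmonicFamily d}
    (hY : IsSphericalHarmonicBasis Y) (ℓ : ℕ) : LinearIndependent ℝ (Y ℓ) := by
  rw [Fintype.linearIndependent_iff]
  intro c hc m
  have h : ∫ x, (∑ k, c k • Y ℓ k) x * Y ℓ m x ∂(unif d) = 0 := by rw [hc]; simp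
  simp only [ContinuousMap.sum_apply, ContinuousMap.smul_apply, smul_eq_mul, Finset.sum_mul,
    mul_assoc] at h
  rw [integral_finsetSum _ fun k _ => (integrable_cont_mul (Y ℓ k) (Y ℓ m)).const_mul (c k)] at h
  simpa [integral_const_mul, hY.orthonormal] using h

/-- The Y_{ℓ,m} are independent members of the space and their number is its dimension. -/
theorem span_harmonics {d : ℕ} {Y : HarmonicFamily d} (hY : IsSphericalHarmonicBasis Y) (ℓ : ℕ) :
    Submodule.span ℝ (Set.range (Y ℓ)) = harmonicSpace d ℓ := by
  refine Submodule.eq_of_le_of_finrank_le (Submodule.span_le.2 ?_) ?_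
  · rintro _ ⟨m, rfl⟩
    exact hY.mem ℓ m
  · rw [finrank_span_eq_card (linearIndependent_harmonics hY ℓ), Fintype.card_fin]
    exact le_rfl

theorem eq_sum_harmonics {d : ℕ} {Y : HarmonicFamily d} (hY : IsSphericalHarmonicBasis Y) {ℓ : ℕ}
    {f : C(Sph d, ℝ)} (hf : f ∈ harmonicSpace d ℓ) :
    f = ∑ m, (∫ x, f x * Y ℓ m x ∂(unif d)) • Y ℓ m := by
  rw [← span_harmonics hY, Submodule.mem_span_range_iff_exists_fun] at hf
  obtain ⟨c, rfl⟩ := hf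
  refine Finset.sum_congr rfl fun m _ => ?_
  congr 1
  simp only [ContinuousMap.sum_apply, ContinuousMap.smul_apply, smul_eq_mul, Finset.sum_mul,
    mul_assoc]
  rw [integral_finsetSum _ fun k _ => (integrable_cont_mul (Y ℓ k) (Y ℓ m)).const_mul (c k)]
  simp [integral_const_mul, hY.orthonormal]

/-- Infinitesimal rotations commute with the Laplacian: the two first-order commutator terms are
mixed second derivatives that cancel. So each space of harmonics is stable under them. -/
theorem polyLaplacian_rotGen {d : ℕ} (i j : Fin (d + 1)) {p : Poly d}
    (hp : polyLaplacian d p = 0) : polyLaplacian d (rotGen i j p) = 0 := by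
  classical
  have h : ∀ k, MvPolynomial.pderiv k (MvPolynomial.pderiv k (rotGen i j p)) =
      MvPolynomial.X i * MvPolynomial.pderiv j (MvPolynomial.pderiv k (MvPolynomial.pderiv k p))
      - MvPolynomial.X j * MvPolynomial.pderiv i (MvPolynomial.pderiv k (MvPolynomial.pderiv k p))
      + ((if k = i then 2 * MvPolynomial.pderiv i (MvPolynomial.pderiv j p) else 0)
      - (if k = j then 2 * MvPolynomial.pderiv j (MvPolynomial.pderiv i p) else 0)) := by
    intro k
    simp only [rotGen_apply, map_sub, MvPolynomial.pderiv_mul, map_add, MvPolynomial.pderiv_X]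
    rw [pderiv_comm j k, pderiv_comm i k, pderiv_comm j k, pderiv_comm i k]
    by_cases hi : k = i
    · subst hi
      by_cases hj : k = j
      · subst hj
        simp
      · simp [hj]; ring
    · by_cases hj : k = j
      · subst hj
        simp [hi]; ring
      · simp [hi, hj]
  rw [polyLaplacian_apply] at hp ⊢
  simp only [h, Finset.sum_add_distrib, Finset.sum_sub_distrib, ← Finset.mul_sum, ← map_sum, hp,
    Finset.sum_ite_eq', Finset.mem_univ, if_true, map_zero, mul_zero, pderiv_comm i j p]
  ring

theorem rotGen_isHomogeneous {d ℓ : ℕ} (i j : Fin (d + 1)) {p : Poly d}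
    (hp : p.IsHomogeneous ℓ) : (rotGen i j p).IsHomogeneous ℓ := by
  rcases ℓ with _ | ℓ
  · have hp' := hp
    rw [← MvPolynomial.totalDegree_zero_iff_isHomogeneous,
      MvPolynomial.totalDegree_eq_zero_iff_eq_C] at hp'
    rw [rotGen_apply, hp', MvPolynomial.pderiv_C, MvPolynomial.pderiv_C, mul_zero, mul_zero,
      sub_zero]
    exact MvPolynomial.isHomogeneous_zero _ _ _
  · have h : ∀ a b : Fin (d + 1),
        (MvPolynomial.X a * MvPolynomial.pderiv b p).IsHomogeneous (ℓ + 1) := by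
      intro a b
      have := (MvPolynomial.isHomogeneous_X ℝ a).mul (hp.pderiv (i := b))
      rwa [Nat.add_sub_cancel, add_comm 1 ℓ] at this
    exact (h i j).sub (h j i)

theorem const_mem_harmonicSpace (d : ℕ) (c : ℝ) :
    ContinuousMap.const (Sph d) c ∈ harmonicSpace d 0 := by
  refine ⟨MvPolynomial.C c, ⟨MvPolynomial.isHomogeneous_C _ _,
    polyLaplacian_eq_zero_of_le_one (by omega) (MvPolynomial.isHomogeneous_C _ _)⟩, ?_⟩
  ext x
  simp [restrictPoly_apply]

theorem eq_const_of_mem_harmonicSpace_zero {d : ℕ} {f : C(Sph d, ℝ)}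
    (hf : f ∈ harmonicSpace d 0) : ∃ c : ℝ, f = ContinuousMap.const (Sph d) c := by
  obtain ⟨p, hp, -, rfl⟩ := exists_poly_of_mem_harmonicSpace hf
  rw [← MvPolynomial.totalDegree_zero_iff_isHomogeneous,
    MvPolynomial.totalDegree_eq_zero_iff_eq_C] at hp
  refine ⟨p.coeff 0, ?_⟩
  ext x
  rw [hp, restrictPoly_apply]
  simp

/-- The addition theorem on the diagonal. -/
theorem sum_sq_harmonics {d : ℕ} (hd : 1 ≤ d) {Y : HarmonicFamily d}
    (hY : IsSphericalHarmonicBasis Y) (ℓ : ℕ) (x : Sph d) :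
    ∑ m, Y ℓ m x ^ 2 = mult d ℓ := by
  choose p hp hΔ hpY using fun m => exists_poly_of_mem_harmonicSpace (hY.mem ℓ m)
  set Q : Poly d := ∑ m, p m * p m with hQ
  have hQhom : Q.IsHomogeneous (ℓ + ℓ) :=
    MvPolynomial.IsHomogeneous.sum _ _ _ fun m _ => (hp m).mul (hp m)
  -- A generator acts on the Y_{ℓ,m} of one degree through a matrix A, antisymmetric by integration
  -- by parts. Hence it kills the sum of squares on the sphere.
  have hrot : ∀ i j, restrictPoly d (rotGen i j Q) = 0 := by
    intro i j
    have hmem : ∀ m, restrictPoly d (rotGen i j (p m)) ∈ harmonicSpace d ℓ := fun m =>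
      ⟨_, ⟨rotGen_isHomogeneous i j (hp m), polyLaplacian_rotGen i j (hΔ m)⟩, rfl⟩
    set A : Fin (mult d ℓ) → Fin (mult d ℓ) → ℝ := fun m k =>
      ∫ x, restrictPoly d (rotGen i j (p m)) x * Y ℓ k x ∂(unif d) with hA
    have hanti : ∀ m k, A m k = -A k m := by
      intro m k
      simp only [hA]
      rw [← hpY k, integral_rotGen_mul, hpY m]
      simp only [mul_comm]
    have hexp : ∀ m, restrictPoly d (rotGen i j (p m)) = ∑ k, A m k • Y ℓ k :=
      fun m => eq_sum_harmonics hY (hmem m)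
    ext x
    simp only [hQ, map_sum, Derivation.leibniz, smul_eq_mul, map_add, restrictPoly_mul, hexp, hpY,
      ContinuousMap.sum_apply, ContinuousMap.add_apply, ContinuousMap.mul_apply,
      ContinuousMap.smul_apply, ContinuousMap.zero_apply, Finset.mul_sum, Finset.sum_add_distrib]
    have : ∑ m, ∑ k, Y ℓ m x * (A m k * Y ℓ k x) = -∑ m, ∑ k, Y ℓ m x * (A m k * Y ℓ k x) := by
      conv_lhs => rw [Finset.sum_comm]
      simp only [← Finset.sum_neg_distrib]
      refine Finset.sum_congr rfl fun m _ => Finset.sum_congr rfl fun k _ => ?_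
      rw [hanti k m]; ring
    linarith
  set f := restrictPoly d Q with hf
  -- Moving the Casimir operator from Q to q gives 0 = -2λ_k ∫ Q q, and λ_k ≠ 0 for k ≠ 0. This
  -- replaces transitivity of the rotation group.
  have hpos : ∀ k, k ≠ 0 → ∀ g ∈ harmonicSpace d k, ∫ x, f x * g x ∂(unif d) = 0 := by
    intro k hk g hg
    obtain ⟨q, hq, hqΔ, rfl⟩ := exists_poly_of_mem_harmonicSpace hg
    have h1 := integral_casimir_mul Q q
    have h0 : ∫ x, restrictPoly d (casimir Q) x * restrictPoly d q x ∂(unif d) = 0 := by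
      simp only [casimir, map_sum, ContinuousMap.sum_apply, Finset.sum_mul]
      have hi := fun i j => integrable_cont_mul (restrictPoly d (rotGen i j (rotGen i j Q)))
        (restrictPoly d q)
      rw [integral_finsetSum _ fun i _ => integrable_finsetSum _ fun j _ => hi i j]
      refine Finset.sum_eq_zero fun i _ => ?_
      rw [integral_finsetSum _ fun j _ => hi i j]
      refine Finset.sum_eq_zero fun j _ => ?_
      rw [integral_rotGen_mul, hrot]
      simp
    have hr : ∀ c : ℝ, ∀ x, restrictPoly d Q x * (c * restrictPoly d q x) =
      c * (restrictPoly d Q x * restrictPoly d q x) := fun c x => by ring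
    rw [h0, casimir_eq hq hqΔ] at h1
    simp only [map_smul, ContinuousMap.smul_apply, smul_eq_mul, hr, integral_const_mul] at h1
    have hne : eigenval d k ≠ 0 := by
      have h2 := eigenval_strictMono hd (Nat.pos_of_ne_zero hk)
      have h3 : eigenval d 0 = 0 := by simp [eigenval]
      rw [h3] at h2
      exact h2.ne'
    exact (mul_eq_zero.1 h1.symm).resolve_left (by simpa using hne)
  set c := ∫ x, f x ∂(unif d) with hc
  -- The difference is a sum of harmonics of degree at most 2ℓ and is orthogonal to every such
  -- harmonic, hence to itself.
  have hfc : f - ContinuousMap.const _ c = 0 := by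
    refine eq_zero_of_integral_mul_self _
      (integral_mul_eq_zero_of_forall (N := ℓ + ℓ) (fun k _ g hg => ?_)
        (Submodule.sub_mem _ (restrictPoly_mem_harmonicSum hd _ Q hQhom)
          (harmonicSpace_le_harmonicSum (Nat.zero_le _) (const_mem_harmonicSpace d c))))
    simp only [ContinuousMap.sub_apply, ContinuousMap.const_apply, sub_mul]
    rw [integral_sub (integrable_cont_mul f g) ((integrable_cont g).const_mul c)]
    by_cases hk : k = 0
    · subst hk
      obtain ⟨b, rfl⟩ := eq_const_of_mem_harmonicSpace_zero hg
      simp [integral_mul_const, ← hc]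
    · have h0 := integral_mul_eq_zero_of_ne hd (Ne.symm hk) (const_mem_harmonicSpace d c) hg
      simp only [ContinuousMap.const_apply] at h0
      rw [hpos k hk g hg, h0, sub_zero]
  have hfx : ∀ x, f x = ∑ m, Y ℓ m x ^ 2 := by
    intro x
    simp only [hf, hQ, map_sum, restrictPoly_mul, hpY, ContinuousMap.sum_apply,
      ContinuousMap.mul_apply, sq]
  have hcm : c = mult d ℓ := by
    simp only [hc, hfx, sq]
    rw [integral_finsetSum _ fun m _ => integrable_cont_mul (Y ℓ m) (Y ℓ m)]
    simp [hY.orthonormal]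
  have := congrArg (fun g : C(Sph d, ℝ) => g x) hfc
  simp only [ContinuousMap.sub_apply, ContinuousMap.const_apply, ContinuousMap.zero_apply] at this
  rw [← hfx, ← hcm]
  linarith

/-! ### The harmonic Hilbert basis of `L²` -/

/-- The class in `L²` of a continuous function. -/
abbrev toL2 {d : ℕ} : C(Sph d, ℝ) →L[ℝ] L2 d := ContinuousMap.toLp (E := ℝ) 2 (unif d) ℝ

/-- The class in `L²` of a spherical harmonic. -/
def vec {d : ℕ} (Y : HarmonicFamily d) (s : (ℓ : ℕ) × Fin (mult d ℓ)) : L2 d := toL2 (Y s.1 s.2)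

theorem inner_toL2 {d : ℕ} (g : C(Sph d, ℝ)) (f : L2 d) :
    inner ℝ (toL2 g) f = ∫ x, f x * g x ∂(unif d) := by
  rw [L2.inner_def]
  refine integral_congr_ae ?_
  filter_upwards [ContinuousMap.coeFn_toLp (p := 2) (𝕜 := ℝ) (unif d) g] with x hx
  rw [hx]
  simp

theorem coeff_eq_inner {d : ℕ} (Y : HarmonicFamily d) (f : L2 d)
    (s : (ℓ : ℕ) × Fin (mult d ℓ)) : coeff Y f s.1 s.2 = inner ℝ (vec Y s) f :=
  (inner_toL2 _ _).symm

theorem inner_toL2_toL2 {d : ℕ} (g f : C(Sph d, ℝ)) :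
    inner ℝ (toL2 g) (toL2 f) = ∫ x, f x * g x ∂(unif d) := by
  rw [ContinuousMap.inner_toLp]
  simp

theorem orthonormal_vec {d : ℕ} (hd : 1 ≤ d) {Y : HarmonicFamily d}
    (hY : IsSphericalHarmonicBasis Y) : Orthonormal ℝ (vec Y) := by
  classical
  rw [orthonormal_iff_ite]
  rintro ⟨k, m⟩ ⟨ℓ, m'⟩
  unfold vec
  rw [inner_toL2_toL2]
  by_cases hkl : k = ℓ
  · subst hkl
    simp only [hY.orthonormal, Sigma.mk.injEq, heq_eq_eq, true_and, eq_comm]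
  · rw [integral_mul_eq_zero_of_ne hd (Ne.symm hkl) (hY.mem _ _) (hY.mem _ _), if_neg]
    intro h
    exact hkl (congrArg Sigma.fst h)

theorem separatesPoints_range_aeval (d : ℕ) :
    (MvPolynomial.aeval (R := ℝ) (coord d)).range.SeparatesPoints := by
  intro x y hxy
  obtain ⟨k, hk⟩ : ∃ k, (x : EuclideanSpace ℝ (Fin (d + 1))) k ≠ (y : EuclideanSpace ℝ _) k := by
    by_contra! h
    exact hxy (Subtype.ext (PiLp.ext h))
  exact ⟨coord d k, ⟨coord d k, ⟨MvPolynomial.X k, by simp⟩, rfl⟩, hk⟩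

theorem restrictPoly_mem_span {d : ℕ} (hd : 1 ≤ d) {Y : HarmonicFamily d}
    (hY : IsSphericalHarmonicBasis Y) (p : Poly d) :
    restrictPoly d p ∈ Submodule.span ℝ
      (Set.range fun s : (ℓ : ℕ) × Fin (mult d ℓ) => Y s.1 s.2) := by
  have hle : ∀ N, harmonicSum d N ≤ Submodule.span ℝ
      (Set.range fun s : (ℓ : ℕ) × Fin (mult d ℓ) => Y s.1 s.2) := by
    intro N
    refine iSup₂_le fun k _ => ?_
    rw [← span_harmonics hY]
    refine Submodule.span_mono ?_
    rintro _ ⟨m, rfl⟩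
    exact ⟨⟨k, m⟩, rfl⟩
  rw [← MvPolynomial.sum_homogeneousComponent p, map_sum]
  exact Submodule.sum_mem _ fun k _ => hle k
    (restrictPoly_mem_harmonicSum hd k _ (MvPolynomial.homogeneousComponent_isHomogeneous k p))

/-- Restricted polynomials are dense in the continuous functions by Stone-Weierstrass, continuous
functions are dense in L², and every restricted polynomial is a finite sum of harmonics. -/
theorem top_le_closure_span_vec {d : ℕ} (hd : 1 ≤ d) {Y : HarmonicFamily d}
    (hY : IsSphericalHarmonicBasis Y) :
    ⊤ ≤ (Submodule.span ℝ (Set.range (vec Y))).topologicalClosure := by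
  have h1 : (Submodule.span ℝ
      (Set.range fun s : (ℓ : ℕ) × Fin (mult d ℓ) => Y s.1 s.2)).topologicalClosure = ⊤ := by
    have h2 := ContinuousMap.subalgebra_topologicalClosure_eq_top_of_separatesPoints _
      (separatesPoints_range_aeval d)
    rw [eq_top_iff]
    intro f _
    have hf : f ∈ (MvPolynomial.aeval (R := ℝ) (coord d)).range.topologicalClosure := by
      rw [h2]; trivial
    refine closure_mono ?_ hf
    rintro _ ⟨p, rfl⟩
    exact restrictPoly_mem_span hd hY p
  have h3 := (ContinuousMap.toLp_denseRange ℝ (unif d) ℝ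
    (p := 2) (by simp)).topologicalClosure_map_submodule h1
  refine le_of_eq ?_
  rw [← h3, Submodule.map_span, ← Set.range_comp]
  rfl

/-- The Hilbert basis of `L²` formed by the spherical harmonics. -/
def harmonicBasis {d : ℕ} (hd : 1 ≤ d) {Y : HarmonicFamily d}
    (hY : IsSphericalHarmonicBasis Y) : HilbertBasis ((ℓ : ℕ) × Fin (mult d ℓ)) ℝ (L2 d) :=
  HilbertBasis.mk (orthonormal_vec hd hY) (top_le_closure_span_vec hd hY)

theorem hasSum_coeff_sq {d : ℕ} (hd : 1 ≤ d) {Y : HarmonicFamily d}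
    (hY : IsSphericalHarmonicBasis Y) (f : L2 d) :
    HasSum (fun s : (ℓ : ℕ) × Fin (mult d ℓ) => coeff Y f s.1 s.2 ^ 2) (‖f‖ ^ 2) := by
  have h := (harmonicBasis hd hY).hasSum_inner_mul_inner f f
  simp only [harmonicBasis, HilbertBasis.coe_mk, real_inner_self_eq_norm_sq] at h
  refine h.congr_fun fun s => ?_
  rw [coeff_eq_inner, sq, real_inner_comm]

theorem tsum_coeff_sq {d : ℕ} (hd : 1 ≤ d) {Y : HarmonicFamily d}
    (hY : IsSphericalHarmonicBasis Y) (f : L2 d) :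
    ∑' ℓ : ℕ, ENNReal.ofReal (∑ m, coeff Y f ℓ m ^ 2) = ENNReal.ofReal (‖f‖ ^ 2) := by
  have h := hasSum_coeff_sq hd hY f
  have h1 : HasSum (fun ℓ : ℕ => ∑ m, coeff Y f ℓ m ^ 2) (‖f‖ ^ 2) :=
    h.sigma fun ℓ => hasSum_fintype _
  rw [← h1.tsum_eq, ENNReal.ofReal_tsum_of_nonneg
    (fun ℓ => Finset.sum_nonneg fun m _ => sq_nonneg _) h1.summable]

/-! ### Truncated expansions and Sobolev balls -/

/-- Indices of the spherical harmonics of degree at most `L`. -/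
abbrev Idx (d L : ℕ) : Type := (i : Fin (L + 1)) × Fin (mult d i)

theorem sum_idx {d L : ℕ} {M : Type*} [AddCommMonoid M] (F : (ℓ : ℕ) → Fin (mult d ℓ) → M) :
    ∑ i : Idx d L, F i.1 i.2 = ∑ ℓ ∈ Finset.range (L + 1), ∑ m, F ℓ m := by
  rw [Fintype.sum_sigma, Fin.sum_univ_eq_sum_range (fun ℓ => ∑ m, F ℓ m)]

theorem card_idx (d L : ℕ) : Fintype.card (Idx d L) = dimLe d L := by
  have h := sum_idx (d := d) (L := L) (fun _ _ => 1)
  simpa [dimLe] using h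

/-- The harmonic coefficients of degree at most `L`. -/
def trunc {d : ℕ} (Y : HarmonicFamily d) (f : L2 d) (L : ℕ) : Coeffs d L :=
  fun i => coeff Y f i.1 i.2

/-- The part of `f` of degree more than `L`. -/
def remainder {d : ℕ} (Y : HarmonicFamily d) (L : ℕ) (f : L2 d) : L2 d :=
  f - toL2 (synth Y (trunc Y f L))

theorem toL2_synth {d L : ℕ} (Y : HarmonicFamily d) (a : Coeffs d L) :
    toL2 (synth Y a) = ∑ i, a i • vec Y ⟨i.1, i.2⟩ := by
  simp [synth, vec, map_sum]

theorem coeff_sub {d : ℕ} (Y : HarmonicFamily d) (f g : L2 d) (ℓ : ℕ) (m : Fin (mult d ℓ)) :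
    coeff Y (f - g) ℓ m = coeff Y f ℓ m - coeff Y g ℓ m := by
  have := fun f => coeff_eq_inner Y f ⟨ℓ, m⟩
  simp only at this
  rw [this, this, this, inner_sub_right]

theorem coeff_toL2_synth {d L : ℕ} (hd : 1 ≤ d) {Y : HarmonicFamily d}
    (hY : IsSphericalHarmonicBasis Y) (a : Coeffs d L) (i : Idx d L) :
    coeff Y (toL2 (synth Y a)) i.1 i.2 = a i := by
  classical
  rw [coeff_eq_inner Y _ ⟨i.1, i.2⟩, toL2_synth, inner_sum, Finset.sum_eq_single i]
  · rw [inner_smul_right, real_inner_self_eq_norm_sq, (orthonormal_vec hd hY).1]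
    simp
  · rintro j - hj
    rw [inner_smul_right, (orthonormal_vec hd hY).2, mul_zero]
    intro h
    apply hj
    rcases i with ⟨⟨i, hi⟩, m⟩
    rcases j with ⟨⟨j, hj'⟩, m'⟩
    simp only [Sigma.mk.injEq] at h
    obtain ⟨rfl, h⟩ := h
    rw [eq_of_heq h]
  · simp

theorem coeff_toL2_synth_of_lt {d L : ℕ} (hd : 1 ≤ d) {Y : HarmonicFamily d}
    (hY : IsSphericalHarmonicBasis Y) (a : Coeffs d L) {ℓ : ℕ} (hℓ : L < ℓ)
    (m : Fin (mult d ℓ)) : coeff Y (toL2 (synth Y a)) ℓ m = 0 := by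
  rw [coeff_eq_inner Y _ ⟨ℓ, m⟩, toL2_synth, inner_sum]
  refine Finset.sum_eq_zero fun i _ => ?_
  rw [inner_smul_right, (orthonormal_vec hd hY).2, mul_zero]
  intro h
  have h1 : ℓ = i.1 := congrArg Sigma.fst h
  have := i.1.2
  omega

theorem coeff_remainder {d L : ℕ} (hd : 1 ≤ d) {Y : HarmonicFamily d}
    (hY : IsSphericalHarmonicBasis Y) (f : L2 d) (ℓ : ℕ) (m : Fin (mult d ℓ)) :
    coeff Y (remainder Y L f) ℓ m = if ℓ ≤ L then 0 else coeff Y f ℓ m := by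
  unfold remainder
  rw [coeff_sub]
  split_ifs with h
  · have := coeff_toL2_synth hd hY (trunc Y f L) ⟨⟨ℓ, Nat.lt_succ_of_le h⟩, m⟩
    simp only [trunc] at this ⊢
    rw [this, sub_self]
  · rw [coeff_toL2_synth_of_lt hd hY _ (not_le.1 h), sub_zero]

theorem norm_toL2_synth_sq {d L : ℕ} (hd : 1 ≤ d) {Y : HarmonicFamily d}
    (hY : IsSphericalHarmonicBasis Y) (a : Coeffs d L) :
    ‖toL2 (synth Y a)‖ ^ 2 = ∑ i, a i ^ 2 := by
  rw [← real_inner_self_eq_norm_sq]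
  nth_rw 1 [toL2_synth]
  rw [sum_inner]
  refine Finset.sum_congr rfl fun i _ => ?_
  rw [real_inner_smul_left, ← coeff_eq_inner Y _ ⟨i.1, i.2⟩, coeff_toL2_synth hd hY, sq]

/-- Pythagoras: the error splits into an error in the coefficients of degree at most L and the
truncation bias. -/
theorem norm_toL2_synth_sub_sq {d L : ℕ} (hd : 1 ≤ d) {Y : HarmonicFamily d}
    (hY : IsSphericalHarmonicBasis Y) (a : Coeffs d L) (f : L2 d) :
    ‖toL2 (synth Y a) - f‖ ^ 2 =
      ∑ i, (a i - trunc Y f L i) ^ 2 + ‖remainder Y L f‖ ^ 2 := by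
  have h1 : toL2 (synth Y a) - f = toL2 (synth Y (a - trunc Y f L)) - remainder Y L f := by
    have : synth Y (a - trunc Y f L) = synth Y a - synth Y (trunc Y f L) := by
      simp [synth, sub_smul, Finset.sum_sub_distrib]
    rw [this, map_sub, remainder]
    abel
  have h2 : inner ℝ (toL2 (synth Y (a - trunc Y f L))) (remainder Y L f) = 0 := by
    rw [toL2_synth, sum_inner]
    refine Finset.sum_eq_zero fun i _ => ?_
    rw [real_inner_smul_left, ← coeff_eq_inner Y _ ⟨i.1, i.2⟩, coeff_remainder hd hY,
      if_pos (Nat.lt_succ_iff.1 i.1.2), mul_zero]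
  rw [h1, norm_sub_sq_real, h2, norm_toL2_synth_sq hd hY]
  simp

theorem sum_sq_coeff_sub_le {d L : ℕ} (hd : 1 ≤ d) {Y : HarmonicFamily d}
    (hY : IsSphericalHarmonicBasis Y) (a : Coeffs d L) (f : L2 d) :
    ∑ i : Idx d L, (coeff Y f i.1 i.2 - a i) ^ 2 ≤ ‖f - toL2 (synth Y a)‖ ^ 2 := by
  rw [norm_sub_rev, norm_toL2_synth_sub_sq hd hY]
  refine le_add_of_le_of_nonneg (le_of_eq (Finset.sum_congr rfl fun i _ => ?_)) (sq_nonneg _)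
  unfold trunc
  ring

/-! ### Eigenvalue bounds and truncation in Sobolev balls -/

theorem eigenval_nonneg {d : ℕ} (hd : 1 ≤ d) (ℓ : ℕ) : 0 ≤ eigenval d ℓ := by
  have h2 : (1 : ℝ) ≤ d := by exact_mod_cast hd
  have h3 : (0 : ℝ) ≤ ℓ := ℓ.cast_nonneg
  unfold eigenval
  exact mul_nonneg h3 (by linarith)

theorem sq_le_eigenval {d : ℕ} (hd : 1 ≤ d) (ℓ : ℕ) : (ℓ : ℝ) ^ 2 ≤ eigenval d ℓ := by
  have h2 : (1 : ℝ) ≤ d := by exact_mod_cast hd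
  have h3 : (0 : ℝ) ≤ ℓ := ℓ.cast_nonneg
  unfold eigenval
  nlinarith

theorem one_add_eigenval_le {d : ℕ} (hd : 1 ≤ d) (ℓ : ℕ) :
    1 + eigenval d ℓ ≤ (d + 1) * ((ℓ : ℝ) + 1) ^ 2 := by
  have h2 : (1 : ℝ) ≤ d := by exact_mod_cast hd
  have h3 : (0 : ℝ) ≤ ℓ := ℓ.cast_nonneg
  unfold eigenval
  nlinarith [mul_nonneg h3 h3, mul_nonneg (mul_nonneg h3 h3) (by linarith : (0 : ℝ) ≤ d),
    mul_nonneg h3 (by linarith : (0 : ℝ) ≤ d)]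

theorem one_add_eigenval_pos {d : ℕ} (hd : 1 ≤ d) (ℓ : ℕ) : 0 < 1 + eigenval d ℓ := by
  have := eigenval_nonneg hd ℓ
  linarith

/-- Every coefficient that survives has degree at least L + 1, so its Sobolev weight is at least (1
+ λ_{L+1})^β. -/
theorem tsum_remainder_le {d L : ℕ} (hd : 1 ≤ d) {Y : HarmonicFamily d}
    (hY : IsSphericalHarmonicBasis Y) {β R : ℝ} (hβ : 0 ≤ β) {f : L2 d}
    (hf : f ∈ sobolevBall Y β R) :
    ‖remainder Y L f‖ ^ 2 ≤ R ^ 2 * (1 + eigenval d (L + 1)) ^ (-β) := by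
  have hpos := fun ℓ => one_add_eigenval_pos hd ℓ
  rw [← ENNReal.ofReal_le_ofReal_iff (mul_nonneg (sq_nonneg _) (Real.rpow_nonneg (hpos _).le _)),
    ← tsum_coeff_sq hd hY, mul_comm, ENNReal.ofReal_mul (Real.rpow_nonneg (hpos _).le _)]
  refine le_trans ?_ (mul_le_mul_right hf _)
  unfold sobolevNormSq
  rw [← ENNReal.tsum_mul_left]
  refine ENNReal.tsum_le_tsum fun ℓ => ?_
  rw [← ENNReal.ofReal_mul (Real.rpow_nonneg (hpos _).le _)]
  refine ENNReal.ofReal_le_ofReal ?_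
  simp only [coeff_remainder hd hY]
  have hs : 0 ≤ ∑ m, coeff Y f ℓ m ^ 2 := Finset.sum_nonneg fun m _ => sq_nonneg _
  split_ifs with h
  · simp only [ne_eq, OfNat.ofNat_ne_zero, not_false_eq_true, zero_pow, Finset.sum_const_zero]
    have := Real.rpow_nonneg (hpos (L + 1)).le (-β)
    have := Real.rpow_nonneg (hpos ℓ).le β
    positivity
  · have h1 : (1 + eigenval d (L + 1)) ^ β ≤ (1 + eigenval d ℓ) ^ β := by
      refine Real.rpow_le_rpow (hpos _).le ?_ hβ
      have := (eigenval_strictMono hd).monotone (show L + 1 ≤ ℓ by omega)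
      linarith
    rw [← mul_assoc]
    refine le_mul_of_one_le_left hs ?_
    rw [Real.rpow_neg (hpos _).le, ← div_eq_inv_mul, one_le_div (Real.rpow_pos_of_pos (hpos _) _)]
    exact h1

/-- Under the regression likelihood the remainder plays the part of the regression function in the
score, so the bounds for the ball must apply to it. -/
theorem remainder_mem_sobolevBall {d : ℕ} (L : ℕ) (hd : 1 ≤ d) {Y : HarmonicFamily d}
    (hY : IsSphericalHarmonicBasis Y) {β R : ℝ} {f : L2 d}
    (hf : f ∈ sobolevBall Y β R) : remainder Y L f ∈ sobolevBall Y β R := by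
  refine le_trans (ENNReal.tsum_le_tsum fun ℓ => ENNReal.ofReal_le_ofReal ?_) hf
  have hp := Real.rpow_nonneg (one_add_eigenval_pos hd ℓ).le β
  refine mul_le_mul_of_nonneg_left (Finset.sum_le_sum fun m _ => ?_) hp
  rw [coeff_remainder hd hY]
  split_ifs
  · simpa using sq_nonneg _
  · exact le_rfl

theorem sum_weighted_coeff_le {d : ℕ} (L : ℕ) (hd : 1 ≤ d) {Y : HarmonicFamily d}
    {β R : ℝ} {f : L2 d} (hf : f ∈ sobolevBall Y β R) :
    ∑ i : Idx d L, (1 + eigenval d i.1) ^ β * coeff Y f i.1 i.2 ^ 2 ≤ R ^ 2 := by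
  rw [sum_idx fun ℓ m => (1 + eigenval d ℓ) ^ β * coeff Y f ℓ m ^ 2]
  have h0 : ∀ ℓ, 0 ≤ ∑ m, (1 + eigenval d ℓ) ^ β * coeff Y f ℓ m ^ 2 := fun ℓ =>
    Finset.sum_nonneg fun m _ =>
      mul_nonneg (Real.rpow_nonneg (one_add_eigenval_pos hd ℓ).le β) (sq_nonneg _)
  rw [← ENNReal.ofReal_le_ofReal_iff (sq_nonneg _), ENNReal.ofReal_sum_of_nonneg fun ℓ _ => h0 ℓ]
  refine le_trans ?_ hf
  simp only [← Finset.mul_sum]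
  exact ENNReal.sum_le_tsum _

theorem norm_sq_le_of_mem_sobolevBall {d : ℕ} (hd : 1 ≤ d) {Y : HarmonicFamily d}
    (hY : IsSphericalHarmonicBasis Y) {β R : ℝ} (hβ : 0 ≤ β) {f : L2 d}
    (hf : f ∈ sobolevBall Y β R) : ‖f‖ ^ 2 ≤ R ^ 2 := by
  rw [← ENNReal.ofReal_le_ofReal_iff (sq_nonneg _), ← tsum_coeff_sq hd hY]
  refine le_trans (ENNReal.tsum_le_tsum fun ℓ => ENNReal.ofReal_le_ofReal ?_) hf
  refine le_mul_of_one_le_left (Finset.sum_nonneg fun m _ => sq_nonneg _) ?_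
  refine Real.one_le_rpow ?_ hβ
  have := eigenval_nonneg hd ℓ
  linarith

/-! ### The Sobolev embedding -/

/-- The squared norm of the embedding of `H^β` into `L^∞`. -/
def embConst (d : ℕ) (β : ℝ) : ℝ := ∑' ℓ, (1 + eigenval d ℓ) ^ (-β) * mult d ℓ

/-- The terms are of order at most ℓ^(d-1-2β), summable precisely because β > d/2. -/
theorem summable_embConst {d : ℕ} (hd : 1 ≤ d) {β : ℝ} (hβ : (d : ℝ) / 2 < β) :
    Summable fun ℓ => (1 + eigenval d ℓ) ^ (-β) * mult d ℓ := by
  have hβ0 : 0 < β := lt_of_le_of_lt (by positivity) hβ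
  have hs : Summable fun ℓ : ℕ => (2 : ℝ) ^ β * (2 * (d + 1) ^ (d - 1)) *
      (((ℓ + 1 : ℕ) : ℝ) ^ ((d : ℝ) - 1 - 2 * β)) := by
    refine Summable.mul_left _ ?_
    rw [summable_nat_add_iff 1 (f := fun ℓ : ℕ => (ℓ : ℝ) ^ ((d : ℝ) - 1 - 2 * β))]
    exact Real.summable_nat_rpow.2 (by linarith)
  refine Summable.of_nonneg_of_le (fun ℓ => mul_nonneg
    (Real.rpow_nonneg (one_add_eigenval_pos hd ℓ).le _) (Nat.cast_nonneg _)) (fun ℓ => ?_) hs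
  have hℓ : (0 : ℝ) < (ℓ + 1 : ℕ) := by positivity
  have h1 : ((ℓ + 1 : ℕ) : ℝ) ^ 2 / 2 ≤ 1 + eigenval d ℓ := by
    have := sq_le_eigenval hd ℓ
    push_cast
    nlinarith [sq_nonneg ((ℓ : ℝ) - 1)]
  have h2 : (1 + eigenval d ℓ) ^ (-β) ≤ 2 ^ β * ((ℓ + 1 : ℕ) : ℝ) ^ (-2 * β) := by
    refine (Real.rpow_le_rpow_of_nonpos (by positivity) h1 (by linarith)).trans (le_of_eq ?_)
    rw [Real.div_rpow (sq_nonneg _) (by norm_num), Real.rpow_neg (by norm_num : (0 : ℝ) ≤ 2),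
      div_inv_eq_mul, mul_comm, ← Real.rpow_natCast, ← Real.rpow_mul hℓ.le]
    congr 2
    push_cast
    ring
  have h3 : (mult d ℓ : ℝ) ≤ 2 * (d + 1) ^ (d - 1) * ((ℓ + 1 : ℕ) : ℝ) ^ ((d : ℝ) - 1) := by
    have h := mult_le hd ℓ
    have h' : (mult d ℓ : ℝ) ≤ 2 * ((d + 1) * ((ℓ + 1 : ℕ) : ℝ)) ^ (d - 1) := by exact_mod_cast h
    refine h'.trans (le_of_eq ?_)
    have : ((d : ℝ) - 1) = ((d - 1 : ℕ) : ℝ) := by rw [Nat.cast_sub hd]; simp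
    rw [mul_pow, this, Real.rpow_natCast]
    ring
  calc (1 + eigenval d ℓ) ^ (-β) * mult d ℓ
      ≤ (2 ^ β * ((ℓ + 1 : ℕ) : ℝ) ^ (-2 * β)) *
        (2 * (d + 1) ^ (d - 1) * ((ℓ + 1 : ℕ) : ℝ) ^ ((d : ℝ) - 1)) := by
        refine mul_le_mul h2 h3 (Nat.cast_nonneg _) (by positivity)
    _ = _ := by
        have : (d : ℝ) - 1 - 2 * β = -2 * β + ((d : ℝ) - 1) := by ring
        rw [this, Real.rpow_add hℓ]
        ring

theorem synth_apply {d L : ℕ} (Y : HarmonicFamily d) (a : Coeffs d L) (x : Sph d) :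
    synth Y a x = ∑ i, a i * Y i.1 i.2 x := by
  simp [synth]

/-- Cauchy-Schwarz with weights (1 + λ_ℓ)^(±β/2). One factor is bounded by the Sobolev norm; the
addition theorem turns the other into a partial sum of `embConst`. -/
theorem synth_trunc_sq_le {d : ℕ} (L : ℕ) (hd : 1 ≤ d) {Y : HarmonicFamily d}
    (hY : IsSphericalHarmonicBasis Y) {β R : ℝ} (hβ : (d : ℝ) / 2 < β) {f : L2 d}
    (hf : f ∈ sobolevBall Y β R) (x : Sph d) :
    synth Y (trunc Y f L) x ^ 2 ≤ R ^ 2 * embConst d β := by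
  have hpos := fun ℓ => one_add_eigenval_pos hd ℓ
  have hcs := Finset.sum_mul_sq_le_sq_mul_sq Finset.univ
    (fun i : Idx d L => (1 + eigenval d i.1) ^ (β / 2) * coeff Y f i.1 i.2)
    (fun i => (1 + eigenval d i.1) ^ (-β / 2) * Y i.1 i.2 x)
  have e1 : ∀ i : Idx d L, (1 + eigenval d i.1) ^ (β / 2) * coeff Y f i.1 i.2 *
      ((1 + eigenval d i.1) ^ (-β / 2) * Y i.1 i.2 x) = trunc Y f L i * Y i.1 i.2 x := by
    intro i
    have : (1 + eigenval d i.1) ^ (β / 2) * (1 + eigenval d i.1) ^ (-β / 2) = 1 := by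
      rw [← Real.rpow_add (hpos _)]; ring_nf; simp
    unfold trunc
    linear_combination (coeff Y f i.1 i.2 * Y i.1 i.2 x) * this
  have e2 : ∀ (ℓ : ℕ) (γ : ℝ), ((1 + eigenval d ℓ) ^ (γ / 2)) ^ 2 = (1 + eigenval d ℓ) ^ γ := by
    intro ℓ γ
    rw [← Real.rpow_natCast, ← Real.rpow_mul (hpos _).le]
    congr 1
    push_cast
    ring
  simp only [e1, mul_pow, e2, ← synth_apply] at hcs
  refine hcs.trans (mul_le_mul (sum_weighted_coeff_le L hd hf) ?_
    (Finset.sum_nonneg fun i _ => mul_nonneg (Real.rpow_nonneg (hpos _).le _) (sq_nonneg _))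
    (sq_nonneg _))
  rw [sum_idx fun ℓ m => (1 + eigenval d ℓ) ^ (-β) * Y ℓ m x ^ 2]
  simp only [← Finset.mul_sum, sum_sq_harmonics hd hY]
  exact (summable_embConst hd hβ).sum_le_tsum _ fun ℓ _ => mul_nonneg
    (Real.rpow_nonneg (one_add_eigenval_pos hd ℓ).le _) (Nat.cast_nonneg _)

theorem tendsto_remainder {d : ℕ} (hd : 1 ≤ d) {Y : HarmonicFamily d}
    (hY : IsSphericalHarmonicBasis Y) {β R : ℝ} (hβ : 0 < β) {f : L2 d}
    (hf : f ∈ sobolevBall Y β R) : Tendsto (fun L => remainder Y L f) atTop (𝓝 0) := by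
  rw [tendsto_zero_iff_norm_tendsto_zero]
  have h1 : Tendsto (fun L : ℕ => R ^ 2 * (1 + eigenval d (L + 1)) ^ (-β)) atTop (𝓝 0) := by
    have h2 : Tendsto (fun L : ℕ => 1 + eigenval d (L + 1)) atTop atTop := by
      refine tendsto_atTop_mono (fun L => ?_) tendsto_natCast_atTop_atTop
      have h := sq_le_eigenval hd (L + 1)
      push_cast at h
      nlinarith [(Nat.cast_nonneg L : (0 : ℝ) ≤ L)]
    simpa using ((tendsto_rpow_neg_atTop hβ).comp h2).const_mul (R ^ 2)
  have h3 := squeeze_zero (fun L => sq_nonneg _) (fun L => tsum_remainder_le hd hY hβ.le hf) h1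
  have h4 := (Real.continuous_sqrt.tendsto 0).comp h3
  simpa [Function.comp_def, Real.sqrt_sq] using h4

/-- The Sobolev embedding of `H^β` into `L^∞` for `β > d / 2`. -/
theorem ae_sq_le_of_mem_sobolevBall {d : ℕ} (hd : 1 ≤ d) {Y : HarmonicFamily d}
    (hY : IsSphericalHarmonicBasis Y) {β R : ℝ} (hβ : (d : ℝ) / 2 < β) {f : L2 d}
    (hf : f ∈ sobolevBall Y β R) : ∀ᵐ x ∂(unif d), f x ^ 2 ≤ R ^ 2 * embConst d β := by
  have hβ0 : 0 < β := lt_of_le_of_lt (by positivity) hβ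
  have h1 : Tendsto (fun L => toL2 (synth Y (trunc Y f L))) atTop (𝓝 f) := by
    have := (tendsto_const_nhds (x := f)).sub (tendsto_remainder hd hY hβ0 hf)
    simpa [remainder] using this
  -- L² convergence gives almost everywhere convergence along a subsequence, and the uniform bound
  -- on truncations passes to the limit.
  obtain ⟨ns, -, hns⟩ := (tendstoInMeasure_of_tendsto_Lp h1).exists_seq_tendsto_ae
  have h2 : ∀ᵐ x ∂(unif d), ∀ L, toL2 (synth Y (trunc Y f L)) x = synth Y (trunc Y f L) x :=
    ae_all_iff.2 fun L => ContinuousMap.coeFn_toLp (p := 2) (𝕜 := ℝ) (unif d) _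
  filter_upwards [hns, h2] with x hx hx2
  refine le_of_tendsto (hx.pow 2) (Eventually.of_forall fun k => ?_)
  rw [hx2]
  exact synth_trunc_sq_le _ hd hY hβ hf x

theorem sum_idx_sq {d : ℕ} (L : ℕ) (hd : 1 ≤ d) {Y : HarmonicFamily d}
    (hY : IsSphericalHarmonicBasis Y) (x : Sph d) :
    ∑ i : Idx d L, Y i.1 i.2 x ^ 2 = dimLe d L := by
  rw [sum_idx fun ℓ m => Y ℓ m x ^ 2]
  simp only [sum_sq_harmonics hd hY, dimLe, Nat.cast_sum]

/-! ### Product measures -/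

theorem measurePreserving_cons {n : ℕ} {X : Type*} {mX : MeasurableSpace X}
    (μ : Fin (n + 1) → Measure X) [∀ i, SigmaFinite (μ i)] :
    MeasurePreserving (fun z : X × (Fin n → X) => (Fin.cons z.1 z.2 : Fin (n + 1) → X))
      ((μ 0).prod (Measure.pi fun i => μ i.succ)) (Measure.pi μ) := by
  have h := (measurePreserving_piFinSuccAbove μ 0).symm
  have e : ⇑(MeasurableEquiv.piFinSuccAbove (fun _ : Fin (n + 1) => X) 0).symm =
      fun z : X × (Fin n → X) => (Fin.cons z.1 z.2 : Fin (n + 1) → X) := by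
    funext z
    exact Fin.insertNth_zero' z.1 z.2
  rw [e] at h
  exact h

theorem lintegral_pi_fin_prod {n : ℕ} {X : Type*} {mX : MeasurableSpace X}
    {μ : Fin n → Measure X} [∀ i, SigmaFinite (μ i)] {f : Fin n → X → ℝ≥0∞}
    (hf : ∀ i, Measurable (f i)) :
    ∫⁻ x, ∏ i, f i (x i) ∂(Measure.pi μ) = ∏ i, ∫⁻ x, f i x ∂(μ i) := by
  induction n with
  | zero => simp
  | succ n ih =>
    have hm : ∀ (m : ℕ) (g : Fin m → X → ℝ≥0∞), (∀ i, Measurable (g i)) →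
        Measurable fun x : Fin m → X => ∏ i, g i (x i) := fun m g hg =>
      Finset.measurable_fun_prod _ fun i _ => (hg i).comp (measurable_pi_apply i)
    rw [← (measurePreserving_cons μ).lintegral_comp (hm _ _ hf)]
    simp only [Fin.prod_univ_succ, Fin.cons_zero, Fin.cons_succ]
    rw [lintegral_prod_mul (f := f 0) (g := fun x : Fin n → X => ∏ i : Fin n, f i.succ (x i))
      (hf 0).aemeasurable (hm _ _ fun i => hf i.succ).aemeasurable, ih fun i => hf i.succ]

theorem lintegral_pi_prod {ι : Type*} [Fintype ι] {X : Type*}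
    {mX : MeasurableSpace X}
    {μ : ι → Measure X} [∀ i, SigmaFinite (μ i)] {f : ι → X → ℝ≥0∞}
    (hf : ∀ i, Measurable (f i)) :
    ∫⁻ x, ∏ i, f i (x i) ∂(Measure.pi μ) = ∏ i, ∫⁻ x, f i x ∂(μ i) := by
  let e := (Fintype.equivFin ι).symm
  rw [← (measurePreserving_piCongrLeft _ e).lintegral_comp_emb
    (MeasurableEquiv.measurableEmbedding _)]
  simp_rw [← e.prod_comp, MeasurableEquiv.coe_piCongrLeft, Equiv.piCongrLeft_apply_apply]
  exact lintegral_pi_fin_prod fun i => hf (e i)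

theorem pi_withDensity {ι : Type*} [Fintype ι] {X : Type*} {mX : MeasurableSpace X}
    {μ : ι → Measure X} [∀ i, SigmaFinite (μ i)] {f : ι → X → ℝ≥0∞}
    (hf : ∀ i, Measurable (f i)) [∀ i, SigmaFinite ((μ i).withDensity (f i))] :
    Measure.pi (fun i => (μ i).withDensity (f i)) =
      (Measure.pi μ).withDensity fun x => ∏ i, f i (x i) := by
  refine Measure.pi_eq fun s hs => ?_
  rw [withDensity_apply _ (MeasurableSet.univ_pi hs),
    ← lintegral_indicator (MeasurableSet.univ_pi hs)]
  have h : ∀ x : ι → X, (Set.univ.pi s).indicator (fun x => ∏ i, f i (x i)) x =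
      ∏ i, (s i).indicator (f i) (x i) := by
    intro x
    by_cases hx : x ∈ Set.univ.pi s
    · rw [Set.indicator_of_mem hx]
      exact Finset.prod_congr rfl fun i _ => (Set.indicator_of_mem (hx i trivial) _).symm
    · rw [Set.indicator_of_notMem hx]
      obtain ⟨i, hi⟩ : ∃ i, x i ∉ s i := by simpa [Set.mem_pi] using hx
      exact (Finset.prod_eq_zero (Finset.mem_univ i) (Set.indicator_of_notMem hi _)).symm
  simp only [h]
  rw [lintegral_pi_prod fun i => (hf i).indicator (hs i)]
  refine Finset.prod_congr rfl fun i _ => ?_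
  rw [lintegral_indicator (hs i), withDensity_apply _ (hs i)]

/-! ### Sums of independent random variables -/

theorem memLp_mul_prod {Ω Ω' : Type*} [MeasurableSpace Ω] [MeasurableSpace Ω'] {μ : Measure Ω}
    {ν : Measure Ω'} [SFinite μ] [SFinite ν]
    {f : Ω → ℝ} {g : Ω' → ℝ} (hf : MemLp f 2 μ) (hg : MemLp g 2 ν) :
    MemLp (fun z : Ω × Ω' => f z.1 * g z.2) 2 (μ.prod ν) := by
  have hm : AEStronglyMeasurable (fun z : Ω × Ω' => f z.1 * g z.2) (μ.prod ν) :=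
    hf.1.comp_fst.mul hg.1.comp_snd
  rw [memLp_two_iff_integrable_sq hm]
  simpa only [mul_pow] using hf.integrable_sq.mul_prod hg.integrable_sq

section IidSums

variable {Ω : Type*} [MeasurableSpace Ω] {μ : Measure Ω} [IsProbabilityMeasure μ]

theorem memLp_pi_eval {n : ℕ} {V : Ω → ℝ} {p : ℝ≥0∞} (hV : MemLp V p μ) (k : Fin n) :
    MemLp (fun w : Fin n → Ω => V (w k)) p (Measure.pi fun _ => μ) :=
  hV.comp_measurePreserving (measurePreserving_eval (fun _ : Fin n => μ) k)

theorem memLp_pi_sum {n : ℕ} {V : Ω → ℝ} {p : ℝ≥0∞} (hV : MemLp V p μ) :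
    MemLp (fun w : Fin n → Ω => ∑ k, V (w k)) p (Measure.pi fun _ => μ) :=
  memLp_finsetSum _ fun k _ => memLp_pi_eval hV k

theorem integral_pi_sum {n : ℕ} {V : Ω → ℝ} (hV : MemLp V 2 μ) :
    ∫ w : Fin n → Ω, ∑ k, V (w k) ∂(Measure.pi fun _ => μ) = n * ∫ x, V x ∂μ := by
  rw [integral_finsetSum _ fun k _ => (memLp_pi_eval hV k).integrable (by norm_num)]
  simp [integral_comp_eval (μ := fun _ : Fin n => μ) hV.1]

theorem variance_pi_sum {n : ℕ} {V : Ω → ℝ} (hV : MemLp V 2 μ) :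
    Var[fun w : Fin n → Ω => ∑ k, V (w k); Measure.pi fun _ => μ] = n * Var[V; μ] := by
  have h := variance_sum_pi (ι := Fin n) (μ := fun _ => μ) (X := fun _ => V) fun _ => hV
  have e : (∑ i : Fin n, fun w : Fin n → Ω => V (w i)) = fun w => ∑ k, V (w k) := by
    ext w; simp
  rw [e] at h
  simpa using h

theorem integral_pi_sum_sq {n : ℕ} {V : Ω → ℝ} (hV : MemLp V 2 μ) (h0 : ∫ x, V x ∂μ = 0) :
    ∫ w : Fin n → Ω, (∑ k, V (w k)) ^ 2 ∂(Measure.pi fun _ => μ) = n * ∫ x, V x ^ 2 ∂μ := by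
  rw [← variance_of_integral_eq_zero hV.1.aemeasurable h0, ← variance_pi_sum hV,
    variance_of_integral_eq_zero (memLp_pi_sum hV).1.aemeasurable]
  rw [integral_pi_sum hV, h0, mul_zero]

/-- The off-diagonal part of the squared norm of a sum of independent random vectors. -/
theorem memLp_offDiag {ι : Type*} [Fintype ι] {V : ι → Ω → ℝ} (hV : ∀ j, MemLp (V j) 2 μ)
    (h0 : ∀ j, ∫ x, V j x ∂μ = 0) {B : ℝ}
    (hB : ∀ u : ι → ℝ, ∫ x, (∑ j, u j * V j x) ^ 2 ∂μ ≤ B * ∑ j, u j ^ 2) (hB0 : 0 ≤ B) (n : ℕ) :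
    MemLp (fun w : Fin n → Ω => ∑ j, ((∑ k, V j (w k)) ^ 2 - ∑ k, V j (w k) ^ 2)) 2
        (Measure.pi fun _ => μ) ∧
      ∫ w : Fin n → Ω, (∑ j, ((∑ k, V j (w k)) ^ 2 - ∑ k, V j (w k) ^ 2)) ^ 2
        ∂(Measure.pi fun _ => μ) ≤ 4 * B * (∑ j, ∫ x, V j x ^ 2 ∂μ) * n ^ 2 := by
  induction n with
  | zero => simp
  | succ n ih =>
    obtain ⟨ihL, ihI⟩ := ih
    set ν : Measure (Fin n → Ω) := Measure.pi fun _ => μ with hν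
    set W : (Fin n → Ω) → ℝ := fun w => ∑ j, ((∑ k, V j (w k)) ^ 2 - ∑ k, V j (w k) ^ 2) with hW
    set Q : Ω × (Fin n → Ω) → ℝ := fun z => ∑ j, V j z.1 * ∑ k, V j (z.2 k) with hQ
    have hmp : MeasurePreserving (fun z : Ω × (Fin n → Ω) => (Fin.cons z.1 z.2 : Fin (n + 1) → Ω))
        (μ.prod ν) (Measure.pi fun _ => μ) := measurePreserving_cons fun _ => μ
    -- Adding one observation increases the off-diagonal part by twice the inner product Q of the
    -- new vector with the sum of the old ones.
    have hcomp : ∀ z : Ω × (Fin n → Ω),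
        ∑ j, ((∑ k, V j ((Fin.cons z.1 z.2 : Fin (n + 1) → Ω) k)) ^ 2 -
          ∑ k, V j ((Fin.cons z.1 z.2 : Fin (n + 1) → Ω) k) ^ 2) = W z.2 + 2 * Q z := by
      intro z
      simp only [Fin.sum_univ_succ, Fin.cons_zero, Fin.cons_succ, hW, hQ, Finset.mul_sum,
        ← Finset.sum_add_distrib]
      refine Finset.sum_congr rfl fun j _ => ?_
      rw [← Finset.mul_sum, ← Finset.mul_sum]
      ring
    have hWm : AEStronglyMeasurable (fun w : Fin (n + 1) → Ω =>
        ∑ j, ((∑ k, V j (w k)) ^ 2 - ∑ k, V j (w k) ^ 2)) (Measure.pi fun _ => μ) := by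
      refine Finset.aestronglyMeasurable_fun_sum _ fun j _ =>
        ((memLp_pi_sum (hV j)).1.pow 2).sub ?_
      exact Finset.aestronglyMeasurable_fun_sum _ fun k _ => (memLp_pi_eval (hV j) k).1.pow 2
    have hS : ∀ j, MemLp (fun w : Fin n → Ω => ∑ k, V j (w k)) 2 ν := fun j => memLp_pi_sum (hV j)
    have hQL : MemLp Q 2 (μ.prod ν) := memLp_finsetSum _ fun j _ => memLp_mul_prod (hV j) (hS j)
    have hWL : MemLp (fun z : Ω × (Fin n → Ω) => W z.2) 2 (μ.prod ν) := ihL.comp_snd μ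
    -- The new vector is centred and independent of the past, so the cross term vanishes.
    have hWQ : ∫ z, W z.2 * Q z ∂(μ.prod ν) = 0 := by
      have h1 : ∀ z : Ω × (Fin n → Ω), W z.2 * Q z =
          ∑ j, V j z.1 * (W z.2 * ∑ k, V j (z.2 k)) := by
        intro z
        simp only [hQ, Finset.mul_sum]
        refine Finset.sum_congr rfl fun j _ => ?_
        refine Finset.sum_congr rfl fun k _ => by ring
      simp only [h1]
      have hWS : ∀ j, Integrable (fun w : Fin n → Ω => W w * ∑ k, V j (w k)) ν :=
        fun j => ihL.integrable_mul (hS j)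
      rw [integral_finsetSum _ fun j _ => ((hV j).integrable (by norm_num)).mul_prod (hWS j)]
      refine Finset.sum_eq_zero fun j _ => ?_
      rw [integral_prod_mul (V j) (fun w : Fin n → Ω => W w * ∑ k, V j (w k)), h0, zero_mul]
    -- With the past fixed, the covariance bound `hB` applies to the old sum; then the mean squared
    -- norm of that sum is n times that of one vector.
    have hQQ : ∫ z, Q z ^ 2 ∂(μ.prod ν) ≤ B * (n * ∑ j, ∫ x, V j x ^ 2 ∂μ) := by
      rw [integral_prod_symm _ hQL.integrable_sq]
      have h2 : ∀ j, Integrable (fun w : Fin n → Ω => (∑ k, V j (w k)) ^ 2) ν :=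
        fun j => (hS j).integrable_sq
      calc ∫ w, ∫ x, Q (x, w) ^ 2 ∂μ ∂ν
          ≤ ∫ w, B * ∑ j, (∑ k, V j (w k)) ^ 2 ∂ν := by
            refine integral_mono hQL.integrable_sq.integral_prod_right
              ((integrable_finsetSum _ fun j _ => h2 j).const_mul B) fun w => ?_
            refine le_trans (le_of_eq ?_) (hB fun j => ∑ k, V j (w k))
            simp only [hQ, mul_comm]
        _ = B * (n * ∑ j, ∫ x, V j x ^ 2 ∂μ) := by
            rw [integral_const_mul, integral_finsetSum _ fun j _ => h2 j]
            congr 1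
            rw [Finset.mul_sum]
            exact Finset.sum_congr rfl fun j _ => integral_pi_sum_sq (hV j) (h0 j)
    have hL : MemLp (fun z : Ω × (Fin n → Ω) => W z.2 + 2 * Q z) 2 (μ.prod ν) :=
      hWL.add (hQL.const_mul 2)
    refine ⟨?_, ?_⟩
    · rw [← hmp.map_eq, memLp_map_measure_iff (hmp.map_eq ▸ hWm) hmp.measurable.aemeasurable]
      simpa only [Function.comp_def, hcomp] using hL
    · rw [← hmp.map_eq, integral_map hmp.measurable.aemeasurable (hmp.map_eq ▸ hWm.pow 2)]
      simp only [hcomp]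
      have h3 : ∀ z : Ω × (Fin n → Ω), (W z.2 + 2 * Q z) ^ 2 =
          W z.2 ^ 2 + 4 * (W z.2 * Q z) + 4 * Q z ^ 2 := fun z => by ring
      simp only [h3]
      have hI1 := hWL.integrable_sq
      have hI2 := (hWL.integrable_mul hQL).const_mul 4
      have hI3 := hQL.integrable_sq.const_mul 4
      simp only [Pi.mul_apply] at hI2
      have h4 : ∫ z, W z.2 ^ 2 ∂(μ.prod ν) = ∫ w, W w ^ 2 ∂ν := by
        have := integral_fun_snd (μ := μ) (ν := ν) (fun w => W w ^ 2)
        simpa using this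
      have hI12 : Integrable (fun z : Ω × (Fin n → Ω) => W z.2 ^ 2 + 4 * (W z.2 * Q z))
        (μ.prod ν) := hI1.add hI2
      rw [integral_add hI12 hI3, integral_add hI1 hI2, integral_const_mul,
        integral_const_mul, hWQ, h4]
      have hv : 0 ≤ ∑ j, ∫ x, V j x ^ 2 ∂μ :=
        Finset.sum_nonneg fun j _ => integral_nonneg fun x => sq_nonneg _
      have hBv := mul_nonneg hB0 hv
      have hn : (0 : ℝ) ≤ n := n.cast_nonneg
      push_cast
      -- The induction closes because n² + n ≤ (n + 1)².
      nlinarith [mul_nonneg hBv hn]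

end IidSums

/-! ### The regression model on the space of design points and noise -/

/-- The law of the noise. -/
abbrev noise (σ : ℝ) : Measure ℝ := gaussianReal 0 (σ ^ 2).toNNReal

/-- The joint law of a design point and the noise. -/
abbrev baseLaw (d : ℕ) (σ : ℝ) : Measure (Sph d × ℝ) := (unif d).prod (noise σ)

/-- The observation made at a design point. -/
def obs {d : ℕ} (f : L2 d) (p : Sph d × ℝ) : Sph d × ℝ := (p.1, f p.1 + p.2)

theorem measurable_coe_L2 {d : ℕ} (f : L2 d) : Measurable f :=
  (Lp.stronglyMeasurable f).measurable

theorem measurable_obs {d : ℕ} (f : L2 d) : Measurable (obs f) :=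
  measurable_fst.prodMk (((measurable_coe_L2 f).comp measurable_fst).add measurable_snd)

/-- The data produced by the design points and the noise. -/
def dataOf {d n : ℕ} (f : L2 d) (w : Fin n → Sph d × ℝ) : Data d n := fun k => obs f (w k)

theorem measurable_dataOf {d n : ℕ} (f : L2 d) : Measurable (dataOf (n := n) f) :=
  measurable_pi_lambda _ fun k => (measurable_obs f).comp (measurable_pi_apply k)

theorem dataLaw_eq_map {d : ℕ} (σ : ℝ) (f : L2 d) (n : ℕ) :
    dataLaw σ f n = (Measure.pi fun _ : Fin n => baseLaw d σ).map (dataOf f) := by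
  have : ∀ _ : Fin n, IsProbabilityMeasure ((baseLaw d σ).map (obs f)) := fun _ =>
    Measure.isProbabilityMeasure_map (measurable_obs f).aemeasurable
  exact (Measure.pi_map_pi (ι := Fin n) (μ := fun _ => baseLaw d σ) (f := fun _ => obs f)
    fun _ => (measurable_obs f).aemeasurable).symm

instance isProbabilityMeasure_dataLaw {d : ℕ} (σ : ℝ) (f : L2 d) (n : ℕ) :
    IsProbabilityMeasure (dataLaw σ f n) := by
  rw [dataLaw_eq_map]
  exact Measure.isProbabilityMeasure_map (measurable_dataOf f).aemeasurable

theorem memLp_noise {σ : ℝ} (p : ℝ≥0) : MemLp (fun e : ℝ => e) p (noise σ) :=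
  memLp_id_gaussianReal p

theorem integral_noise (σ : ℝ) : ∫ e, e ∂(noise σ) = 0 := integral_id_gaussianReal

theorem integral_noise_sq (σ : ℝ) : ∫ e, e ^ 2 ∂(noise σ) = σ ^ 2 := by
  have h := variance_fun_id_gaussianReal (μ := 0) (v := (σ ^ 2).toNNReal)
  rw [variance_of_integral_eq_zero aemeasurable_id' integral_id_gaussianReal] at h
  rw [h, Real.coe_toNNReal _ (sq_nonneg _)]

theorem memLp_response {d : ℕ} (σ : ℝ) (g : L2 d) :
    MemLp (fun p : Sph d × ℝ => g p.1 + p.2) 2 (baseLaw d σ) :=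
  ((Lp.memLp g).comp_fst (noise σ)).add ((memLp_noise 2).comp_snd (unif d))

theorem memLp_response_mul {d : ℕ} (σ : ℝ) (g : L2 d) (h : C(Sph d, ℝ)) :
    MemLp (fun p : Sph d × ℝ => (g p.1 + p.2) * h p.1) 2 (baseLaw d σ) := by
  refine (memLp_response σ g).of_le_mul (c := ‖h‖)
    ((memLp_response σ g).1.mul (h.continuous.comp continuous_fst).aestronglyMeasurable)
    (ae_of_all _ fun p => ?_)
  rw [norm_mul, mul_comm]
  exact mul_le_mul_of_nonneg_right (h.norm_coe_le_norm _) (norm_nonneg _)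

theorem integrable_coe_mul {d : ℕ} (g : L2 d) (h : C(Sph d, ℝ)) :
    Integrable (fun x => g x * h x) (unif d) :=
  ((Lp.memLp g).integrable (by norm_num)).mul_bdd (c := ‖h‖) h.continuous.aestronglyMeasurable
    (ae_of_all _ fun x => h.norm_coe_le_norm x)

theorem integral_response_mul {d : ℕ} (σ : ℝ) (g : L2 d) (h : C(Sph d, ℝ)) :
    ∫ p, (g p.1 + p.2) * h p.1 ∂(baseLaw d σ) = ∫ x, g x * h x ∂(unif d) := by
  have h1 : Integrable (fun p : Sph d × ℝ => g p.1 * h p.1) (baseLaw d σ) :=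
    (integrable_coe_mul g h).comp_fst _
  have h2 : Integrable (fun p : Sph d × ℝ => h p.1 * p.2) (baseLaw d σ) :=
    (integrable_cont h).mul_prod ((memLp_noise 2).integrable (by norm_num))
  have e : ∀ p : Sph d × ℝ, (g p.1 + p.2) * h p.1 = g p.1 * h p.1 + h p.1 * p.2 :=
    fun p => by ring
  simp only [e]
  rw [integral_add h1 h2, integral_prod_mul (fun x => h x) (fun e => e), integral_noise, mul_zero,
    add_zero, integral_fun_fst (fun x => g x * h x)]
  simp

theorem integral_prod_add_mul_sq {Ω : Type*} [MeasurableSpace Ω] {μ : Measure Ω}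
    [IsProbabilityMeasure μ] (σ : ℝ) {G H : Ω → ℝ}
    (h1 : Integrable (fun x => G x ^ 2 * H x) μ) (h2 : Integrable (fun x => G x * H x) μ)
    (h3 : Integrable H μ) :
    ∫ p, (G p.1 + p.2) ^ 2 * H p.1 ∂(μ.prod (noise σ)) = ∫ x, (G x ^ 2 + σ ^ 2) * H x ∂μ := by
  have i1 : Integrable (fun p : Ω × ℝ => G p.1 ^ 2 * H p.1) (μ.prod (noise σ)) := h1.comp_fst _
  have i2 : Integrable (fun p : Ω × ℝ => 2 * (G p.1 * H p.1) * p.2) (μ.prod (noise σ)) :=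
    (h2.const_mul 2).mul_prod ((memLp_noise 2).integrable (by norm_num))
  have i3 : Integrable (fun p : Ω × ℝ => H p.1 * p.2 ^ 2) (μ.prod (noise σ)) :=
    h3.mul_prod (memLp_noise 2).integrable_sq
  have i12 : Integrable (fun p : Ω × ℝ => G p.1 ^ 2 * H p.1 + 2 * (G p.1 * H p.1) * p.2)
    (μ.prod (noise σ)) := i1.add i2
  have e : ∀ p : Ω × ℝ, (G p.1 + p.2) ^ 2 * H p.1 =
      G p.1 ^ 2 * H p.1 + 2 * (G p.1 * H p.1) * p.2 + H p.1 * p.2 ^ 2 := fun p => by ring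
  have e2 : ∀ x, (G x ^ 2 + σ ^ 2) * H x = G x ^ 2 * H x + σ ^ 2 * H x := fun x => by ring
  simp only [e, e2]
  rw [integral_add i12 i3, integral_add i1 i2,
    integral_prod_mul (fun x => 2 * (G x * H x)) (fun e => e), integral_noise,
    integral_prod_mul H (fun e => e ^ 2), integral_noise_sq,
    integral_fun_fst (fun x => G x ^ 2 * H x), integral_add h1 (h3.const_mul _),
    integral_const_mul]
  simp only [probReal_univ, one_smul, mul_zero, add_zero, integral_const_mul]
  ring

theorem integral_response_mul_sq {d : ℕ} (σ : ℝ) (g : L2 d) (h : C(Sph d, ℝ)) :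
    ∫ p, ((g p.1 + p.2) * h p.1) ^ 2 ∂(baseLaw d σ) =
      ∫ x, (g x ^ 2 + σ ^ 2) * h x ^ 2 ∂(unif d) := by
  have hs : ∀ x, (h * h) x = h x ^ 2 := fun x => by simp [sq]
  have h1 : Integrable (fun x => g x ^ 2 * (h * h) x) (unif d) :=
    (Lp.memLp g).integrable_sq.mul_bdd (c := ‖h * h‖) (h * h).continuous.aestronglyMeasurable
      (ae_of_all _ fun x => (h * h).norm_coe_le_norm x)
  have := integral_prod_add_mul_sq (μ := unif d) σ h1 (integrable_coe_mul g (h * h))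
    (integrable_cont (h * h))
  simpa only [hs, mul_pow] using this

theorem integral_sq_eq_norm_sq {d : ℕ} (g : L2 d) : ∫ x, g x ^ 2 ∂(unif d) = ‖g‖ ^ 2 := by
  rw [← real_inner_self_eq_norm_sq, L2.inner_def]
  simp [sq]

/-- The centred harmonic coefficient of a single observation. -/
def score {d : ℕ} (Y : HarmonicFamily d) (g : L2 d) (L : ℕ) (i : Idx d L) (p : Sph d × ℝ) : ℝ :=
  (g p.1 + p.2) * Y i.1 i.2 p.1 - coeff Y g i.1 i.2

theorem memLp_score {d : ℕ} (Y : HarmonicFamily d) (σ : ℝ) (g : L2 d) (L : ℕ) (i : Idx d L) :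
    MemLp (score Y g L i) 2 (baseLaw d σ) :=
  (memLp_response_mul σ g (Y i.1 i.2)).sub (memLp_const _)

theorem integral_score {d : ℕ} (Y : HarmonicFamily d) (σ : ℝ) (g : L2 d) (L : ℕ) (i : Idx d L) :
    ∫ p, score Y g L i p ∂(baseLaw d σ) = 0 := by
  unfold score
  rw [integral_sub ((memLp_response_mul σ g (Y i.1 i.2)).integrable (by norm_num))
    (integrable_const _), integral_response_mul]
  simp [coeff]

/-- The second moment of a linear combination of the scores. -/
theorem integral_sum_score_sq_le {d L : ℕ} (Y : HarmonicFamily d) (σ : ℝ) (g : L2 d)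
    (u : Coeffs d L) :
    ∫ p, (∑ i, u i * score Y g L i p) ^ 2 ∂(baseLaw d σ) ≤
      ∫ x, (g x ^ 2 + σ ^ 2) * synth Y u x ^ 2 ∂(unif d) := by
  rw [← integral_response_mul_sq]
  have h := variance_le_expectation_sq (μ := baseLaw d σ)
    (memLp_response_mul σ g (synth Y u)).1
  -- The combination of scores is the response times `synth Y u`, minus its mean; its second moment
  -- is a variance, at most the uncentred second moment.
  have e : (fun p => (∑ i, u i * score Y g L i p) ^ 2) = fun p : Sph d × ℝ =>
      ((g p.1 + p.2) * synth Y u p.1 - ∫ q, (g q.1 + q.2) * synth Y u q.1 ∂(baseLaw d σ)) ^ 2 := by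
    funext p
    congr 1
    rw [integral_response_mul]
    simp only [synth_apply, score, mul_sub, Finset.sum_sub_distrib, Finset.mul_sum]
    congr 1
    · exact Finset.sum_congr rfl fun i _ => by ring
    · rw [integral_finsetSum]
      · refine Finset.sum_congr rfl fun i _ => ?_
        rw [coeff, ← integral_const_mul]
        exact integral_congr_ae (ae_of_all _ fun x => by ring)
      · intro i _
        have := (integrable_coe_mul g (Y i.1 i.2)).const_mul (u i)
        exact this.congr (ae_of_all _ fun x => by ring)
  rw [e, ← variance_eq_integral (memLp_response_mul σ g (synth Y u)).1.aemeasurable]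
  exact h

/-- The addition theorem replaces the sum of the squared harmonics by the constant `dimLe d L` under
the integral, so only the L² norm of g enters. -/
theorem sum_integral_score_sq_le {d : ℕ} (L : ℕ) (hd : 1 ≤ d) {Y : HarmonicFamily d}
    (hY : IsSphericalHarmonicBasis Y) (σ : ℝ) (g : L2 d) :
    ∑ i, ∫ p, score Y g L i p ^ 2 ∂(baseLaw d σ) ≤ (‖g‖ ^ 2 + σ ^ 2) * dimLe d L := by
  classical
  have h : ∀ i, ∫ p, score Y g L i p ^ 2 ∂(baseLaw d σ) ≤
      ∫ x, (g x ^ 2 + σ ^ 2) * Y i.1 i.2 x ^ 2 ∂(unif d) := by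
    intro i
    have := integral_sum_score_sq_le Y σ g (Pi.single i 1)
    simpa [synth_apply, Pi.single_apply] using this
  refine (Finset.sum_le_sum fun i _ => h i).trans (le_of_eq ?_)
  have hi : Integrable (fun x => g x ^ 2 + σ ^ 2) (unif d) :=
    (Lp.memLp g).integrable_sq.add (integrable_const _)
  rw [← integral_finsetSum _ fun i _ => hi.mul_bdd (c := ‖Y i.1 i.2 ^ 2‖)
    (Y i.1 i.2 ^ 2).continuous.aestronglyMeasurable
      (ae_of_all _ fun x => (Y i.1 i.2 ^ 2).norm_coe_le_norm x)]
  simp only [← Finset.mul_sum, sum_idx_sq L hd hY]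
  rw [integral_mul_const, integral_add (Lp.memLp g).integrable_sq (integrable_const _),
    integral_sq_eq_norm_sq]
  simp

theorem empCoeff_dataOf {d n L : ℕ} (hn : 1 ≤ n) (Y : HarmonicFamily d) (g : L2 d)
    (w : Fin n → Sph d × ℝ) (i : Idx d L) :
    empCoeff Y (dataOf g w) i.1 i.2 - coeff Y g i.1 i.2 =
      (n : ℝ)⁻¹ * ∑ k, score Y g L i (w k) := by
  have hn' : (n : ℝ) ≠ 0 := by positivity
  simp only [empCoeff, score, dataOf, obs, Finset.sum_sub_distrib, Finset.sum_const,
    Finset.card_univ, Fintype.card_fin, nsmul_eq_mul]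
  field_simp

/-! ### The upper bound for the minimax risk -/

/-- The projection estimator. -/
def projEst {d : ℕ} (Y : HarmonicFamily d) (L n : ℕ) (z : Data d n) : L2 d :=
  toL2 (synth Y fun i : Idx d L => empCoeff Y z i.1 i.2)

theorem measurable_empCoeff {d : ℕ} (Y : HarmonicFamily d) (n ℓ : ℕ) (m : Fin (mult d ℓ)) :
    Measurable fun z : Data d n => empCoeff Y z ℓ m := by
  have := (Y ℓ m).continuous.measurable
  unfold empCoeff
  fun_prop

theorem stronglyMeasurable_projEst {d : ℕ} (Y : HarmonicFamily d) (L n : ℕ) :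
    StronglyMeasurable (projEst Y L n) := by
  have h : projEst Y L n = fun z => ∑ i : Idx d L, empCoeff Y z i.1 i.2 • vec Y ⟨i.1, i.2⟩ :=
    funext fun z => toL2_synth Y _
  rw [h]
  exact Finset.stronglyMeasurable_fun_sum _ fun i _ =>
    (measurable_empCoeff Y n i.1 i.2).stronglyMeasurable.smul_const _

theorem enorm_sq_eq_ofReal {E : Type*} [NormedAddCommGroup E] (x : E) :
    ‖x‖ₑ ^ 2 = ENNReal.ofReal (‖x‖ ^ 2) := by
  rw [ENNReal.ofReal_pow (norm_nonneg _), ofReal_norm]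

/-- Bias and variance: the coefficient errors are means of n centred independent scores, and the
remainder is bounded by the Sobolev weight. -/
theorem risk_projEst_le {d n L : ℕ} (hd : 1 ≤ d) {Y : HarmonicFamily d}
    (hY : IsSphericalHarmonicBasis Y) (hn : 1 ≤ n) (σ : ℝ) {β R : ℝ} (hβ : 0 ≤ β) {f : L2 d}
    (hf : f ∈ sobolevBall Y β R) :
    ∫⁻ z, ‖projEst Y L n z - f‖ₑ ^ 2 ∂(dataLaw σ f n) ≤
      ENNReal.ofReal ((R ^ 2 + σ ^ 2) * dimLe d L / n +
        R ^ 2 * (1 + eigenval d (L + 1)) ^ (-β)) := by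
  have hn' : (0 : ℝ) < n := by positivity
  have hm : Measurable fun z : Data d n => ‖projEst Y L n z - f‖ₑ ^ 2 :=
    ((stronglyMeasurable_projEst Y L n).sub stronglyMeasurable_const).enorm.pow_const 2
  rw [dataLaw_eq_map, lintegral_map hm (measurable_dataOf f)]
  have e : ∀ w : Fin n → Sph d × ℝ, ‖projEst Y L n (dataOf f w) - f‖ₑ ^ 2 =
      ENNReal.ofReal (∑ i, (n : ℝ)⁻¹ ^ 2 * (∑ k, score Y f L i (w k)) ^ 2 +
        ‖remainder Y L f‖ ^ 2) := by
    intro w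
    rw [enorm_sq_eq_ofReal, projEst, norm_toL2_synth_sub_sq hd hY]
    simp only [trunc, empCoeff_dataOf hn, mul_pow]
  simp only [e]
  have hi : ∀ i : Idx d L, Integrable (fun w : Fin n → Sph d × ℝ =>
      (n : ℝ)⁻¹ ^ 2 * (∑ k, score Y f L i (w k)) ^ 2) (Measure.pi fun _ => baseLaw d σ) :=
    fun i => (memLp_pi_sum (memLp_score Y σ f L i)).integrable_sq.const_mul _
  have hsum : Integrable (fun w : Fin n → Sph d × ℝ =>
      ∑ i, (n : ℝ)⁻¹ ^ 2 * (∑ k, score Y f L i (w k)) ^ 2 + ‖remainder Y L f‖ ^ 2)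
      (Measure.pi fun _ => baseLaw d σ) :=
    (integrable_finsetSum _ fun i _ => hi i).add (integrable_const _)
  rw [← ofReal_integral_eq_lintegral_ofReal hsum
    (ae_of_all _ fun w => by positivity)]
  refine ENNReal.ofReal_le_ofReal ?_
  rw [integral_add (integrable_finsetSum _ fun i _ => hi i) (integrable_const _),
    integral_finsetSum _ fun i _ => hi i]
  refine add_le_add ?_ (by simpa using tsum_remainder_le hd hY hβ hf)
  simp only [integral_const_mul,
    integral_pi_sum_sq (memLp_score Y σ f L _) (integral_score Y σ f L _)]
  have e2 : ∀ c : ℝ, (n : ℝ)⁻¹ ^ 2 * (n * c) = c / n := fun c => by field_simp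
  simp only [e2, ← Finset.sum_div]
  gcongr
  refine (sum_integral_score_sq_le L hd hY σ f).trans ?_
  have := norm_sq_le_of_mem_sobolevBall hd hY hβ hf
  exact mul_le_mul_of_nonneg_right (by linarith) (Nat.cast_nonneg _)

/-! ### Densities of the data -/

/-- The density of an observation with respect to the product of the uniform and the Lebesgue
measure. -/
def obsDensity {d : ℕ} (σ : ℝ) (f : L2 d) (p : Sph d × ℝ) : ℝ :=
  gaussianPDFReal (f p.1) (σ ^ 2).toNNReal p.2

theorem obsDensity_nonneg {d : ℕ} (σ : ℝ) (f : L2 d) (p : Sph d × ℝ) : 0 ≤ obsDensity σ f p :=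
  gaussianPDFReal_nonneg _ _ _

theorem measurable_obsDensity {d : ℕ} (σ : ℝ) (f : L2 d) : Measurable (obsDensity σ f) := by
  have : Measurable fun p : Sph d × ℝ => f p.1 := (measurable_coe_L2 f).comp measurable_fst
  unfold obsDensity
  simp only [gaussianPDFReal_def]
  fun_prop

theorem variance_ne_zero {σ : ℝ} (hσ : 0 < σ) : (σ ^ 2).toNNReal ≠ 0 := by
  simp [hσ.ne']

theorem map_obs_eq_withDensity {d : ℕ} {σ : ℝ} (hσ : 0 < σ) (f : L2 d) :
    (baseLaw d σ).map (obs f) =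
      ((unif d).prod (volume : Measure ℝ)).withDensity fun p => ENNReal.ofReal (obsDensity σ f p) := by
  refine Measure.ext_of_lintegral _ fun h hh => ?_
  rw [lintegral_map hh (measurable_obs f), lintegral_prod (fun p => h (obs f p))
      (hh.comp (measurable_obs f)).aemeasurable,
    lintegral_withDensity_eq_lintegral_mul _ (measurable_obsDensity σ f).ennreal_ofReal hh,
    lintegral_prod _ ((measurable_obsDensity σ f).ennreal_ofReal.mul hh).aemeasurable]
  refine lintegral_congr fun x => ?_
  have hx : Measurable fun y => h (x, y) := hh.comp measurable_prodMk_left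
  have e : ∫⁻ y, h (obs f (x, y)) ∂(noise σ) = ∫⁻ y, h (x, y) ∂((noise σ).map (f x + ·)) := by
    rw [lintegral_map hx (measurable_const_add _)]
    rfl
  rw [e, gaussianReal_map_const_add, zero_add, gaussianReal_of_var_ne_zero _ (variance_ne_zero hσ),
    lintegral_withDensity_eq_lintegral_mul _ (measurable_gaussianPDF _ _) hx]
  rfl

/-- The density of the data. -/
def dataDensity {d : ℕ} (σ : ℝ) (f : L2 d) {n : ℕ} (z : Data d n) : ℝ := ∏ k, obsDensity σ f (z k)

instance sigmaFinite_unif_prod (d : ℕ) : SigmaFinite ((unif d).prod (volume : Measure ℝ)) :=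
  Measure.prod.instSigmaFinite

/-- The dominating measure of the data. -/
abbrev refLaw (d n : ℕ) : Measure (Data d n) :=
  Measure.pi fun _ : Fin n => (unif d).prod (volume : Measure ℝ)

theorem dataDensity_nonneg {d : ℕ} (σ : ℝ) (f : L2 d) {n : ℕ} (z : Data d n) :
    0 ≤ dataDensity σ f z := Finset.prod_nonneg fun _ _ => obsDensity_nonneg _ _ _

theorem measurable_dataDensity {d : ℕ} (σ : ℝ) (f : L2 d) (n : ℕ) :
    Measurable (dataDensity σ f (n := n)) :=
  Finset.measurable_fun_prod _ fun k _ => (measurable_obsDensity σ f).comp (measurable_pi_apply k)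

theorem dataLaw_eq_withDensity {d : ℕ} {σ : ℝ} (hσ : 0 < σ) (f : L2 d) (n : ℕ) :
    dataLaw σ f n = (refLaw d n).withDensity fun z => ENNReal.ofReal (dataDensity σ f z) := by
  have hp : IsProbabilityMeasure (((unif d).prod (volume : Measure ℝ)).withDensity
      fun p => ENNReal.ofReal (obsDensity σ f p)) := by
    rw [← map_obs_eq_withDensity hσ]
    exact Measure.isProbabilityMeasure_map (measurable_obs f).aemeasurable
  have h : dataLaw σ f n = Measure.pi fun _ : Fin n =>
      ((unif d).prod (volume : Measure ℝ)).withDensity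
      fun p => ENNReal.ofReal (obsDensity σ f p) := by
    unfold dataLaw
    congr 1
    funext _
    exact map_obs_eq_withDensity hσ f
  rw [h, pi_withDensity (μ := fun _ : Fin n => (unif d).prod (volume : Measure ℝ))
    fun _ => (measurable_obsDensity σ f).ennreal_ofReal]
  congr 1
  funext z
  rw [dataDensity, ENNReal.ofReal_prod_of_nonneg fun _ _ => obsDensity_nonneg _ _ _]

/-! ### The Hellinger affinity -/

/-- Completing the square at the midpoint exhibits a Gaussian density times the affinity of the two
Gaussians. -/
theorem sqrt_gaussianPDFReal_mul (a b y : ℝ) (v : ℝ≥0) :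
    √(gaussianPDFReal a v y * gaussianPDFReal b v y) =
      Real.exp (-(a - b) ^ 2 / (8 * v)) * gaussianPDFReal ((a + b) / 2) v y := by
  rw [Real.sqrt_eq_iff_mul_self_eq (mul_nonneg (gaussianPDFReal_nonneg _ _ _)
    (gaussianPDFReal_nonneg _ _ _)) (mul_nonneg (Real.exp_nonneg _) (gaussianPDFReal_nonneg _ _ _))]
  simp only [gaussianPDFReal_def]
  have e : Real.exp (-(y - a) ^ 2 / (2 * v)) * Real.exp (-(y - b) ^ 2 / (2 * v)) =
      (Real.exp (-(a - b) ^ 2 / (8 * v)) * Real.exp (-(y - (a + b) / 2) ^ 2 / (2 * v))) *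
      (Real.exp (-(a - b) ^ 2 / (8 * v)) * Real.exp (-(y - (a + b) / 2) ^ 2 / (2 * v))) := by
    simp only [← Real.exp_add]
    congr 1
    by_cases hv : (v : ℝ) = 0
    · simp [hv]
    · field_simp
      ring
  linear_combination ((√(2 * Real.pi * v))⁻¹ ^ 2) * e

/-- Given the design point x, the affinity is exp(-(f x - g x)² / (8σ²)). Bounding it below by 1
minus the exponent and averaging over x leaves only the L² distance. -/
theorem one_sub_le_affinity {d : ℕ} {σ : ℝ} (hσ : 0 < σ) (f g : L2 d) :
    ENNReal.ofReal (1 - ‖f - g‖ ^ 2 / (8 * σ ^ 2)) ≤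
      ∫⁻ p, ENNReal.ofReal (√(obsDensity σ f p * obsDensity σ g p))
        ∂((unif d).prod (volume : Measure ℝ)) := by
  have hv : ((σ ^ 2).toNNReal : ℝ) = σ ^ 2 := Real.coe_toNNReal _ (sq_nonneg _)
  have hm : Measurable fun p => ENNReal.ofReal (√(obsDensity σ f p * obsDensity σ g p)) :=
    ((measurable_obsDensity σ f).mul (measurable_obsDensity σ g)).sqrt.ennreal_ofReal
  rw [lintegral_prod _ hm.aemeasurable]
  have e : ∀ x, ∫⁻ y, ENNReal.ofReal (√(obsDensity σ f (x, y) * obsDensity σ g (x, y))) =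
      ENNReal.ofReal (Real.exp (-(f x - g x) ^ 2 / (8 * σ ^ 2))) := by
    intro x
    simp only [obsDensity, sqrt_gaussianPDFReal_mul, hv, ENNReal.ofReal_mul (Real.exp_nonneg _)]
    rw [lintegral_const_mul _ (measurable_gaussianPDFReal _ _).ennreal_ofReal,
      lintegral_gaussianPDFReal_eq_one _ (variance_ne_zero hσ), mul_one]
  simp only [e]
  have hi : Integrable (fun x => 1 - (f - g) x ^ 2 / (8 * σ ^ 2)) (unif d) :=
    (integrable_const _).sub ((Lp.memLp (f - g)).integrable_sq.div_const _)
  have h1 : 1 - ‖f - g‖ ^ 2 / (8 * σ ^ 2) = ∫ x, (1 - (f - g) x ^ 2 / (8 * σ ^ 2)) ∂(unif d) := by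
    rw [integral_sub (integrable_const _) ((Lp.memLp (f - g)).integrable_sq.div_const _),
      integral_div, integral_sq_eq_norm_sq]
    simp
  have hexp : Integrable (fun x => Real.exp (-(f x - g x) ^ 2 / (8 * σ ^ 2))) (unif d) := by
    have hmf := measurable_coe_L2 f
    have hmg := measurable_coe_L2 g
    refine (integrable_const (1 : ℝ)).mono' (by fun_prop) (ae_of_all _ fun x => ?_)
    rw [Real.norm_eq_abs, Real.abs_exp]
    refine Real.exp_le_one_iff.2 (div_nonpos_of_nonpos_of_nonneg ?_ (by positivity))
    simpa using sq_nonneg _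
  rw [h1, ← ofReal_integral_eq_lintegral_ofReal hexp (ae_of_all _ fun x => Real.exp_nonneg _)]
  refine ENNReal.ofReal_le_ofReal (integral_mono_ae hi hexp ?_)
  filter_upwards [Lp.coeFn_sub f g] with x hx
  rw [hx, Pi.sub_apply, neg_div]
  have := Real.add_one_le_exp (-((f x - g x) ^ 2 / (8 * σ ^ 2)))
  linarith

/-- Affinities of product laws multiply, and Bernoulli's inequality bounds the n-th power below by 1
- n‖f - g‖² / (8σ²). -/
theorem affinity_dataLaw {d n : ℕ} {σ : ℝ} (hσ : 0 < σ) (f g : L2 d)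
    (h : n * ‖f - g‖ ^ 2 ≤ 4 * σ ^ 2) :
    ENNReal.ofReal (1 / 2) ≤
      ∫⁻ z, ENNReal.ofReal (√(dataDensity σ f z * dataDensity σ g z)) ∂(refLaw d n) := by
  have e : ∀ z : Data d n, ENNReal.ofReal (√(dataDensity σ f z * dataDensity σ g z)) =
      ∏ k, ENNReal.ofReal (√(obsDensity σ f (z k) * obsDensity σ g (z k))) := by
    intro z
    rw [← ENNReal.ofReal_prod_of_nonneg fun _ _ => Real.sqrt_nonneg _, dataDensity, dataDensity,
      ← Finset.prod_mul_distrib, Real.sqrt_prod _ fun k _ =>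
        mul_nonneg (obsDensity_nonneg _ _ _) (obsDensity_nonneg _ _ _)]
  have hm : Measurable fun p => ENNReal.ofReal (√(obsDensity σ f p * obsDensity σ g p)) :=
    ((measurable_obsDensity σ f).mul (measurable_obsDensity σ g)).sqrt.ennreal_ofReal
  simp only [e]
  rw [lintegral_pi_prod (μ := fun _ : Fin n => (unif d).prod (volume : Measure ℝ)) fun _ => hm,
    Finset.prod_const, Finset.card_univ, Fintype.card_fin]
  refine le_trans ?_ (pow_le_pow_left₀ zero_le (one_sub_le_affinity hσ f g) n)
  rcases Nat.eq_zero_or_pos n with rfl | hn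
  · simp
  have hn1 : (1 : ℝ) ≤ n := by exact_mod_cast hn
  have hx : ‖f - g‖ ^ 2 / (8 * σ ^ 2) ≤ 1 / 2 := by
    rw [div_le_iff₀ (by positivity)]
    nlinarith [sq_nonneg ‖f - g‖]
  have hx0 : 0 ≤ ‖f - g‖ ^ 2 / (8 * σ ^ 2) := by positivity
  rw [← ENNReal.ofReal_pow (by linarith)]
  refine ENNReal.ofReal_le_ofReal ?_
  have hb := one_add_mul_le_pow (a := -(‖f - g‖ ^ 2 / (8 * σ ^ 2))) (by linarith) n
  have hnx : n * (‖f - g‖ ^ 2 / (8 * σ ^ 2)) ≤ 1 / 2 := by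
    rw [← mul_div_assoc, div_le_iff₀ (by positivity)]
    linarith
  rw [← sub_eq_add_neg] at hb
  linarith

/-- The two-point lower bound. -/
theorem two_point_bound {d n : ℕ} {σ : ℝ} (hσ : 0 < σ) (f g : L2 d)
    (h : n * ‖f - g‖ ^ 2 ≤ 4 * σ ^ 2) {u : Data d n → ℝ} (hu : Measurable u) {s t δ : ℝ}
    (hδ : 0 ≤ δ) (hst : |s - t| = 2 * δ) :
    ENNReal.ofReal (δ ^ 2 / 2) ≤
      ∫⁻ z, ENNReal.ofReal ((u z - s) ^ 2) ∂(dataLaw σ f n) +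
      ∫⁻ z, ENNReal.ofReal ((u z - t) ^ 2) ∂(dataLaw σ g n) := by
  have haff := affinity_dataLaw hσ f g h
  have hmp := (measurable_dataDensity σ f n)
  have hmq := (measurable_dataDensity σ g n)
  have h1 : ∀ f : L2 d, ∫⁻ z, ENNReal.ofReal (dataDensity σ f z) ∂(refLaw d n) = 1 := by
    intro f
    have := measure_univ (μ := dataLaw σ f n)
    rwa [dataLaw_eq_withDensity hσ, withDensity_apply _ MeasurableSet.univ,
      Measure.restrict_univ] at this
  have h2 : ∀ (f : L2 d) (s : ℝ), ∫⁻ z, ENNReal.ofReal ((u z - s) ^ 2) ∂(dataLaw σ f n) =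
      ∫⁻ z, ENNReal.ofReal (dataDensity σ f z * (u z - s) ^ 2) ∂(refLaw d n) := by
    intro f s
    rw [dataLaw_eq_withDensity hσ, lintegral_withDensity_eq_lintegral_mul _
      (measurable_dataDensity σ f n).ennreal_ofReal ((hu.sub_const s).pow_const 2).ennreal_ofReal]
    refine lintegral_congr fun z => ?_
    rw [Pi.mul_apply, ENNReal.ofReal_mul (dataDensity_nonneg _ _ _)]
  -- No value is within δ of both s and t. With a, b the roots of the two densities, 2δ ≤ |u - s| +
  -- |u - t| is multiplied by δab, and each product is split by the arithmetic-geometric mean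
  -- inequality.
  have hpt : ∀ z, ENNReal.ofReal (2 * δ ^ 2) *
      ENNReal.ofReal (√(dataDensity σ f z * dataDensity σ g z)) ≤
      (ENNReal.ofReal (dataDensity σ f z * (u z - s) ^ 2) +
      ENNReal.ofReal (dataDensity σ g z * (u z - t) ^ 2)) +
      (ENNReal.ofReal (δ ^ 2 / 4) * ENNReal.ofReal (dataDensity σ f z) +
      ENNReal.ofReal (δ ^ 2 / 4) * ENNReal.ofReal (dataDensity σ g z)) := by
    intro z
    have hp := dataDensity_nonneg σ f z
    have hq := dataDensity_nonneg σ g z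
    rw [← ENNReal.ofReal_mul (by positivity), ← ENNReal.ofReal_mul (by positivity),
      ← ENNReal.ofReal_mul (by positivity), ← ENNReal.ofReal_add (by positivity) (by positivity),
      ← ENNReal.ofReal_add (by positivity) (by positivity),
      ← ENNReal.ofReal_add (by positivity) (by positivity)]
    refine ENNReal.ofReal_le_ofReal ?_
    rw [Real.sqrt_mul hp]
    set a := √(dataDensity σ f z) with ha
    set b := √(dataDensity σ g z) with hb
    have ha0 : 0 ≤ a := Real.sqrt_nonneg _
    have hb0 : 0 ≤ b := Real.sqrt_nonneg _
    rw [← Real.sq_sqrt hp, ← Real.sq_sqrt hq, ← ha, ← hb]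
    have htri : 2 * δ ≤ |u z - s| + |u z - t| := by
      rw [← hst]
      have := abs_sub (u z - t) (u z - s)
      have e : u z - t - (u z - s) = s - t := by ring
      rw [e] at this
      linarith
    have e1 : (u z - s) ^ 2 = |u z - s| ^ 2 := (sq_abs _).symm
    have e2 : (u z - t) ^ 2 = |u z - t| ^ 2 := (sq_abs _).symm
    rw [e1, e2]
    have h3 : 2 * δ * (δ * (a * b)) ≤ (|u z - s| + |u z - t|) * (δ * (a * b)) :=
      mul_le_mul_of_nonneg_right htri (by positivity)
    nlinarith [sq_nonneg (a * |u z - s| - δ * b / 2), sq_nonneg (b * |u z - t| - δ * a / 2)]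
  have hI := lintegral_mono (μ := refLaw d n) hpt
  have hmf : Measurable fun z => ENNReal.ofReal (dataDensity σ f z * (u z - s) ^ 2) :=
    (hmp.mul ((hu.sub_const s).pow_const 2)).ennreal_ofReal
  have hmg : Measurable fun z => ENNReal.ofReal (dataDensity σ g z * (u z - t) ^ 2) :=
    (hmq.mul ((hu.sub_const t).pow_const 2)).ennreal_ofReal
  have hmfg : Measurable fun z => ENNReal.ofReal (dataDensity σ f z * (u z - s) ^ 2) +
      ENNReal.ofReal (dataDensity σ g z * (u z - t) ^ 2) := hmf.add hmg
  have hms : Measurable fun z => ENNReal.ofReal (√(dataDensity σ f z * dataDensity σ g z)) :=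
    (hmp.mul hmq).sqrt.ennreal_ofReal
  rw [lintegral_const_mul _ hms,
    lintegral_add_left hmfg, lintegral_add_left hmf,
    lintegral_add_left (hmp.ennreal_ofReal.const_mul _),
    lintegral_const_mul _ hmp.ennreal_ofReal, lintegral_const_mul _ hmq.ennreal_ofReal,
    h1, h1, mul_one, ← ENNReal.ofReal_add (by positivity) (by positivity)] at hI
  rw [h2, h2]
  -- Affinity at least 1/2 makes the left side at least δ², and the two densities return only δ²/2.
  have h4 : ENNReal.ofReal (δ ^ 2 / 2) + ENNReal.ofReal (δ ^ 2 / 4 + δ ^ 2 / 4) ≤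
      ENNReal.ofReal (2 * δ ^ 2) *
      ∫⁻ z, ENNReal.ofReal (√(dataDensity σ f z * dataDensity σ g z)) ∂(refLaw d n) := by
    refine le_trans (le_of_eq ?_) (mul_le_mul_right haff _)
    rw [← ENNReal.ofReal_mul (by positivity), ← ENNReal.ofReal_add (by positivity) (by positivity)]
    congr 1
    ring
  exact (ENNReal.add_le_add_iff_right ENNReal.ofReal_ne_top).1 (h4.trans hI)

/-! ### Assouad's lower bound -/

/-- The coefficient vector with entries `±δ`. -/
def hypercube {d L : ℕ} (δ : ℝ) (θ : Idx d L → Bool) : Coeffs d L :=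
  fun i => if θ i then δ else -δ

theorem hypercube_sq {d L : ℕ} (δ : ℝ) (θ : Idx d L → Bool) (i : Idx d L) :
    hypercube δ θ i ^ 2 = δ ^ 2 := by
  unfold hypercube
  split_ifs <;> ring

theorem toL2_hypercube_mem_sobolevBall {d L : ℕ} (hd : 1 ≤ d) {Y : HarmonicFamily d}
    (hY : IsSphericalHarmonicBasis Y) {β R δ : ℝ} (hβ : 0 ≤ β)
    (hδ : δ ^ 2 * dimLe d L * (1 + eigenval d L) ^ β ≤ R ^ 2) (θ : Idx d L → Bool) :
    toL2 (synth Y (hypercube δ θ)) ∈ sobolevBall Y β R := by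
  have hpos := fun ℓ => one_add_eigenval_pos hd ℓ
  show sobolevNormSq Y β _ ≤ _
  unfold sobolevNormSq
  rw [tsum_eq_sum (s := Finset.range (L + 1))]
  · rw [← ENNReal.ofReal_sum_of_nonneg fun ℓ _ => mul_nonneg (Real.rpow_nonneg (hpos ℓ).le _)
      (Finset.sum_nonneg fun m _ => sq_nonneg _)]
    refine ENNReal.ofReal_le_ofReal (le_trans ?_ hδ)
    rw [dimLe, Nat.cast_sum, Finset.mul_sum, Finset.sum_mul]
    refine Finset.sum_le_sum fun ℓ hℓ => ?_
    have hℓL : ℓ ≤ L := Nat.lt_succ_iff.1 (Finset.mem_range.1 hℓ)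
    have h1 : ∀ m, coeff Y (toL2 (synth Y (hypercube δ θ))) ℓ m ^ 2 = δ ^ 2 := by
      intro m
      have := coeff_toL2_synth hd hY (hypercube δ θ) ⟨⟨ℓ, Nat.lt_succ_of_le hℓL⟩, m⟩
      simp only at this
      rw [this, hypercube_sq]
    have h2 : (1 + eigenval d ℓ) ^ β ≤ (1 + eigenval d L) ^ β := by
      refine Real.rpow_le_rpow (hpos _).le ?_ hβ
      have := (eigenval_strictMono hd).monotone hℓL
      linarith
    simp only [h1, Finset.sum_const, Finset.card_univ, Fintype.card_fin, nsmul_eq_mul]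
    calc (1 + eigenval d ℓ) ^ β * (mult d ℓ * δ ^ 2)
        ≤ (1 + eigenval d L) ^ β * (mult d ℓ * δ ^ 2) := by gcongr
      _ = _ := by ring
  · intro ℓ hℓ
    have hℓL : L < ℓ := by
      rw [Finset.mem_range] at hℓ; omega
    simp [coeff_toL2_synth_of_lt hd hY _ hℓL]

theorem flip_involutive {ι : Type*} [DecidableEq ι] (j : ι) :
    Function.Involutive fun θ : ι → Bool => Function.update θ j (!θ j) := by
  intro θ
  funext i
  by_cases h : i = j
  · subst h; simp
  · simp [h]

theorem measurable_coeff_comp {d n : ℕ} (Y : HarmonicFamily d) {T : Data d n → L2 d}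
    (hT : StronglyMeasurable T) (ℓ : ℕ) (m : Fin (mult d ℓ)) :
    Measurable fun z => coeff Y (T z) ℓ m := by
  have h : (fun z => coeff Y (T z) ℓ m) = fun z => inner ℝ (vec Y ⟨ℓ, m⟩) (T z) :=
    funext fun z => coeff_eq_inner Y (T z) ⟨ℓ, m⟩
  rw [h]
  exact (StronglyMeasurable.inner stronglyMeasurable_const hT).measurable

/-- Assouad: the worst risk dominates the average over the sign vectors, and the squared error
dominates the sum of the coordinate errors. In each coordinate, sign vectors are paired with their
flips. The functions of a pair are at L² distance 2δ, which `hn` makes small enough for the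
two-point bound. -/
theorem worstCaseRisk_ge {d n L : ℕ} (hd : 1 ≤ d) {Y : HarmonicFamily d}
    (hY : IsSphericalHarmonicBasis Y) {σ β R δ : ℝ} (hσ : 0 < σ) (hβ : 0 ≤ β) (hδ0 : 0 ≤ δ)
    (hδ : δ ^ 2 * dimLe d L * (1 + eigenval d L) ^ β ≤ R ^ 2) (hn : n * δ ^ 2 ≤ σ ^ 2)
    {T : Data d n → L2 d} (hT : StronglyMeasurable T) :
    ENNReal.ofReal (dimLe d L * (δ ^ 2 / 4)) ≤ worstCaseRisk σ n (sobolevBall Y β R) T := by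
  classical
  set W := worstCaseRisk σ n (sobolevBall Y β R) T with hW
  set F : (Idx d L → Bool) → L2 d := fun θ => toL2 (synth Y (hypercube δ θ)) with hF
  set G : (Idx d L → Bool) → Idx d L → ℝ≥0∞ := fun θ j =>
    ∫⁻ z, ENNReal.ofReal ((coeff Y (T z) j.1 j.2 - hypercube δ θ j) ^ 2) ∂(dataLaw σ (F θ) n)
    with hG
  have hm := fun j : Idx d L => measurable_coeff_comp Y hT j.1 j.2
  have h1 : ∀ θ, ∑ j, G θ j ≤ W := by
    intro θ
    have hle : ∫⁻ z, ‖T z - F θ‖ₑ ^ 2 ∂(dataLaw σ (F θ) n) ≤ W :=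
      le_iSup₂ (f := fun f (_ : f ∈ sobolevBall Y β R) =>
        ∫⁻ z, ‖T z - f‖ₑ ^ 2 ∂(dataLaw σ f n)) (F θ)
        (toL2_hypercube_mem_sobolevBall hd hY hβ hδ θ)
    refine le_trans ?_ hle
    rw [← lintegral_finsetSum _ fun j _ => (((hm j).sub_const _).pow_const 2).ennreal_ofReal]
    refine lintegral_mono fun z => ?_
    rw [enorm_sq_eq_ofReal, ← ENNReal.ofReal_sum_of_nonneg fun j _ => sq_nonneg _]
    exact ENNReal.ofReal_le_ofReal (sum_sq_coeff_sub_le hd hY _ _)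
  have h2 : ∀ θ j, ENNReal.ofReal (δ ^ 2 / 2) ≤
      G θ j + G (Function.update θ j (!θ j)) j := by
    intro θ j
    refine two_point_bound hσ _ _ ?_ (hm j) hδ0 ?_
    · have e : F θ - F (Function.update θ j (!θ j)) =
          toL2 (synth Y (hypercube δ θ - hypercube δ (Function.update θ j (!θ j)))) := by
        simp only [hF, ← map_sub]
        congr 1
        simp [synth, sub_smul, Finset.sum_sub_distrib]
      rw [e, norm_toL2_synth_sq hd hY, Finset.sum_eq_single j]
      · have : (hypercube δ θ - hypercube δ (Function.update θ j (!θ j))) j ^ 2 = 4 * δ ^ 2 := by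
          simp only [Pi.sub_apply, hypercube, Function.update_self]
          cases θ j <;> simp <;> ring
        rw [this]
        linarith
      · intro i _ hi
        simp [hypercube, hi]
      · simp
    · simp only [hypercube, Function.update_self]
      cases θ j
      · simp only [Bool.false_eq_true, if_false, Bool.not_false, if_true]
        rw [show -δ - δ = -(2 * δ) by ring, abs_neg, abs_of_nonneg (by positivity)]
      · simp only [if_true, Bool.not_true, Bool.false_eq_true, if_false]
        rw [show δ - -δ = 2 * δ by ring, abs_of_nonneg (by positivity)]
  set N : ℝ≥0∞ := (Fintype.card (Idx d L → Bool) : ℝ≥0∞) with hN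
  have h3 : ∀ j, N * ENNReal.ofReal (δ ^ 2 / 2) ≤ 2 * ∑ θ, G θ j := by
    intro j
    -- Flipping a sign permutes the cube, so both halves of the pair have the same total.
    have hsum : ∑ θ, G (Function.update θ j (!θ j)) j = ∑ θ, G θ j :=
      Equiv.sum_comp (Function.Involutive.toPerm _ (flip_involutive j)) fun θ => G θ j
    calc N * ENNReal.ofReal (δ ^ 2 / 2) = ∑ _θ : Idx d L → Bool, ENNReal.ofReal (δ ^ 2 / 2) := by
          rw [Finset.sum_const, Finset.card_univ, nsmul_eq_mul]
      _ ≤ ∑ θ, (G θ j + G (Function.update θ j (!θ j)) j) := Finset.sum_le_sum fun θ _ => h2 θ j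
      _ = 2 * ∑ θ, G θ j := by rw [Finset.sum_add_distrib, hsum, two_mul]
  have h4 : N * (dimLe d L * ENNReal.ofReal (δ ^ 2 / 2)) ≤ N * (2 * W) := by
    calc N * (dimLe d L * ENNReal.ofReal (δ ^ 2 / 2))
        = ∑ _j : Idx d L, N * ENNReal.ofReal (δ ^ 2 / 2) := by
          rw [Finset.sum_const, Finset.card_univ, card_idx, nsmul_eq_mul]; ring
      _ ≤ ∑ j, 2 * ∑ θ, G θ j := Finset.sum_le_sum fun j _ => h3 j
      _ = 2 * ∑ θ, ∑ j, G θ j := by rw [← Finset.mul_sum, Finset.sum_comm]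
      _ ≤ 2 * ∑ _θ : Idx d L → Bool, W := by gcongr with θ; exact h1 θ
      _ = N * (2 * W) := by
          rw [Finset.sum_const, Finset.card_univ, nsmul_eq_mul]; ring
  have hN0 : N ≠ 0 := by simp [hN]
  have hNt : N ≠ ∞ := by simp [hN]
  have h5 := (ENNReal.mul_le_mul_iff_right hN0 hNt).1 h4
  refine (ENNReal.mul_le_mul_iff_right (a := 2) (by simp) (by simp)).1 (le_trans (le_of_eq ?_) h5)
  have e2 : (2 : ℝ≥0∞) = ENNReal.ofReal 2 := by simp
  have e3 : ((dimLe d L : ℕ) : ℝ≥0∞) = ENNReal.ofReal (dimLe d L) := by simp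
  rw [e2, e3, ← ENNReal.ofReal_mul (by norm_num), ← ENNReal.ofReal_mul (by positivity)]
  congr 1
  ring

/-! ### The minimax rate -/

/-- The resolution level `n ^ (1 / (2 β + d))`. -/
def resolution (d : ℕ) (β : ℝ) (n : ℕ) : ℝ := (n : ℝ) ^ (1 / (2 * β + d))

theorem one_le_resolution {d n : ℕ} {β : ℝ} (hβ : 0 ≤ β) (hn : 1 ≤ n) :
    1 ≤ resolution d β n :=
  Real.one_le_rpow (by exact_mod_cast hn) (by positivity)

theorem resolution_rpow_mul_pow {d n : ℕ} {β : ℝ} (hβ : 0 < β) (hn : 1 ≤ n) :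
    resolution d β n ^ (2 * β) * resolution d β n ^ d = n := by
  have hN : 0 < resolution d β n := one_pos.trans_le (one_le_resolution hβ.le hn)
  have hp : 2 * β + d ≠ 0 := by positivity
  rw [← Real.rpow_natCast, ← Real.rpow_add hN, resolution, ← Real.rpow_mul (Nat.cast_nonneg _),
    one_div_mul_cancel hp, Real.rpow_one]

theorem rate_sq {d n : ℕ} {β : ℝ} :
    ((n : ℝ) ^ (-β / (2 * β + d))) ^ 2 = resolution d β n ^ (-(2 * β)) := by
  rw [← Real.rpow_natCast, resolution, ← Real.rpow_mul (Nat.cast_nonneg _),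
    ← Real.rpow_mul (Nat.cast_nonneg _)]
  congr 1
  push_cast
  ring

/-- The balance that defines the rate: the variance of N^d coefficients is the squared bias at level
N. -/
theorem pow_div_eq_rate {d n : ℕ} {β : ℝ} (hβ : 0 < β) (hn : 1 ≤ n) :
    resolution d β n ^ d / n = resolution d β n ^ (-(2 * β)) := by
  have hN : 0 < resolution d β n := one_pos.trans_le (one_le_resolution hβ.le hn)
  have hn' : (0 : ℝ) < n := by positivity
  rw [Real.rpow_neg hN.le, div_eq_iff hn'.ne', ← resolution_rpow_mul_pow (d := d) hβ hn]
  have : resolution d β n ^ (2 * β) ≠ 0 := (Real.rpow_pos_of_pos hN _).ne'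
  field_simp

theorem rpow_sq_neg {N β : ℝ} (hN : 0 < N) : (N ^ 2) ^ (-β) = N ^ (-(2 * β)) := by
  rw [← Real.rpow_natCast, ← Real.rpow_mul hN.le]
  congr 1
  push_cast
  ring

theorem one_add_eigenval_rpow_neg_le {d ℓ : ℕ} (hd : 1 ≤ d) {N β : ℝ} (hN : 0 < N) (hβ : 0 ≤ β)
    (h : N ≤ ℓ) : (1 + eigenval d ℓ) ^ (-β) ≤ N ^ (-(2 * β)) := by
  rw [← rpow_sq_neg hN]
  refine Real.rpow_le_rpow_of_nonpos (by positivity) ?_ (by linarith)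
  have h1 := sq_le_eigenval hd ℓ
  nlinarith

theorem le_one_add_eigenval_rpow_neg {d ℓ : ℕ} (hd : 1 ≤ d) {N β : ℝ} (hN : 0 < N) (hβ : 0 ≤ β)
    (h : (ℓ : ℝ) + 1 ≤ N) :
    ((d : ℝ) + 1) ^ (-β) * N ^ (-(2 * β)) ≤ (1 + eigenval d ℓ) ^ (-β) := by
  rw [← rpow_sq_neg hN, ← Real.mul_rpow (by positivity) (by positivity)]
  refine Real.rpow_le_rpow_of_nonpos (one_add_eigenval_pos hd ℓ) ?_ (by linarith)
  refine (one_add_eigenval_le hd ℓ).trans ?_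
  gcongr

/-- The projection estimator with L the integer part of N. The constants come from L + 1 ≤ 2N in the
variance and N ≤ L + 1 in the bias. -/
theorem minimaxRisk_le_rate {d n : ℕ} (hd : 1 ≤ d) {Y : HarmonicFamily d}
    (hY : IsSphericalHarmonicBasis Y) (hn : 1 ≤ n) (σ : ℝ) {β : ℝ} (R : ℝ) (hβ : 0 < β) :
    minimaxRisk σ n (sobolevBall Y β R) ≤
      ENNReal.ofReal (((R ^ 2 + σ ^ 2) * (2 * (d + 1) ^ d * 2 ^ d) + R ^ 2) *
        resolution d β n ^ (-(2 * β))) := by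
  set N := resolution d β n with hNdef
  have hN1 : 1 ≤ N := one_le_resolution hβ.le hn
  have hN : 0 < N := one_pos.trans_le hN1
  have hn' : (0 : ℝ) < n := by positivity
  set L := ⌊N⌋₊ with hL
  have hLN : (L : ℝ) ≤ N := Nat.floor_le hN.le
  have hNL : N ≤ ((L + 1 : ℕ) : ℝ) := by
    push_cast
    exact (Nat.lt_floor_add_one N).le
  refine (iInf₂_le (projEst Y L n) (stronglyMeasurable_projEst Y L n)).trans
    (iSup₂_le fun f hf => (risk_projEst_le hd hY hn σ hβ.le hf).trans
      (ENNReal.ofReal_le_ofReal ?_))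
  have h1 := one_add_eigenval_rpow_neg_le hd hN hβ.le hNL
  have h2 : (dimLe d L : ℝ) ≤ 2 * (d + 1) ^ d * 2 ^ d * N ^ d := by
    have : (dimLe d L : ℝ) ≤ 2 * (d + 1) ^ d * (L + 1) ^ d := by exact_mod_cast dimLe_le hd L
    have h3 : ((L : ℝ) + 1) ^ d ≤ (2 * N) ^ d := by
      gcongr
      linarith
    calc (dimLe d L : ℝ) ≤ 2 * (d + 1) ^ d * (L + 1) ^ d := this
      _ ≤ 2 * (d + 1) ^ d * (2 * N) ^ d := by gcongr
      _ = _ := by rw [mul_pow]; ring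
  calc (R ^ 2 + σ ^ 2) * dimLe d L / n + R ^ 2 * (1 + eigenval d (L + 1)) ^ (-β)
      ≤ (R ^ 2 + σ ^ 2) * (2 * (d + 1) ^ d * 2 ^ d * N ^ d) / n + R ^ 2 * N ^ (-(2 * β)) := by
        gcongr
    _ = (R ^ 2 + σ ^ 2) * (2 * (d + 1) ^ d * 2 ^ d) * (N ^ d / n) + R ^ 2 * N ^ (-(2 * β)) := by
        ring
    _ = _ := by
        rw [hNdef, pow_div_eq_rate hβ hn]
        ring

/-- The constant of the minimax lower bound. -/
def lowerConst (d : ℕ) (σ β R : ℝ) : ℝ :=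
  min (σ ^ 2 / d.factorial) (R ^ 2 * (((d : ℝ) + 1) ^ (-β) * 2 ^ (-(2 * β)))) / 4

theorem lowerConst_pos (d : ℕ) {σ β R : ℝ} (hσ : 0 < σ) (hR : 0 < R) :
    0 < lowerConst d σ β R := by
  unfold lowerConst
  positivity

/-- Assouad's bound with L the integer part of N: both constraints on δ² allow a multiple of 1/n,
and the dimension is at least N^d / d!. -/
theorem rate_le_worstCaseRisk {d n : ℕ} (hd : 1 ≤ d) {Y : HarmonicFamily d}
    (hY : IsSphericalHarmonicBasis Y) (hn : 1 ≤ n) {σ β : ℝ} (R : ℝ) (hσ : 0 < σ) (hβ : 0 < β)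
    {T : Data d n → L2 d} (hT : StronglyMeasurable T) :
    ENNReal.ofReal (lowerConst d σ β R * resolution d β n ^ (-(2 * β))) ≤
      worstCaseRisk σ n (sobolevBall Y β R) T := by
  set N := resolution d β n with hNdef
  have hN1 : 1 ≤ N := one_le_resolution hβ.le hn
  have hN : 0 < N := one_pos.trans_le hN1
  have hn' : (0 : ℝ) < n := by positivity
  set L := ⌊N⌋₊ with hL
  have hLN : (L : ℝ) ≤ N := Nat.floor_le hN.le
  have hNL : N ≤ (L : ℝ) + 1 := (Nat.lt_floor_add_one N).le
  have hr : 0 < N ^ (-(2 * β)) := Real.rpow_pos_of_pos hN _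
  have hDN : N ^ d / d.factorial ≤ dimLe d L := by
    refine le_trans ?_ (pow_le_dimLe hd L)
    gcongr
  have hD : (0 : ℝ) < dimLe d L := lt_of_lt_of_le (by positivity) hDN
  have hE := one_add_eigenval_pos hd L
  -- The largest δ² allowed: the first term keeps neighbouring hypotheses indistinguishable, the
  -- second keeps the cube inside the ball.
  set δ2 := min (σ ^ 2 / n) (R ^ 2 * (1 + eigenval d L) ^ (-β) / dimLe d L) with hδ2
  have hδ0 : 0 ≤ δ2 := by positivity
  have hsq : √δ2 ^ 2 = δ2 := Real.sq_sqrt hδ0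
  have key := worstCaseRisk_ge (δ := √δ2) (R := R) (L := L) (β := β) hd hY hσ hβ.le
    (Real.sqrt_nonneg _) ?_ ?_ hT
  · refine le_trans (ENNReal.ofReal_le_ofReal ?_) key
    rw [hsq]
    have h1 : σ ^ 2 / d.factorial * N ^ (-(2 * β)) ≤ dimLe d L * (σ ^ 2 / n) := by
      rw [hNdef, ← pow_div_eq_rate hβ hn, ← hNdef]
      calc σ ^ 2 / d.factorial * (N ^ d / n) = (N ^ d / d.factorial) * (σ ^ 2 / n) := by ring
        _ ≤ _ := by gcongr
    have h2 : R ^ 2 * (((d : ℝ) + 1) ^ (-β) * 2 ^ (-(2 * β))) * N ^ (-(2 * β)) ≤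
        dimLe d L * (R ^ 2 * (1 + eigenval d L) ^ (-β) / dimLe d L) := by
      rw [mul_div_cancel₀ _ hD.ne', mul_assoc, mul_assoc, ← Real.mul_rpow (by norm_num) hN.le]
      gcongr
      exact le_one_add_eigenval_rpow_neg hd (by positivity) hβ.le (by linarith)
    rw [lowerConst, hδ2, mul_div_assoc', mul_min_of_nonneg _ _ hD.le, div_mul_eq_mul_div]
    gcongr
    rw [min_mul_of_nonneg _ _ hr.le]
    exact min_le_min h1 h2
  · rw [hsq]
    have h3 : (1 + eigenval d L) ^ (-β) * (1 + eigenval d L) ^ β = 1 := by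
      rw [← Real.rpow_add hE, neg_add_cancel, Real.rpow_zero]
    calc δ2 * dimLe d L * (1 + eigenval d L) ^ β
        ≤ R ^ 2 * (1 + eigenval d L) ^ (-β) / dimLe d L * dimLe d L * (1 + eigenval d L) ^ β := by
          gcongr
          exact min_le_right _ _
      _ = R ^ 2 * ((1 + eigenval d L) ^ (-β) * (1 + eigenval d L) ^ β) := by field_simp
      _ ≤ R ^ 2 := by rw [h3, mul_one]
  · rw [hsq]
    calc n * δ2 ≤ n * (σ ^ 2 / n) := by
          gcongr
          exact min_le_left _ _
      _ ≤ σ ^ 2 := by field_simp; exact le_rfl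

theorem eventually_sq_lt_worstCaseRisk {d : ℕ} (hd : 1 ≤ d) {Y : HarmonicFamily d}
    (hY : IsSphericalHarmonicBasis Y) {σ β R : ℝ} (hσ : 0 < σ) (hβ : 0 < β) (hR : 0 < R)
    {T : (n : ℕ) → Data d n → L2 d} (hT : ∀ n, StronglyMeasurable (T n)) {r : ℕ → ℝ}
    (hr : r =o[atTop] fun n : ℕ => (n : ℝ) ^ (-β / (2 * β + d))) :
    ∀ᶠ n in atTop, ENNReal.ofReal (r n ^ 2) < worstCaseRisk σ n (sobolevBall Y β R) (T n) := by
  have hc := lowerConst_pos d (β := β) hσ hR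
  -- Half of the lower constant leaves room for the strict inequality.
  have h := (isLittleO_iff.1 hr) (c := √(lowerConst d σ β R / 2)) (by positivity)
  filter_upwards [h, eventually_ge_atTop 1] with n h1 hn
  refine lt_of_lt_of_le ?_ (rate_le_worstCaseRisk hd hY hn R hσ hβ (hT n))
  have hr : 0 < resolution d β n ^ (-(2 * β)) :=
    Real.rpow_pos_of_pos (one_pos.trans_le (one_le_resolution hβ.le hn)) _
  rw [ENNReal.ofReal_lt_ofReal_iff (by positivity)]
  have h2 : ‖r n‖ ^ 2 ≤ (√(lowerConst d σ β R / 2) * ‖(n : ℝ) ^ (-β / (2 * β + d))‖) ^ 2 := by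
    gcongr
  rw [mul_pow, Real.sq_sqrt (by positivity), Real.norm_eq_abs, Real.norm_eq_abs, sq_abs, sq_abs,
    rate_sq] at h2
  refine h2.trans_lt ?_
  gcongr
  linarith

/-! ### Tails of Gaussian posteriors -/

theorem lintegral_comp_const_smul {ι : Type*} [Fintype ι] {r : ℝ} (hr : 0 < r)
    {F : (ι → ℝ) → ℝ≥0∞} (hF : Measurable F) :
    ∫⁻ u, F u = ENNReal.ofReal (r ^ Fintype.card ι) * ∫⁻ u, F (r • u) := by
  have h := Measure.map_addHaar_smul (volume : Measure (ι → ℝ)) hr.ne'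
  have h2 : ∫⁻ u, F u ∂((volume : Measure (ι → ℝ)).map (r • ·)) = ∫⁻ u, F (r • u) :=
    lintegral_map hF (measurable_const_smul r)
  rw [← h2, h, lintegral_smul_measure, smul_eq_mul, ← mul_assoc,
    ← ENNReal.ofReal_mul (by positivity), Module.finrank_fintype_fun_eq_card,
    abs_of_pos (by positivity), mul_inv_cancel₀ (by positivity), ENNReal.ofReal_one, one_mul]

/-- On the tail, half of q is spent on absorbing h and producing the decay in t. The other half
remains integrable, and rescaling by √2 compares its integral with that of exp(-q/2). Evenness of q
and oddness of h show that h can only increase the total integral. -/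
theorem setLIntegral_exp_tail_le {ι : Type*} [Fintype ι] {q h : (ι → ℝ) → ℝ}
    (hqm : Measurable q) (hhm : Measurable h) (hq : ∀ (c : ℝ) u, q (c • u) = c ^ 2 * q u)
    (hh : ∀ (c : ℝ) u, h (c • u) = c * h u) {κ H : ℝ} (t : ℝ) (hκ : 0 < κ)
    (hqκ : ∀ u, κ * ∑ i, u i ^ 2 ≤ q u) (hH0 : 0 ≤ H) (hhH : ∀ u, h u ^ 2 ≤ H * ∑ i, u i ^ 2) :
    ∫⁻ u in {u : ι → ℝ | t < ∑ i, u i ^ 2}, ENNReal.ofReal (Real.exp (-(q u) / 2 + h u)) ≤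
      ENNReal.ofReal (Real.exp (2 * H / κ - κ * t / 8) * √2 ^ Fintype.card ι) *
        ∫⁻ u, ENNReal.ofReal (Real.exp (-(q u) / 2 + h u)) := by
  have hS : MeasurableSet {u : ι → ℝ | t < ∑ i, u i ^ 2} :=
    measurableSet_lt measurable_const (by fun_prop)
  have hm1 : Measurable fun u => ENNReal.ofReal (Real.exp (-(q u) / 2 + h u)) := by fun_prop
  have hm2 : Measurable fun u => ENNReal.ofReal (Real.exp (-(q u) / 4)) := by fun_prop
  have hm3 : Measurable fun u => ENNReal.ofReal (Real.exp (-(q u) / 2)) := by fun_prop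
  have hpt : ∀ u : ι → ℝ, t < ∑ i, u i ^ 2 → ENNReal.ofReal (Real.exp (-(q u) / 2 + h u)) ≤
      ENNReal.ofReal (Real.exp (2 * H / κ - κ * t / 8)) *
        ENNReal.ofReal (Real.exp (-(q u) / 4)) := by
    intro u hu
    rw [← ENNReal.ofReal_mul (Real.exp_nonneg _), ← Real.exp_add]
    refine ENNReal.ofReal_le_ofReal (Real.exp_le_exp.2 ?_)
    have hS0 : 0 ≤ ∑ i, u i ^ 2 := Finset.sum_nonneg fun i _ => sq_nonneg _
    -- Arithmetic-geometric mean inequality, balanced so that h uses only κ|u|²/8 of the available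
    -- q/4 ≥ κ|u|²/4.
    have hb : h u ≤ 2 * H / κ + κ * (∑ i, u i ^ 2) / 8 := by
      refine le_of_sq_le_sq ?_ (by positivity)
      refine (hhH u).trans ?_
      have e : H * ∑ i, u i ^ 2 = 4 * (2 * H / κ) * (κ * (∑ i, u i ^ 2) / 8) := by
        field_simp
        ring
      rw [e]
      nlinarith [sq_nonneg (2 * H / κ - κ * (∑ i, u i ^ 2) / 8)]
    have h1 := hqκ u
    have h2 : κ * t ≤ κ * ∑ i, u i ^ 2 := mul_le_mul_of_nonneg_left hu.le hκ.le
    linarith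
  have hscale : ∫⁻ u, ENNReal.ofReal (Real.exp (-(q u) / 4)) =
      ENNReal.ofReal (√2 ^ Fintype.card ι) * ∫⁻ u, ENNReal.ofReal (Real.exp (-(q u) / 2)) := by
    rw [lintegral_comp_const_smul (r := √2) (by positivity) hm2]
    congr 2
    funext u
    rw [hq, Real.sq_sqrt (by norm_num)]
    congr 2
    ring
  -- Averaging over u and -u replaces exp(h) by cosh(h) ≥ 1.
  have heven : ∫⁻ u, ENNReal.ofReal (Real.exp (-(q u) / 2)) ≤
      ∫⁻ u, ENNReal.ofReal (Real.exp (-(q u) / 2 + h u)) := by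
    have hneg : ∫⁻ u, ENNReal.ofReal (Real.exp (-(q u) / 2 - h u)) =
        ∫⁻ u, ENNReal.ofReal (Real.exp (-(q u) / 2 + h u)) := by
      rw [← lintegral_neg_eq_self fun u => ENNReal.ofReal (Real.exp (-(q u) / 2 + h u))]
      refine lintegral_congr fun u => ?_
      have h1 := hq (-1) u
      have h2 := hh (-1) u
      rw [neg_one_smul] at h1 h2
      rw [h1, h2]
      congr 2
      ring
    have h2 : 2 * ∫⁻ u, ENNReal.ofReal (Real.exp (-(q u) / 2)) ≤
        2 * ∫⁻ u, ENNReal.ofReal (Real.exp (-(q u) / 2 + h u)) := by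
      conv_rhs => rw [two_mul]
      nth_rewrite 2 [← hneg]
      rw [← lintegral_add_left hm1, ← lintegral_const_mul _ hm3]
      refine lintegral_mono fun u => ?_
      have e2 : (2 : ℝ≥0∞) = ENNReal.ofReal 2 := by simp
      rw [e2, ← ENNReal.ofReal_mul (by norm_num),
        ← ENNReal.ofReal_add (Real.exp_nonneg _) (Real.exp_nonneg _)]
      refine ENNReal.ofReal_le_ofReal ?_
      rw [sub_eq_add_neg, Real.exp_add, Real.exp_add]
      have h3 := Real.add_one_le_exp (h u)
      have h4 := Real.add_one_le_exp (-h u)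
      nlinarith [Real.exp_nonneg (-(q u) / 2)]
    exact (ENNReal.mul_le_mul_iff_right (by simp) (by simp)).1 h2
  calc ∫⁻ u in {u : ι → ℝ | t < ∑ i, u i ^ 2}, ENNReal.ofReal (Real.exp (-(q u) / 2 + h u))
      ≤ ∫⁻ u in {u : ι → ℝ | t < ∑ i, u i ^ 2}, ENNReal.ofReal (Real.exp (2 * H / κ - κ * t / 8)) *
        ENNReal.ofReal (Real.exp (-(q u) / 4)) := setLIntegral_mono' hS hpt
    _ ≤ ∫⁻ u, ENNReal.ofReal (Real.exp (2 * H / κ - κ * t / 8)) *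
        ENNReal.ofReal (Real.exp (-(q u) / 4)) := setLIntegral_le_lintegral _ _
    _ = ENNReal.ofReal (Real.exp (2 * H / κ - κ * t / 8) * √2 ^ Fintype.card ι) *
        ∫⁻ u, ENNReal.ofReal (Real.exp (-(q u) / 2)) := by
        rw [lintegral_const_mul _ hm2, hscale, ← mul_assoc, ENNReal.ofReal_mul (Real.exp_nonneg _)]
    _ ≤ _ := by gcongr

theorem bayes_apply_le {Θ : Type*} [MeasurableSpace Θ] (π : Measure Θ) (lik : Θ → ℝ≥0∞)
    {S : Set Θ} (hS : MeasurableSet S) {ε : ℝ≥0∞}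
    (h : ∫⁻ a in S, lik a ∂π ≤ ε * ∫⁻ a, lik a ∂π) : bayes π lik S ≤ ε := by
  rw [bayes, Measure.smul_apply, withDensity_apply _ hS, smul_eq_mul, mul_comm, ← div_eq_mul_inv]
  exact ENNReal.div_le_of_le_mul h

/-- Valid also when the evidence is 0 or ∞, by the conventions of division, so the evidence need not
be examined. -/
theorem bayes_apply_le_one {Θ : Type*} [MeasurableSpace Θ] (π : Measure Θ) (lik : Θ → ℝ≥0∞)
    (S : Set Θ) : bayes π lik S ≤ 1 := by
  refine (measure_mono (Set.subset_univ S)).trans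
    (bayes_apply_le π lik MeasurableSet.univ ?_)
  rw [one_mul, Measure.restrict_univ]

theorem gaussianPDF_add (m u y : ℝ) (v : ℝ≥0) :
    gaussianPDF (m + u) v y =
      gaussianPDF m v y * ENNReal.ofReal (Real.exp (-(u ^ 2 / v) / 2 + (y - m) / v * u)) := by
  rw [gaussianPDF, gaussianPDF, ← ENNReal.ofReal_mul (gaussianPDFReal_nonneg _ _ _),
    gaussianPDFReal, gaussianPDFReal, mul_assoc (√(2 * Real.pi * v))⁻¹, ← Real.exp_add]
  congr 3
  by_cases hv : (v : ℝ) = 0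
  · simp [hv]
  · field_simp
    ring

theorem gaussianPDF_swap (m y : ℝ) (v : ℝ≥0) : gaussianPDF m v y = gaussianPDF y v m := by
  rw [gaussianPDF, gaussianPDF, gaussianPDFReal, gaussianPDFReal]
  congr 4
  ring

/-- The tail of the posterior in a Gaussian linear model with design matrix `X` and
responses `y`, around an arbitrary centre. -/
theorem bayes_gaussian_tail_le {ι J : Type*} [Fintype ι] [Fintype J] {v : ι → ℝ≥0}
    (hv : ∀ i, v i ≠ 0) (τ : ℝ≥0) (X : J → ι → ℝ) (y : J → ℝ) (a₀ : ι → ℝ) {κ : ℝ} (t : ℝ)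
    (hκ : 0 < κ) (hX : ∀ u : ι → ℝ, κ * ∑ i, u i ^ 2 ≤ ∑ j, (∑ i, X j i * u i) ^ 2 / τ) :
    bayes (Measure.pi fun i => gaussianReal 0 (v i))
        (fun a => ∏ j, gaussianPDF (∑ i, X j i * a i) τ (y j))
        {a | t < ∑ i, (a i - a₀ i) ^ 2} ≤
      ENNReal.ofReal (Real.exp (2 * (∑ i, ((∑ j, (y j - ∑ i, X j i * a₀ i) * X j i) / τ -
        a₀ i / v i) ^ 2) / κ - κ * t / 8) * √2 ^ Fintype.card ι) := by
  -- The gradient of the log-posterior at the centre; below, q is the quadratic form of the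
  -- posterior precision.
  set b : ι → ℝ := fun i => (∑ j, (y j - ∑ i, X j i * a₀ i) * X j i) / τ - a₀ i / v i with hb
  set q : (ι → ℝ) → ℝ := fun u => ∑ i, u i ^ 2 / v i + ∑ j, (∑ i, X j i * u i) ^ 2 / τ with hq
  set h : (ι → ℝ) → ℝ := fun u => ∑ i, b i * u i with hh
  set lik : (ι → ℝ) → ℝ≥0∞ := fun a => ∏ j, gaussianPDF (∑ i, X j i * a i) τ (y j) with hlik
  have hlikm : Measurable lik := by
    refine Finset.measurable_fun_prod _ fun j _ => ?_
    have e : (fun a : ι → ℝ => gaussianPDF (∑ i, X j i * a i) τ (y j)) =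
        fun a => gaussianPDF (y j) τ (∑ i, X j i * a i) := funext fun a => gaussianPDF_swap _ _ _
    rw [e]
    exact (measurable_gaussianPDF _ _).comp (by fun_prop)
  set p : (ι → ℝ) → ℝ≥0∞ := fun a => ∏ i, gaussianPDF 0 (v i) (a i) with hp
  have hpm : Measurable p := Finset.measurable_fun_prod _ fun i _ =>
    (measurable_gaussianPDF _ _).comp (measurable_pi_apply i)
  have hπ : Measure.pi (fun i => gaussianReal 0 (v i)) =
      (volume : Measure (ι → ℝ)).withDensity p := by
    have e : (fun i => gaussianReal 0 (v i)) =
        fun i => (volume : Measure ℝ).withDensity (gaussianPDF 0 (v i)) :=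
      funext fun i => gaussianReal_of_var_ne_zero _ (hv i)
    have : ∀ i, SigmaFinite ((volume : Measure ℝ).withDensity (gaussianPDF 0 (v i))) := by
      intro i
      rw [← gaussianReal_of_var_ne_zero _ (hv i)]
      infer_instance
    rw [e, pi_withDensity (μ := fun _ : ι => (volume : Measure ℝ))
      fun i => measurable_gaussianPDF 0 (v i)]
    rfl
  set K : ℝ≥0∞ := p a₀ * lik a₀ with hK
  -- Second-order expansion of the log-posterior at the centre, exact for a Gaussian model. The
  -- constant K cancels in Bayes' formula.
  have hfac : ∀ u, p (u + a₀) * lik (u + a₀) =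
      K * ENNReal.ofReal (Real.exp (-(q u) / 2 + h u)) := by
    intro u
    have e1 : p (u + a₀) = p a₀ *
        ENNReal.ofReal (Real.exp (∑ i, (-(u i ^ 2 / v i) / 2 + (0 - a₀ i) / v i * u i))) := by
      rw [Real.exp_sum, ENNReal.ofReal_prod_of_nonneg fun _ _ => Real.exp_nonneg _,
        ← Finset.prod_mul_distrib]
      refine Finset.prod_congr rfl fun i _ => ?_
      rw [gaussianPDF_swap 0 (a₀ i), ← gaussianPDF_add, gaussianPDF_swap, Pi.add_apply, add_comm]
    have e2 : lik (u + a₀) = lik a₀ *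
        ENNReal.ofReal (Real.exp (∑ j, (-((∑ i, X j i * u i) ^ 2 / τ) / 2 +
          (y j - ∑ i, X j i * a₀ i) / τ * ∑ i, X j i * u i))) := by
      rw [Real.exp_sum, ENNReal.ofReal_prod_of_nonneg fun _ _ => Real.exp_nonneg _,
        ← Finset.prod_mul_distrib]
      refine Finset.prod_congr rfl fun j _ => ?_
      rw [← gaussianPDF_add, ← Finset.sum_add_distrib]
      congr 1
      exact Finset.sum_congr rfl fun i _ => by rw [Pi.add_apply]; ring
    rw [e1, e2, mul_mul_mul_comm, ← ENNReal.ofReal_mul (Real.exp_nonneg _), ← Real.exp_add]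
    congr 3
    have e3 : ∑ j, (y j - ∑ i, X j i * a₀ i) / τ * ∑ i, X j i * u i =
        ∑ i, (∑ j, (y j - ∑ i, X j i * a₀ i) * X j i) / τ * u i := by
      simp only [Finset.mul_sum, Finset.sum_div, Finset.sum_mul]
      rw [Finset.sum_comm]
      exact Finset.sum_congr rfl fun i _ => Finset.sum_congr rfl fun j _ => by ring
    simp only [Finset.sum_add_distrib, e3, hq, hh, hb, sub_mul, Finset.sum_sub_distrib,
      ← Finset.sum_div, Finset.sum_neg_distrib, zero_sub, neg_div, neg_mul]
    ring
  have hS : MeasurableSet {a : ι → ℝ | t < ∑ i, (a i - a₀ i) ^ 2} :=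
    measurableSet_lt measurable_const (by fun_prop)
  have htail := setLIntegral_exp_tail_le (q := q) (h := h) (κ := κ) (H := ∑ i, b i ^ 2)
    (by fun_prop) (by fun_prop) ?_ ?_ t hκ ?_ (Finset.sum_nonneg fun i _ => sq_nonneg _)
    (fun u => Finset.sum_mul_sq_le_sq_mul_sq _ _ _)
  · refine bayes_apply_le _ _ hS ?_
    rw [hπ, setLIntegral_withDensity_eq_setLIntegral_mul _ hpm hlikm hS,
      lintegral_withDensity_eq_lintegral_mul _ hpm hlikm, ← lintegral_indicator hS,
      ← lintegral_add_right_eq_self _ a₀, ← lintegral_add_right_eq_self (fun a => (p * lik) a) a₀]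
    have hexp : Measurable fun u => ENNReal.ofReal (Real.exp (-(q u) / 2 + h u)) := by fun_prop
    have hS' : MeasurableSet {u : ι → ℝ | t < ∑ i, u i ^ 2} :=
      measurableSet_lt measurable_const (by fun_prop)
    have e4 : ∀ u, ({a : ι → ℝ | t < ∑ i, (a i - a₀ i) ^ 2}.indicator fun a => (p * lik) a)
        (u + a₀) = K * ({u : ι → ℝ | t < ∑ i, u i ^ 2}.indicator
          fun u => ENNReal.ofReal (Real.exp (-(q u) / 2 + h u))) u := by
      intro u
      simp only [Set.indicator_apply, Set.mem_ofPred_eq, Pi.add_apply, add_sub_cancel_right,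
        Pi.mul_apply, hfac]
      split_ifs <;> simp
    simp only [e4, Pi.mul_apply, hfac]
    rw [lintegral_const_mul _ (hexp.indicator hS'), lintegral_const_mul _ hexp,
      lintegral_indicator hS', mul_left_comm]
    gcongr
  · intro c u
    simp only [hq, Pi.smul_apply, smul_eq_mul, mul_add, Finset.mul_sum]
    congr 1
    · exact Finset.sum_congr rfl fun i _ => by ring
    · refine Finset.sum_congr rfl fun j _ => ?_
      have : ∑ i, X j i * (c * u i) = c * ∑ i, X j i * u i := by
        rw [Finset.mul_sum]
        exact Finset.sum_congr rfl fun i _ => by ring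
      rw [this]
      ring
  · intro c u
    simp only [hh, Pi.smul_apply, smul_eq_mul, Finset.mul_sum]
    exact Finset.sum_congr rfl fun i _ => by ring
  · intro u
    -- The likelihood alone supplies the curvature κ; the prior precision is only nonnegative.
    refine (hX u).trans (le_add_of_nonneg_left ?_)
    exact Finset.sum_nonneg fun i _ => by positivity

/-! ### Concentration of empirical coefficients -/

section Markov

variable {Ω : Type*} [MeasurableSpace Ω] {μ : Measure Ω} [IsFiniteMeasure μ]

theorem measure_ge_le_of_integral_le {X : Ω → ℝ} (h0 : ∀ w, 0 ≤ X w) (hX : Integrable X μ)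
    {b c : ℝ} (hb : ∫ w, X w ∂μ ≤ b) (hc : 0 < c) : μ {w | c ≤ X w} ≤ ENNReal.ofReal (b / c) := by
  rw [← ofReal_measureReal]
  refine ENNReal.ofReal_le_ofReal ((le_div_iff₀' hc).2 ?_)
  exact (mul_meas_ge_le_integral_of_nonneg (ae_of_all _ h0) hX c).trans hb

theorem measure_ge_le_of_integral_sq_le {X : Ω → ℝ} (hX : MemLp X 2 μ)
    {b c : ℝ} (hb : ∫ w, X w ^ 2 ∂μ ≤ b) (hc : 0 < c) :
    μ {w | c ≤ X w} ≤ ENNReal.ofReal (b / c ^ 2) := by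
  refine (measure_mono fun w hw => ?_).trans (measure_ge_le_of_integral_le
    (fun w => sq_nonneg (X w)) hX.integrable_sq hb (by positivity : 0 < c ^ 2))
  exact pow_le_pow_left₀ hc.le hw 2

end Markov

theorem ae_pi_fst {d n : ℕ} (σ : ℝ) {P : Sph d → Prop} (h : ∀ᵐ x ∂(unif d), P x) :
    ∀ᵐ w ∂(Measure.pi fun _ : Fin n => baseLaw d σ), ∀ k, P (w k).1 :=
  ae_all_iff.2 fun k => (measurePreserving_eval (fun _ : Fin n => baseLaw d σ)
    k).quasiMeasurePreserving.ae (Measure.quasiMeasurePreserving_fst.ae h)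

theorem sum_coeff_sq_le {d : ℕ} (L : ℕ) (hd : 1 ≤ d) {Y : HarmonicFamily d}
    (hY : IsSphericalHarmonicBasis Y) (f : L2 d) :
    ∑ i : Idx d L, coeff Y f i.1 i.2 ^ 2 ≤ ‖f‖ ^ 2 := by
  simpa [synth] using sum_sq_coeff_sub_le (L := L) hd hY 0 f

/-- The variance of the squared noise. -/
def noiseVar (σ : ℝ) : ℝ := ∫ e, (e ^ 2 - σ ^ 2) ^ 2 ∂(noise σ)

theorem memLp_noise_sq (σ : ℝ) : MemLp (fun e : ℝ => e ^ 2 - σ ^ 2) 2 (noise σ) := by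
  refine MemLp.sub ?_ (memLp_const _)
  rw [memLp_two_iff_integrable_sq (by fun_prop)]
  have h := (memLp_noise (σ := σ) 4).integrable_norm_pow (by norm_num)
  refine h.congr (ae_of_all _ fun e => ?_)
  show ‖e‖ ^ 4 = (e ^ 2) ^ 2
  rw [Real.norm_eq_abs, Even.pow_abs (by decide : Even 4), ← pow_mul]

/-- The bound for the square of functions in the Sobolev ball. -/
def supConst (d : ℕ) (β R : ℝ) : ℝ := R ^ 2 * embConst d β

/-- A bound on the covariance operator of the scores that does not grow with L. It is the pointwise
bound on g, hence the Sobolev embedding, that makes it possible. -/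
theorem integral_sum_score_sq_le_of_ae_le {d L : ℕ} (hd : 1 ≤ d) {Y : HarmonicFamily d}
    (hY : IsSphericalHarmonicBasis Y) (σ : ℝ) {g : L2 d} {B : ℝ}
    (hgB : ∀ᵐ x ∂(unif d), g x ^ 2 ≤ B) (u : Coeffs d L) :
    ∫ p, (∑ i, u i * score Y g L i p) ^ 2 ∂(baseLaw d σ) ≤ (B + σ ^ 2) * ∑ i, u i ^ 2 := by
  refine (integral_sum_score_sq_le Y σ g u).trans ?_
  have hs : ∀ x, (synth Y u ^ 2) x = synth Y u x ^ 2 := fun x => rfl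
  have hgi : Integrable (fun x => g x ^ 2 + σ ^ 2) (unif d) :=
    (Lp.memLp g).integrable_sq.add (integrable_const _)
  have hi : Integrable (fun x => (g x ^ 2 + σ ^ 2) * synth Y u x ^ 2) (unif d) :=
    hgi.mul_bdd (c := ‖synth Y u ^ 2‖) (synth Y u ^ 2).continuous.aestronglyMeasurable
      (ae_of_all _ fun x => (synth Y u ^ 2).norm_coe_le_norm x)
  have hi2 : Integrable (fun x => synth Y u x ^ 2) (unif d) := integrable_cont (synth Y u ^ 2)
  have e : ∫ x, synth Y u x ^ 2 ∂(unif d) = ∑ i, u i ^ 2 := by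
    rw [← norm_toL2_synth_sq hd hY, ← integral_sq_eq_norm_sq]
    refine integral_congr_ae ?_
    filter_upwards [ContinuousMap.coeFn_toLp (p := 2) (𝕜 := ℝ) (unif d) (synth Y u)] with x hx
    rw [hx]
  rw [← e, ← integral_const_mul]
  refine integral_mono_ae hi (hi2.const_mul _) ?_
  filter_upwards [hgB] with x hx
  gcongr

/-- A deterministic bound for the diagonal part of the squared norm: by the addition theorem the
only randomness left is the squared noise. -/
theorem sum_score_sq_le {d L : ℕ} (hd : 1 ≤ d) {Y : HarmonicFamily d}
    (hY : IsSphericalHarmonicBasis Y) {g : L2 d} {B R : ℝ} (hgR : ‖g‖ ^ 2 ≤ R ^ 2)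
    (hD : 1 ≤ dimLe d L) {p : Sph d × ℝ} (hp : g p.1 ^ 2 ≤ B) :
    ∑ i, score Y g L i p ^ 2 ≤
      (4 * B + 2 * R ^ 2) * dimLe d L + 4 * dimLe d L * p.2 ^ 2 := by
  have hD' : (1 : ℝ) ≤ dimLe d L := by exact_mod_cast hD
  have h4 : ∀ i : Idx d L, score Y g L i p ^ 2 ≤
      2 * (g p.1 + p.2) ^ 2 * Y i.1 i.2 p.1 ^ 2 + 2 * coeff Y g i.1 i.2 ^ 2 := by
    intro i
    have hsq : ∀ a b c : ℝ, (a * b - c) ^ 2 ≤ 2 * a ^ 2 * b ^ 2 + 2 * c ^ 2 := fun a b c => by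
      nlinarith [sq_nonneg (a * b + c)]
    exact hsq (g p.1 + p.2) (Y i.1 i.2 p.1) (coeff Y g i.1 i.2)
  refine (Finset.sum_le_sum fun i _ => h4 i).trans ?_
  rw [Finset.sum_add_distrib, ← Finset.mul_sum, ← Finset.mul_sum, sum_idx_sq L hd hY]
  have h5 := (sum_coeff_sq_le L hd hY g).trans hgR
  have h6 : (g p.1 + p.2) ^ 2 ≤ 2 * B + 2 * p.2 ^ 2 := by
    nlinarith [sq_nonneg (g p.1 - p.2)]
  have h7 : R ^ 2 ≤ R ^ 2 * dimLe d L := le_mul_of_one_le_right (sq_nonneg _) hD'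
  have h8 : 2 * (g p.1 + p.2) ^ 2 * dimLe d L ≤ 2 * (2 * B + 2 * p.2 ^ 2) * dimLe d L := by gcongr
  linarith

/-- The squared norm is its diagonal plus its off-diagonal part. The diagonal is controlled by the
mean squared noise through Chebyshev. The off-diagonal part has second moment of order n²D, so
exceeding nD has probability of order 1/D. -/
theorem score_concentration {d n : ℕ} (L : ℕ) (hd : 1 ≤ d) {Y : HarmonicFamily d}
    (hY : IsSphericalHarmonicBasis Y) (hn : 1 ≤ n) {σ β R : ℝ} (hσ : 0 < σ)
    (hβ : (d : ℝ) / 2 < β) {g : L2 d} (hg : g ∈ sobolevBall Y β R) (hD : 1 ≤ dimLe d L)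
    (hB : 0 ≤ supConst d β R) :
    (Measure.pi fun _ : Fin n => baseLaw d σ)
      {w | (4 * supConst d β R + 8 * σ ^ 2 + 2 * R ^ 2 + 1) * (n * dimLe d L) <
        ∑ i, (∑ k, score Y g L i (w k)) ^ 2} ≤
      ENNReal.ofReal (noiseVar σ / (n * σ ^ 4)) +
      ENNReal.ofReal (4 * (supConst d β R + σ ^ 2) * (R ^ 2 + σ ^ 2) / dimLe d L) := by
  set B := supConst d β R with hBdef
  have hβ0 : 0 ≤ β := le_trans (by positivity) hβ.le
  have hn' : (0 : ℝ) < n := by positivity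
  have hD' : (1 : ℝ) ≤ dimLe d L := by exact_mod_cast hD
  have hgB : ∀ᵐ x ∂(unif d), g x ^ 2 ≤ B := ae_sq_le_of_mem_sobolevBall hd hY hβ hg
  have hgR := norm_sq_le_of_mem_sobolevBall hd hY hβ0 hg
  obtain ⟨hW, hW2⟩ := memLp_offDiag (memLp_score Y σ g L) (integral_score Y σ g L)
    (integral_sum_score_sq_le_of_ae_le hd hY σ hgB)
    (by positivity) n
  have hoff := measure_ge_le_of_integral_sq_le hW hW2 (c := n * dimLe d L) (by positivity)
  have hmean : ∫ p : Sph d × ℝ, (p.2 ^ 2 - σ ^ 2) ∂(baseLaw d σ) = 0 := by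
    rw [integral_fun_snd (fun e : ℝ => e ^ 2 - σ ^ 2),
      integral_sub (memLp_noise 2).integrable_sq (integrable_const _), integral_noise_sq]
    simp
  have hvar : ∫ p : Sph d × ℝ, (p.2 ^ 2 - σ ^ 2) ^ 2 ∂(baseLaw d σ) = noiseVar σ := by
    rw [integral_fun_snd (fun e : ℝ => (e ^ 2 - σ ^ 2) ^ 2)]
    simp [noiseVar]
  have hεmem : MemLp (fun p : Sph d × ℝ => p.2 ^ 2 - σ ^ 2) 2 (baseLaw d σ) :=
    (memLp_noise_sq σ).comp_snd (unif d)
  have hε := measure_ge_le_of_integral_sq_le (memLp_pi_sum (n := n) hεmem)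
    (integral_pi_sum_sq hεmem hmean).le (c := n * σ ^ 2) (by positivity)
  rw [hvar] at hε
  have h1 : n * noiseVar σ / (n * σ ^ 2) ^ 2 = noiseVar σ / (n * σ ^ 4) := by
    field_simp
  rw [h1] at hε
  have h2 : 4 * (B + σ ^ 2) * (∑ i, ∫ p, score Y g L i p ^ 2 ∂(baseLaw d σ)) * n ^ 2 /
      (n * dimLe d L) ^ 2 ≤ 4 * (B + σ ^ 2) * (R ^ 2 + σ ^ 2) / dimLe d L := by
    have h3 : ∑ i, ∫ p, score Y g L i p ^ 2 ∂(baseLaw d σ) ≤ (R ^ 2 + σ ^ 2) * dimLe d L := by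
      refine (sum_integral_score_sq_le L hd hY σ g).trans ?_
      gcongr
    calc _ ≤ 4 * (B + σ ^ 2) * ((R ^ 2 + σ ^ 2) * dimLe d L) * n ^ 2 / (n * dimLe d L) ^ 2 := by
          gcongr
      _ = _ := by field_simp
  refine le_trans (measure_mono_ae ?_) ((measure_union_le _ _).trans
    (add_le_add hε (hoff.trans (ENNReal.ofReal_le_ofReal h2))))
  filter_upwards [ae_pi_fst (n := n) σ hgB] with w hw hlt
  -- Off both exceptional events the squared noise sums to less than 2nσ², which gives the term 8σ²
  -- of the constant, and the off-diagonal part is below nD, which gives the term 1.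
  by_contra hcon
  have c1' : ∑ k, ((w k).2 ^ 2 - σ ^ 2) < n * σ ^ 2 := not_le.1 fun h => hcon (Or.inl h)
  have c2' : ∑ i, ((∑ k, score Y g L i (w k)) ^ 2 - ∑ k, score Y g L i (w k) ^ 2) <
    n * dimLe d L := not_le.1 fun h => hcon (Or.inr h)
  have hlt' : (4 * B + 8 * σ ^ 2 + 2 * R ^ 2 + 1) * (n * dimLe d L) <
    ∑ i, (∑ k, score Y g L i (w k)) ^ 2 := hlt
  rw [Finset.sum_sub_distrib] at c1' c2'
  simp only [Finset.sum_const, Finset.card_univ, Fintype.card_fin, nsmul_eq_mul] at c1'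
  have hsum : ∑ i, ∑ k, score Y g L i (w k) ^ 2 ≤
      n * ((4 * B + 2 * R ^ 2) * dimLe d L) + 4 * dimLe d L * ∑ k, (w k).2 ^ 2 := by
    rw [Finset.sum_comm]
    refine (Finset.sum_le_sum fun k _ =>
      sum_score_sq_le hd hY hgR hD (hw k)).trans (le_of_eq ?_)
    rw [Finset.sum_add_distrib, Finset.mul_sum, Finset.sum_const, Finset.card_univ,
      Fintype.card_fin, nsmul_eq_mul]
  have h9 : 4 * dimLe d L * ∑ k, (w k).2 ^ 2 ≤ 4 * dimLe d L * (2 * (n * σ ^ 2)) := by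
    gcongr
    linarith
  linarith

/-! ### Concentration of the Gram matrix -/

theorem integral_mul_idx {d L : ℕ} (hd : 1 ≤ d) {Y : HarmonicFamily d}
    (hY : IsSphericalHarmonicBasis Y) (i j : Idx d L) :
    ∫ x, Y i.1 i.2 x * Y j.1 j.2 x ∂(unif d) = (Pi.single i 1 : Coeffs d L) j := by
  rw [← coeff_toL2_synth hd hY (Pi.single i 1) j, coeff]
  refine integral_congr_ae ?_
  filter_upwards [ContinuousMap.coeFn_toLp (p := 2) (𝕜 := ℝ) (unif d)
    (synth Y (Pi.single i 1 : Coeffs d L))] with x hx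
  rw [hx, synth_apply, Finset.sum_eq_single i]
  · simp
  · intro k _ hk
    simp [hk]
  · simp

/-- The deviation of the entries of the Gram matrix from their means. -/
def gramDev {d : ℕ} (Y : HarmonicFamily d) {L n : ℕ} (x : Fin n → Sph d) (i j : Idx d L) : ℝ :=
  ∑ k, (Y i.1 i.2 (x k) * Y j.1 j.2 (x k) - (Pi.single i 1 : Coeffs d L) j)

/-- Markov's inequality for the squared Hilbert-Schmidt norm. Its mean is at most n times the
integral of (∑ Y²)², which is D² by the addition theorem. -/
theorem gram_concentration {d n : ℕ} (L : ℕ) (hd : 1 ≤ d) {Y : HarmonicFamily d}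
    (hY : IsSphericalHarmonicBasis Y) (hn : 1 ≤ n) (σ : ℝ) :
    (Measure.pi fun _ : Fin n => baseLaw d σ)
      {w | (n : ℝ) ^ 2 / 4 ≤ ∑ i : Idx d L, ∑ j : Idx d L, gramDev Y (fun k => (w k).1) i j ^ 2} ≤
      ENNReal.ofReal (4 * (dimLe d L : ℝ) ^ 2 / n) := by
  have hn' : (0 : ℝ) < n := by positivity
  set V : Idx d L → Idx d L → Sph d × ℝ → ℝ := fun i j p =>
    Y i.1 i.2 p.1 * Y j.1 j.2 p.1 - (Pi.single i 1 : Coeffs d L) j with hV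
  have hc : ∀ i j : Idx d L, MemLp (fun p : Sph d × ℝ => Y i.1 i.2 p.1 * Y j.1 j.2 p.1) 2
      (baseLaw d σ) := fun i j =>
    MemLp.comp_fst (f := fun x => Y i.1 i.2 x * Y j.1 j.2 x)
      (MemLp.of_bound (Y i.1 i.2 * Y j.1 j.2).continuous.aestronglyMeasurable
        ‖Y i.1 i.2 * Y j.1 j.2‖ (ae_of_all _ (Y i.1 i.2 * Y j.1 j.2).norm_coe_le_norm)) _
  have hm : ∀ i j, MemLp (V i j) 2 (baseLaw d σ) := fun i j => (hc i j).sub (memLp_const _)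
  have hmean : ∀ i j : Idx d L, ∫ p : Sph d × ℝ, Y i.1 i.2 p.1 * Y j.1 j.2 p.1 ∂(baseLaw d σ) =
      (Pi.single i 1 : Coeffs d L) j := by
    intro i j
    rw [integral_fun_fst (fun x => Y i.1 i.2 x * Y j.1 j.2 x), integral_mul_idx hd hY]
    simp
  have h0 : ∀ i j, ∫ p, V i j p ∂(baseLaw d σ) = 0 := by
    intro i j
    rw [integral_sub ((hc i j).integrable (by norm_num)) (integrable_const _), hmean]
    simp
  have h2 : ∀ i j, ∫ p, V i j p ^ 2 ∂(baseLaw d σ) ≤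
      ∫ x, Y i.1 i.2 x ^ 2 * Y j.1 j.2 x ^ 2 ∂(unif d) := by
    intro i j
    have h := variance_le_expectation_sq (hc i j).1
    rw [variance_eq_integral (hc i j).1.aemeasurable, hmean] at h
    refine h.trans (le_of_eq ?_)
    simp only [Pi.pow_apply, mul_pow]
    rw [integral_fun_fst (fun x => Y i.1 i.2 x ^ 2 * Y j.1 j.2 x ^ 2)]
    simp
  refine (measure_ge_le_of_integral_le (b := n * (dimLe d L : ℝ) ^ 2)
    (fun w => Finset.sum_nonneg fun i _ => Finset.sum_nonneg fun j _ => sq_nonneg _) ?_ ?_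
    (by positivity)).trans (le_of_eq ?_)
  · exact integrable_finsetSum _ fun i _ => integrable_finsetSum _ fun j _ =>
      (memLp_pi_sum (hm i j)).integrable_sq
  · show ∫ w : Fin n → Sph d × ℝ, ∑ i, ∑ j, (∑ k, V i j (w k)) ^ 2
      ∂(Measure.pi fun _ => baseLaw d σ) ≤ _
    rw [integral_finsetSum _ fun i _ => integrable_finsetSum _ fun j _ =>
      (memLp_pi_sum (hm i j)).integrable_sq]
    have e : ∀ i, ∫ w : Fin n → Sph d × ℝ, ∑ j, (∑ k, V i j (w k)) ^ 2
        ∂(Measure.pi fun _ => baseLaw d σ) = ∑ j, n * ∫ p, V i j p ^ 2 ∂(baseLaw d σ) := by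
      intro i
      rw [integral_finsetSum _ fun j _ => (memLp_pi_sum (hm i j)).integrable_sq]
      exact Finset.sum_congr rfl fun j _ => integral_pi_sum_sq (hm i j) (h0 i j)
    simp only [e, ← Finset.mul_sum]
    gcongr
    have hi : ∀ i j : Idx d L, Integrable (fun x => Y i.1 i.2 x ^ 2 * Y j.1 j.2 x ^ 2) (unif d) :=
      fun i j => integrable_cont (Y i.1 i.2 ^ 2 * Y j.1 j.2 ^ 2)
    calc ∑ i, ∑ j, ∫ p, V i j p ^ 2 ∂(baseLaw d σ)
        ≤ ∑ i : Idx d L, ∑ j : Idx d L, ∫ x, Y i.1 i.2 x ^ 2 * Y j.1 j.2 x ^ 2 ∂(unif d) :=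
          Finset.sum_le_sum fun i _ => Finset.sum_le_sum fun j _ => h2 i j
      _ = ∫ x, ∑ i : Idx d L, ∑ j : Idx d L, Y i.1 i.2 x ^ 2 * Y j.1 j.2 x ^ 2 ∂(unif d) := by
          rw [integral_finsetSum _ fun i _ => integrable_finsetSum _ fun j _ => hi i j]
          exact Finset.sum_congr rfl fun i _ => (integral_finsetSum _ fun j _ => hi i j).symm
      _ = (dimLe d L : ℝ) ^ 2 := by
          simp only [← Finset.mul_sum, ← Finset.sum_mul, sum_idx_sq L hd hY]
          simp [sq]
  · congr 1
    field_simp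

/-- A Gram matrix close to its mean is bounded below. -/
theorem le_sum_synth_sq {d n L : ℕ} {Y : HarmonicFamily d} {x : Fin n → Sph d}
    (hx : ∑ i : Idx d L, ∑ j : Idx d L, gramDev Y x i j ^ 2 ≤ (n : ℝ) ^ 2 / 4)
    (u : Coeffs d L) :
    (n : ℝ) / 2 * ∑ i, u i ^ 2 ≤ ∑ k, (∑ i, Y i.1 i.2 (x k) * u i) ^ 2 := by
  have e : ∑ k, (∑ i, Y i.1 i.2 (x k) * u i) ^ 2 =
      n * ∑ i, u i ^ 2 + ∑ i, ∑ j, gramDev Y x i j * (u i * u j) := by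
    have e1 : ∀ i j : Idx d L, gramDev Y x i j * (u i * u j) =
        ∑ k, Y i.1 i.2 (x k) * u i * (Y j.1 j.2 (x k) * u j) -
          n * ((Pi.single i 1 : Coeffs d L) j * (u i * u j)) := by
      intro i j
      simp only [gramDev, Finset.sum_sub_distrib, sub_mul, Finset.sum_mul]
      congr 1
      · exact Finset.sum_congr rfl fun k _ => by ring
      · simp
    have e2 : ∀ i, ∑ j, (Pi.single i 1 : Coeffs d L) j * (u i * u j) = u i ^ 2 := by
      intro i
      rw [Finset.sum_eq_single i]
      · simp [sq]
      · intro j _ hj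
        simp [hj]
      · simp
    simp only [e1, Finset.sum_sub_distrib, ← Finset.mul_sum, e2]
    have e3 : ∑ i : Idx d L, ∑ j : Idx d L, ∑ k, Y i.1 i.2 (x k) * u i * (Y j.1 j.2 (x k) * u j) =
        ∑ k, (∑ i, Y i.1 i.2 (x k) * u i) ^ 2 := by
      simp only [sq, Finset.sum_mul_sum]
      symm
      rw [Finset.sum_comm]
      exact Finset.sum_congr rfl fun i _ => Finset.sum_comm
    rw [e3]
    ring
  -- The Hilbert-Schmidt norm bounds the operator norm: Cauchy-Schwarz over pairs of indices.
  have hcs := Finset.sum_mul_sq_le_sq_mul_sq (Finset.univ : Finset (Idx d L × Idx d L))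
    (fun p => gramDev Y x p.1 p.2) (fun p => u p.1 * u p.2)
  simp only [Fintype.sum_prod_type] at hcs
  have e4 : ∑ i, ∑ j, (u i * u j) ^ 2 = (∑ i, u i ^ 2) ^ 2 := by
    simp only [mul_pow, ← Finset.mul_sum, ← Finset.sum_mul]
    ring
  rw [e4] at hcs
  set S := ∑ i, u i ^ 2 with hS
  have hS0 : 0 ≤ S := Finset.sum_nonneg fun i _ => sq_nonneg _
  have h1 : (∑ i, ∑ j, gramDev Y x i j * (u i * u j)) ^ 2 ≤ (n / 2 * S) ^ 2 := by
    refine hcs.trans ?_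
    calc _ ≤ (n : ℝ) ^ 2 / 4 * S ^ 2 := by gcongr
      _ = _ := by ring
  have h2 := (abs_le_of_sq_le_sq' h1 (by positivity)).1
  rw [e]
  linarith

/-! ### Posterior tails -/

/-- The exponent of the bound for the tail of the posterior. -/
def tailExponent (σ n D K A t : ℝ) : ℝ :=
  8 * K * D / σ ^ 2 + 8 * σ ^ 2 * A / n + D - n * t / (16 * σ ^ 2)

/-- The Gaussian tail bound at κ = n/(2σ²), with H split into a data part of order nD and a prior
part, and the volume factor 2^(D/2) absorbed in exp(D). -/
theorem exp_mul_sqrt_two_pow_le {ι : Type*} [Fintype ι] {σ n : ℝ} (hσ : 0 < σ) (hn : 0 < n)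
    (D : ℕ) {K : ℝ} (t : ℝ) {s b : ι → ℝ} (hs : ∑ i, s i ^ 2 ≤ K * (n * D)) :
    Real.exp (2 * (∑ i, (s i / σ ^ 2 - b i) ^ 2) / (n / (2 * σ ^ 2)) -
      n / (2 * σ ^ 2) * t / 8) * √2 ^ D ≤
      Real.exp (tailExponent σ n D K (∑ i, b i ^ 2) t) := by
  have h1 : ∑ i, (s i / σ ^ 2 - b i) ^ 2 ≤ 2 * (K * (n * D)) / σ ^ 4 + 2 * ∑ i, b i ^ 2 := by
    have h : ∀ i, (s i / σ ^ 2 - b i) ^ 2 ≤ 2 * (s i / σ ^ 2) ^ 2 + 2 * b i ^ 2 := fun i => by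
      nlinarith [sq_nonneg (s i / σ ^ 2 + b i)]
    refine (Finset.sum_le_sum fun i _ => h i).trans ?_
    rw [Finset.sum_add_distrib, ← Finset.mul_sum, ← Finset.mul_sum]
    have e : ∑ i, (s i / σ ^ 2) ^ 2 = (∑ i, s i ^ 2) / σ ^ 4 := by
      rw [Finset.sum_div]
      exact Finset.sum_congr rfl fun i _ => by ring
    rw [e, mul_div_assoc]
    gcongr
  have h2 : √2 ^ D ≤ Real.exp D := by
    have : √2 ≤ Real.exp 1 := by
      rw [Real.sqrt_le_left (Real.exp_nonneg _)]
      have := Real.add_one_le_exp (1 : ℝ)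
      nlinarith
    calc √2 ^ D ≤ Real.exp 1 ^ D := by gcongr
      _ = Real.exp D := by rw [← Real.exp_nat_mul, mul_one]
  have h3 : 2 * (∑ i, (s i / σ ^ 2 - b i) ^ 2) / (n / (2 * σ ^ 2)) ≤
      8 * K * D / σ ^ 2 + 8 * σ ^ 2 * (∑ i, b i ^ 2) / n := by
    calc _ ≤ 2 * (2 * (K * (n * D)) / σ ^ 4 + 2 * ∑ i, b i ^ 2) / (n / (2 * σ ^ 2)) := by gcongr
      _ = _ := by
          field_simp
          ring
  have h4 : n / (2 * σ ^ 2) * t / 8 = n * t / (16 * σ ^ 2) := by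
    field_simp
    ring
  calc _ ≤ Real.exp (2 * (∑ i, (s i / σ ^ 2 - b i) ^ 2) / (n / (2 * σ ^ 2)) -
      n / (2 * σ ^ 2) * t / 8) * Real.exp D := by gcongr
    _ ≤ _ := by
      rw [← Real.exp_add, tailExponent]
      refine Real.exp_le_exp.2 ?_
      rw [h4]
      linarith

theorem harmonicPosterior_tail_le {d n L : ℕ} {Y : HarmonicFamily d} (hn : 1 ≤ n) {σ : ℝ}
    (hσ : 0 < σ) {C : ℕ → ℝ} (hC : ∀ ℓ, 0 < C ℓ) (f : L2 d) (w : Fin n → Sph d × ℝ) {K : ℝ}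
    (hK : ∑ i, (∑ k, score Y f L i (w k)) ^ 2 ≤ K * (n * dimLe d L)) (t : ℝ) :
    harmonicPosterior Y σ C L (dataOf f w) {a | t < ∑ i, (a i - trunc Y f L i) ^ 2} ≤
      ENNReal.ofReal (Real.exp (tailExponent σ n (dimLe d L) K
        (∑ i, (trunc Y f L i / C i.1) ^ 2) t)) := by
  classical
  have hn' : (0 : ℝ) < n := by positivity
  have hτ : ((σ ^ 2 / n).toNNReal : ℝ) = σ ^ 2 / n := Real.coe_toNNReal _ (by positivity)
  have hv : ∀ i : Idx d L, ((C i.1).toNNReal : ℝ) = C i.1 :=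
    fun i => Real.coe_toNNReal _ (hC _).le
  set X : Idx d L → Idx d L → ℝ := fun j i => if j = i then 1 else 0 with hX
  have hXu : ∀ (j : Idx d L) (u : Coeffs d L), ∑ i, X j i * u i = u j := by
    intro j u
    simp [hX]
  have hlik : harmonicLik Y σ (L := L) (dataOf f w) = fun a => ∏ j : Idx d L,
      gaussianPDF (∑ i, X j i * a i) (σ ^ 2 / n).toNNReal (empCoeff Y (dataOf f w) j.1 j.2) := by
    funext a
    simp only [hXu]
    rfl
  have h := bayes_gaussian_tail_le (v := fun i : Idx d L => (C i.1).toNNReal)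
    (fun i => by simpa using hC i.1) (σ ^ 2 / n).toNNReal X
    -- The identity design has curvature n/σ²; half of it is used so that the bound has the same
    -- form as for the regression likelihood.
    (fun j => empCoeff Y (dataOf f w) j.1 j.2) (trunc Y f L) (κ := n / (2 * σ ^ 2)) t
    (by positivity) ?_
  · rw [harmonicPosterior, hlik]
    refine h.trans (ENNReal.ofReal_le_ofReal ?_)
    rw [card_idx]
    have e : ∀ i : Idx d L, (∑ j : Idx d L, (empCoeff Y (dataOf f w) j.1 j.2 -
        ∑ i', X j i' * trunc Y f L i') * X j i) / ((σ ^ 2 / n).toNNReal : ℝ) -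
        trunc Y f L i / ((C i.1).toNNReal : ℝ) =
        (∑ k, score Y f L i (w k)) / σ ^ 2 - trunc Y f L i / C i.1 := by
      intro i
      have e1 : ∑ j : Idx d L, (empCoeff Y (dataOf f w) j.1 j.2 - trunc Y f L j) * X j i =
          empCoeff Y (dataOf f w) i.1 i.2 - trunc Y f L i := by
        simp [hX]
      simp only [hXu, hτ, hv, e1]
      rw [trunc, empCoeff_dataOf hn]
      field_simp
    simp only [e]
    exact exp_mul_sqrt_two_pow_le hσ hn' (dimLe d L) t hK
  · intro u
    simp only [hXu, hτ]
    rw [← Finset.sum_div, div_mul_eq_mul_div, div_div_eq_mul_div]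
    have h0 : 0 ≤ ∑ i, u i ^ 2 := Finset.sum_nonneg fun i _ => sq_nonneg _
    rw [div_le_div_iff₀ (by positivity) (by positivity)]
    have : 0 ≤ (∑ i, u i ^ 2) * n * σ ^ 2 := by positivity
    linarith

/-- After subtraction of the truncated truth, the residuals are observations of the remainder. Its
coefficients of degree at most L vanish, so residual times harmonic is already the centred score of
the remainder. -/
theorem regressionPosterior_tail_le {d n L : ℕ} (hd : 1 ≤ d) {Y : HarmonicFamily d}
    (hY : IsSphericalHarmonicBasis Y) (hn : 1 ≤ n) {σ : ℝ}
    (hσ : 0 < σ) {C : ℕ → ℝ} (hC : ∀ ℓ, 0 < C ℓ) (f : L2 d) (w : Fin n → Sph d × ℝ)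
    (hw : ∀ k, remainder Y L f (w k).1 = f (w k).1 - synth Y (trunc Y f L) (w k).1)
    (hG : ∑ i : Idx d L, ∑ j : Idx d L, gramDev Y (fun k => (w k).1) i j ^ 2 ≤ (n : ℝ) ^ 2 / 4)
    {K : ℝ}
    (hK : ∑ i, (∑ k, score Y (remainder Y L f) L i (w k)) ^ 2 ≤ K * (n * dimLe d L)) (t : ℝ) :
    regressionPosterior Y σ C L (dataOf f w) {a | t < ∑ i, (a i - trunc Y f L i) ^ 2} ≤
      ENNReal.ofReal (Real.exp (tailExponent σ n (dimLe d L) K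
        (∑ i, (trunc Y f L i / C i.1) ^ 2) t)) := by
  have hn' : (0 : ℝ) < n := by positivity
  have hτ : ((σ ^ 2).toNNReal : ℝ) = σ ^ 2 := Real.coe_toNNReal _ (by positivity)
  have hv : ∀ i : Idx d L, ((C i.1).toNNReal : ℝ) = C i.1 :=
    fun i => Real.coe_toNNReal _ (hC _).le
  set X : Fin n → Idx d L → ℝ := fun k i => Y i.1 i.2 (w k).1 with hX
  have hXu : ∀ (k : Fin n) (u : Coeffs d L), ∑ i, X k i * u i = synth Y u (w k).1 := by
    intro k u
    rw [synth_apply]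
    exact Finset.sum_congr rfl fun i _ => mul_comm _ _
  have hlik : regressionLik Y σ (L := L) (dataOf f w) = fun a => ∏ k,
      gaussianPDF (∑ i, X k i * a i) (σ ^ 2).toNNReal (dataOf f w k).2 := by
    funext a
    simp only [hXu]
    rfl
  have h := bayes_gaussian_tail_le (v := fun i : Idx d L => (C i.1).toNNReal)
    (fun i => by simpa using hC i.1) (σ ^ 2).toNNReal X
    (fun k => (dataOf f w k).2) (trunc Y f L) (κ := n / (2 * σ ^ 2)) t
    (by positivity) ?_
  · rw [regressionPosterior, hlik]
    refine h.trans (ENNReal.ofReal_le_ofReal ?_)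
    rw [card_idx]
    have e : ∀ i : Idx d L, (∑ k, ((dataOf f w k).2 - ∑ i', X k i' * trunc Y f L i') * X k i) /
        ((σ ^ 2).toNNReal : ℝ) - trunc Y f L i / ((C i.1).toNNReal : ℝ) =
        (∑ k, score Y (remainder Y L f) L i (w k)) / σ ^ 2 - trunc Y f L i / C i.1 := by
      intro i
      have h0 : coeff Y (remainder Y L f) i.1 i.2 = 0 := by
        rw [coeff_remainder hd hY, if_pos (Nat.lt_succ_iff.1 i.1.2)]
      simp only [hXu, hτ, hv]
      congr 2
      refine Finset.sum_congr rfl fun k _ => ?_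
      rw [score, h0, hw]
      simp only [dataOf, obs, hX]
      ring
    simp only [e]
    exact exp_mul_sqrt_two_pow_le hσ hn' (dimLe d L) t hK
  · intro u
    rw [hτ, ← Finset.sum_div, le_div_iff₀ (by positivity)]
    refine le_trans (le_of_eq ?_) (le_sum_synth_sq hG u)
    field_simp

theorem farFrom_subset {d L : ℕ} (hd : 1 ≤ d) {Y : HarmonicFamily d}
    (hY : IsSphericalHarmonicBasis Y) {f : L2 d} {r b : ℝ} (hr : 0 ≤ r)
    (hb : ‖remainder Y L f‖ ^ 2 ≤ b) :
    farFrom Y L f r ⊆ {a | r ^ 2 - b < ∑ i, (a i - trunc Y f L i) ^ 2} := by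
  intro a ha
  have h : r < ‖toL2 (synth Y a) - f‖ := ha
  have h2 : r ^ 2 < ‖toL2 (synth Y a) - f‖ ^ 2 := by gcongr
  rw [norm_toL2_synth_sub_sq hd hY] at h2
  show r ^ 2 - b < ∑ i, (a i - trunc Y f L i) ^ 2
  linarith

theorem lintegral_le_measure_add {Ω : Type*} [MeasurableSpace Ω] {μ : Measure Ω}
    [IsProbabilityMeasure μ] {F : Ω → ℝ≥0∞} (h1 : ∀ w, F w ≤ 1) {s : Set Ω} {E : ℝ≥0∞}
    (hE : ∀ᵐ w ∂μ, w ∉ s → F w ≤ E) : ∫⁻ w, F w ∂μ ≤ μ s + E := by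
  have h : ∀ᵐ w ∂μ, F w ≤ s.indicator 1 w + E := by
    filter_upwards [hE] with w hw
    by_cases hs : w ∈ s
    · rw [Set.indicator_of_mem hs]
      exact (h1 w).trans le_self_add
    · rw [Set.indicator_of_notMem hs, zero_add]
      exact hw hs
  refine (lintegral_mono_ae h).trans ?_
  rw [lintegral_add_right _ measurable_const, lintegral_const, measure_univ, mul_one]
  gcongr
  exact lintegral_indicator_one_le s

/-! ### The contraction rate -/

/-- Here the prior meets the smoothness: 1/C_ℓ² is at most a multiple of the squared Sobolev weight,
one factor of which is absorbed by the norm of f and the other bounded by its order at degree L. -/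
theorem sum_trunc_div_sq_le {d : ℕ} (L : ℕ) (hd : 1 ≤ d) {Y : HarmonicFamily d} {β R c₁ : ℝ}
    (hβ : 0 ≤ β) (hc : 0 < c₁) {C : ℕ → ℝ} (hC : ∀ ℓ, c₁ * (1 + eigenval d ℓ) ^ (-β) ≤ C ℓ)
    {f : L2 d} (hf : f ∈ sobolevBall Y β R) :
    ∑ i, (trunc Y f L i / C i.1) ^ 2 ≤
      (((d : ℝ) + 1) * ((L : ℝ) + 1) ^ 2) ^ β * R ^ 2 / c₁ ^ 2 := by
  set E := (((d : ℝ) + 1) * ((L : ℝ) + 1) ^ 2) ^ β with hE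
  have hE0 : 0 ≤ E := by positivity
  have h : ∀ i : Idx d L, (trunc Y f L i / C i.1) ^ 2 ≤
      E / c₁ ^ 2 * ((1 + eigenval d i.1) ^ β * coeff Y f i.1 i.2 ^ 2) := by
    intro i
    have hpos := one_add_eigenval_pos hd i.1
    have hp : 0 < (1 + eigenval d i.1) ^ β := Real.rpow_pos_of_pos hpos _
    have hle : (1 + eigenval d i.1) ^ β ≤ E := by
      refine Real.rpow_le_rpow hpos.le ((one_add_eigenval_le hd _).trans ?_) hβ
      have : ((i.1 : ℕ) : ℝ) ≤ L := by exact_mod_cast Nat.lt_succ_iff.1 i.1.2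
      gcongr
    have hCi := hC i.1
    rw [Real.rpow_neg hpos.le] at hCi
    have hC0 : 0 < c₁ * ((1 + eigenval d i.1) ^ β)⁻¹ := by positivity
    calc (trunc Y f L i / C i.1) ^ 2 = trunc Y f L i ^ 2 / C i.1 ^ 2 := by rw [div_pow]
      _ ≤ trunc Y f L i ^ 2 / (c₁ * ((1 + eigenval d i.1) ^ β)⁻¹) ^ 2 := by gcongr
      _ = (1 + eigenval d i.1) ^ β / c₁ ^ 2 *
          ((1 + eigenval d i.1) ^ β * coeff Y f i.1 i.2 ^ 2) := by
          rw [trunc]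
          field_simp
      _ ≤ _ := by gcongr
  refine (Finset.sum_le_sum fun i _ => h i).trans ?_
  rw [← Finset.mul_sum, mul_div_right_comm]
  gcongr
  exact sum_weighted_coeff_le L hd hf

theorem tendsto_resolution (d : ℕ) {β : ℝ} (hβ : 0 < β) :
    Tendsto (resolution d β) atTop atTop :=
  (tendsto_rpow_atTop (by positivity)).comp tendsto_natCast_atTop_atTop

/-- Truncation levels of the order of the resolution level. -/
theorem eventually_truncation_bounds {d : ℕ} (hd : 1 ≤ d) {Y : HarmonicFamily d}
    (hY : IsSphericalHarmonicBasis Y) {β c₁ : ℝ} (R : ℝ) (hβ : 0 < β) (hc : 0 < c₁) {C : ℕ → ℝ}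
    (hC : ∀ ℓ, c₁ * (1 + eigenval d ℓ) ^ (-β) ≤ C ℓ) {L : ℕ → ℕ}
    (hL : (fun n => (L n : ℝ)) =Θ[atTop] (fun n : ℕ => (n : ℝ) ^ (1 / (2 * β + d)))) :
    ∃ a b c e : ℝ, 0 ≤ a ∧ 0 ≤ b ∧ ∀ᶠ n : ℕ in atTop, 1 ≤ n ∧
      (dimLe d (L n) : ℝ) ≤ a * resolution d β n ^ d ∧
      resolution d β n ≤ b * dimLe d (L n) ∧
      ∀ f ∈ sobolevBall Y β R, ∑ i, (trunc Y f (L n) i / C i.1) ^ 2 ≤ c * n ∧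
        ‖remainder Y (L n) f‖ ^ 2 ≤ e * resolution d β n ^ (-(2 * β)) := by
  obtain ⟨u, hu0, hu⟩ := hL.1.exists_pos
  obtain ⟨l, hl0, hl⟩ := hL.2.exists_pos
  -- Here u and l are the constants in L ≤ u N and N ≤ l L. The first and third witnesses use L + 1
  -- ≤ (u + 1) N, the other two use N ≤ l (L + 1).
  refine ⟨2 * ((d : ℝ) + 1) ^ d * (u + 1) ^ d, l ^ d * d.factorial,
    (((d : ℝ) + 1) * (u + 1) ^ 2) ^ β * R ^ 2 / c₁ ^ 2, R ^ 2 * l⁻¹ ^ (-(2 * β)), by positivity,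
    by positivity, ?_⟩
  filter_upwards [hu.bound, hl.bound, eventually_ge_atTop 1] with n h1 h2 hn
  have hN1 : 1 ≤ resolution d β n := one_le_resolution hβ.le hn
  have h1' : (L n : ℝ) ≤ u * resolution d β n := by
    rw [Real.norm_of_nonneg (Nat.cast_nonneg _), Real.norm_of_nonneg (by positivity)] at h1
    exact h1
  have h2' : resolution d β n ≤ l * L n := by
    rw [Real.norm_of_nonneg (Nat.cast_nonneg _), Real.norm_of_nonneg (by positivity)] at h2
    exact h2
  have hnN := resolution_rpow_mul_pow (d := d) hβ hn
  set N := resolution d β n with hN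
  have hN0 : 0 < N := one_pos.trans_le hN1
  have h3 : (L n : ℝ) + 1 ≤ (u + 1) * N := by linarith
  have hNd : 1 ≤ N ^ d := one_le_pow₀ hN1
  refine ⟨hn, ?_, ?_, fun f hf => ⟨?_, ?_⟩⟩
  · have : (dimLe d (L n) : ℝ) ≤ 2 * (d + 1) ^ d * (L n + 1) ^ d := by
      exact_mod_cast dimLe_le hd (L n)
    calc (dimLe d (L n) : ℝ) ≤ 2 * (d + 1) ^ d * (L n + 1) ^ d := this
      _ ≤ 2 * (d + 1) ^ d * ((u + 1) * N) ^ d := by gcongr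
      _ = _ := by rw [mul_pow]; ring
  · have h4 := pow_le_dimLe hd (L n)
    rw [div_le_iff₀ (by positivity)] at h4
    calc N ≤ N ^ d := le_self_pow₀ hN1 (by omega)
      _ ≤ (l * (L n + 1)) ^ d := by
          gcongr
          nlinarith
      _ = l ^ d * (L n + 1) ^ d := mul_pow _ _ _
      _ ≤ l ^ d * (dimLe d (L n) * d.factorial) := by gcongr
      _ = _ := by ring
  · refine (sum_trunc_div_sq_le (L n) hd hβ.le hc hC hf).trans ?_
    have h5 : (((d : ℝ) + 1) * ((L n : ℝ) + 1) ^ 2) ^ β ≤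
        (((d : ℝ) + 1) * (u + 1) ^ 2) ^ β * N ^ (2 * β) := by
      have : N ^ (2 * β) = (N ^ 2) ^ β := by
        rw [← Real.rpow_natCast, ← Real.rpow_mul hN0.le, Nat.cast_ofNat]
      rw [this, ← Real.mul_rpow (by positivity) (by positivity), mul_assoc, ← mul_pow]
      gcongr
    have h6 : N ^ (2 * β) ≤ n := by
      rw [← hnN]
      exact le_mul_of_one_le_right (Real.rpow_nonneg hN0.le _) hNd
    calc _ ≤ (((d : ℝ) + 1) * (u + 1) ^ 2) ^ β * N ^ (2 * β) * R ^ 2 / c₁ ^ 2 := by gcongr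
      _ ≤ (((d : ℝ) + 1) * (u + 1) ^ 2) ^ β * n * R ^ 2 / c₁ ^ 2 := by gcongr
      _ = _ := by ring
  · refine (tsum_remainder_le hd hY hβ.le hf).trans ?_
    have h7 : l⁻¹ * N ≤ ((L n + 1 : ℕ) : ℝ) := by
      rw [inv_mul_le_iff₀ hl0]
      push_cast
      nlinarith
    rw [mul_assoc, ← Real.mul_rpow (by positivity) hN0.le]
    gcongr
    exact one_add_eigenval_rpow_neg_le hd (by positivity) hβ.le h7

/-- The constant of the concentration inequality for the scores. -/
def scoreConst (d : ℕ) (σ β R : ℝ) : ℝ := 4 * supConst d β R + 8 * σ ^ 2 + 2 * R ^ 2 + 1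

theorem supConst_nonneg {d : ℕ} (hd : 1 ≤ d) (β R : ℝ) : 0 ≤ supConst d β R :=
  mul_nonneg (sq_nonneg _) (tsum_nonneg fun ℓ => mul_nonneg
    (Real.rpow_nonneg (one_add_eigenval_pos hd ℓ).le _) (Nat.cast_nonneg _))

/-- Uniform exponential tail bounds on the event of typical design and noise. -/
def HasExponentialTail {d : ℕ} (Y : HarmonicFamily d) (σ : ℝ) (C : ℕ → ℝ) {L n : ℕ}
    (post : Data d n → Measure (Coeffs d L)) (B : Set (L2 d)) : Prop :=
  ∀ f ∈ B, ∃ g ∈ B, ∀ᵐ w ∂(Measure.pi fun _ : Fin n => baseLaw d σ),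
    ∑ i : Idx d L, ∑ j : Idx d L, gramDev Y (fun k => (w k).1) i j ^ 2 ≤ (n : ℝ) ^ 2 / 4 →
    ∀ K : ℝ, ∑ i, (∑ k, score Y g L i (w k)) ^ 2 ≤ K * (n * dimLe d L) → ∀ t : ℝ,
      post (dataOf f w) {a | t < ∑ i, (a i - trunc Y f L i) ^ 2} ≤
        ENNReal.ofReal (Real.exp (tailExponent σ n (dimLe d L) K
          (∑ i, (trunc Y f L i / C i.1) ^ 2) t))

theorem lintegral_posterior_le {d n L : ℕ} (hd : 1 ≤ d) {Y : HarmonicFamily d}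
    (hY : IsSphericalHarmonicBasis Y) (hn : 1 ≤ n) {σ β R : ℝ} (hσ : 0 < σ)
    (hβ : (d : ℝ) / 2 < β) (hD : 1 ≤ dimLe d L) {C : ℕ → ℝ}
    {post : Data d n → Measure (Coeffs d L)} (h1 : ∀ z S, post z S ≤ 1)
    (htail : HasExponentialTail Y σ C post (sobolevBall Y β R)) {f : L2 d}
    (hf : f ∈ sobolevBall Y β R) {r b : ℝ} (hr : 0 ≤ r) (hb : ‖remainder Y L f‖ ^ 2 ≤ b) :
    ∫⁻ z, post z (farFrom Y L f r) ∂(dataLaw σ f n) ≤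
      ENNReal.ofReal (4 * (dimLe d L : ℝ) ^ 2 / n) + (ENNReal.ofReal (noiseVar σ / (n * σ ^ 4)) +
      ENNReal.ofReal (4 * (supConst d β R + σ ^ 2) * (R ^ 2 + σ ^ 2) / dimLe d L)) +
      ENNReal.ofReal (Real.exp (tailExponent σ n (dimLe d L) (scoreConst d σ β R)
          (∑ i, (trunc Y f L i / C i.1) ^ 2) (r ^ 2 - b))) := by
  obtain ⟨g, hg, hw⟩ := htail f hf
  set s₁ : Set (Fin n → Sph d × ℝ) := {w | (n : ℝ) ^ 2 / 4 ≤
    ∑ i : Idx d L, ∑ j : Idx d L, gramDev Y (fun k => (w k).1) i j ^ 2} with hs₁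
  set s₂ : Set (Fin n → Sph d × ℝ) := {w | scoreConst d σ β R * (n * dimLe d L) <
    ∑ i, (∑ k, score Y g L i (w k)) ^ 2} with hs₂
  have b1 : (Measure.pi fun _ : Fin n => baseLaw d σ) s₁ ≤ _ := gram_concentration L hd hY hn σ
  have b2 : (Measure.pi fun _ : Fin n => baseLaw d σ) s₂ ≤ _ :=
    score_concentration L hd hY hn hσ hβ hg hD (supConst_nonneg hd β R)
  have b3 := (measure_union_le (μ := Measure.pi fun _ : Fin n => baseLaw d σ) s₁ s₂).trans
    (add_le_add b1 b2)
  have hsub := farFrom_subset hd hY hr hb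
  rw [dataLaw_eq_map]
  -- Only the inequality for push-forwards is used, so measurability of the posterior mass in the
  -- data is not required.
  refine (lintegral_map_le _ _).trans ((lintegral_le_measure_add (s := s₁ ∪ s₂)
    (E := ENNReal.ofReal (Real.exp (tailExponent σ n (dimLe d L) (scoreConst d σ β R)
      (∑ i, (trunc Y f L i / C i.1) ^ 2) (r ^ 2 - b)))) (fun w => h1 _ _) ?_).trans
    (add_le_add_left b3 _))
  filter_upwards [hw] with w hw hs
  rw [Set.mem_union, not_or] at hs
  exact (measure_mono hsub).trans (hw (not_le.1 hs.1).le _ (not_lt.1 hs.2) _)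

/-- All four error terms are bounded independently of f and vanish. The Gram term is of order
N^(d-2β), which tends to 0 because β > d/2; the exponential term is handled by a large fixed M. -/
theorem contractsUniformly_of_hasExponentialTail {d : ℕ} (hd : 1 ≤ d) {Y : HarmonicFamily d}
    (hY : IsSphericalHarmonicBasis Y) {σ β R c₁ : ℝ} (hσ : 0 < σ) (hβ : (d : ℝ) / 2 < β)
    (hc : 0 < c₁) {C : ℕ → ℝ} (hC : ∀ ℓ, c₁ * (1 + eigenval d ℓ) ^ (-β) ≤ C ℓ) {L : ℕ → ℕ}
    (hL : (fun n => (L n : ℝ)) =Θ[atTop] (fun n : ℕ => (n : ℝ) ^ (1 / (2 * β + d))))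
    {post : (n : ℕ) → Data d n → Measure (Coeffs d (L n))} (h1 : ∀ n z S, post n z S ≤ 1)
    (htail : ∀ n, 1 ≤ n → HasExponentialTail Y σ C (post n) (sobolevBall Y β R)) :
    ContractsUniformly Y σ L post (sobolevBall Y β R)
      fun n => (n : ℝ) ^ (-β / (2 * β + d)) := by
  have hβ0 : 0 < β := lt_of_le_of_lt (by positivity) hβ
  obtain ⟨a, b, c, e, ha, hb, hev⟩ := eventually_truncation_bounds hd hY R hβ0 hc hC hL
  set K := scoreConst d σ β R with hK
  have hK0 : 0 ≤ K := by
    have := supConst_nonneg hd β R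
    rw [hK, scoreConst]
    positivity
  -- The least M² for which the decay nt/(16σ²) beats all positive terms of the exponent and leaves
  -- -N^d; the summand e pays for the truncation bias.
  set q := e + 16 * σ ^ 2 * (8 * K * a / σ ^ 2 + 8 * σ ^ 2 * |c| + a + 1) with hq
  set κ := 4 * (supConst d β R + σ ^ 2) * (R ^ 2 + σ ^ 2) with hκ
  have hκ0 : 0 ≤ κ := by
    have := supConst_nonneg hd β R
    positivity
  refine ⟨√q, fun M hM => ?_⟩
  have hM0 : 0 ≤ M := (Real.sqrt_nonneg _).trans hM
  have hMq : q ≤ M ^ 2 := (Real.sqrt_le_left hM0).1 hM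
  set bound : ℕ → ℝ≥0∞ := fun n =>
    ENNReal.ofReal (4 * a ^ 2 * resolution d β n ^ (-(2 * β - d))) +
      (ENNReal.ofReal (noiseVar σ / σ ^ 4 * (n : ℝ)⁻¹) +
        ENNReal.ofReal (κ * b * (resolution d β n)⁻¹)) +
      ENNReal.ofReal (Real.exp (-resolution d β n)) with hbound
  have hlim : Tendsto bound atTop (𝓝 0) := by
    have hN := tendsto_resolution d hβ0
    have t1 : Tendsto (fun n => 4 * a ^ 2 * resolution d β n ^ (-(2 * β - d))) atTop (𝓝 0) := by
      simpa using ((tendsto_rpow_neg_atTop (y := 2 * β - d) (by linarith)).comp hN).const_mul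
        (4 * a ^ 2)
    have t2 : Tendsto (fun n : ℕ => noiseVar σ / σ ^ 4 * (n : ℝ)⁻¹) atTop (𝓝 0) := by
      simpa using (tendsto_inv_atTop_nhds_zero_nat (𝕜 := ℝ)).const_mul (noiseVar σ / σ ^ 4)
    have t3 : Tendsto (fun n => κ * b * (resolution d β n)⁻¹) atTop (𝓝 0) := by
      simpa using (tendsto_inv_atTop_zero.comp hN).const_mul (κ * b)
    have t4 : Tendsto (fun n => Real.exp (-resolution d β n)) atTop (𝓝 0) :=
      Real.tendsto_exp_neg_atTop_nhds_zero.comp hN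
    have h0 : ENNReal.ofReal 0 = 0 := ENNReal.ofReal_zero
    have := ((ENNReal.tendsto_ofReal t1).add ((ENNReal.tendsto_ofReal t2).add
      (ENNReal.tendsto_ofReal t3))).add (ENNReal.tendsto_ofReal t4)
    simpa only [h0, add_zero] using this
  refine tendsto_of_tendsto_of_tendsto_of_le_of_le' tendsto_const_nhds hlim
    (Eventually.of_forall fun n => zero_le) ?_
  filter_upwards [hev] with n hn
  obtain ⟨hn1, hDa, hDb, hfn⟩ := hn
  have hN1 : 1 ≤ resolution d β n := one_le_resolution hβ0.le hn1
  have hnN := resolution_rpow_mul_pow (d := d) hβ0 hn1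
  have hρ := rate_sq (d := d) (n := n) (β := β)
  set N := resolution d β n with hN
  have hN0 : 0 < N := one_pos.trans_le hN1
  have hn' : (0 : ℝ) < n := by positivity
  have hD0 : (0 : ℝ) < dimLe d (L n) := by
    by_contra h
    have : b * (dimLe d (L n) : ℝ) ≤ 0 := mul_nonpos_of_nonneg_of_nonpos hb (not_lt.1 h)
    linarith
  have hD1 : 1 ≤ dimLe d (L n) := by exact_mod_cast hD0
  refine iSup₂_le fun f hf => ?_
  obtain ⟨hA, hrem⟩ := hfn f hf
  refine (lintegral_posterior_le hd hY hn1 hσ hβ hD1 (h1 n) (htail n hn1) hf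
    (mul_nonneg hM0 (Real.rpow_nonneg (Nat.cast_nonneg _) _)) hrem).trans ?_
  have hNd : N ≤ N ^ d := le_self_pow₀ hN1 (by omega)
  refine add_le_add (add_le_add ?_ (add_le_add ?_ ?_)) ?_ <;> refine ENNReal.ofReal_le_ofReal ?_
  -- The squared dimension over n, rewritten through n = N^(2β) N^d.
  · have e1 : (N ^ d) ^ 2 / n = N ^ (-(2 * β - d)) := by
      rw [← hnN, neg_sub, Real.rpow_sub hN0, Real.rpow_natCast]
      have : N ^ (2 * β) ≠ 0 := (Real.rpow_pos_of_pos hN0 _).ne'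
      field_simp
    calc 4 * (dimLe d (L n) : ℝ) ^ 2 / n ≤ 4 * (a * N ^ d) ^ 2 / n := by gcongr
      _ = 4 * a ^ 2 * ((N ^ d) ^ 2 / n) := by ring
      _ = _ := by rw [e1]
  · refine le_of_eq ?_
    field_simp
  · rw [div_le_iff₀ hD0]
    calc κ = κ * N⁻¹ * N := by field_simp
      _ ≤ κ * N⁻¹ * (b * dimLe d (L n)) := by gcongr
      _ = _ := by ring
  · refine Real.exp_le_exp.2 ?_
    have e2 : (n : ℝ) * N ^ (-(2 * β)) = N ^ d := by
      rw [← hnN, Real.rpow_neg hN0.le]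
      have : N ^ (2 * β) ≠ 0 := (Real.rpow_pos_of_pos hN0 _).ne'
      field_simp
    rw [mul_pow, hρ, ← sub_mul, tailExponent]
    have e3 : (n : ℝ) * ((M ^ 2 - e) * N ^ (-(2 * β))) = (M ^ 2 - e) * N ^ d := by
      rw [← e2]; ring
    rw [e3]
    have b1 : 8 * K * dimLe d (L n) / σ ^ 2 ≤ 8 * K * a / σ ^ 2 * N ^ d := by
      calc _ ≤ 8 * K * (a * N ^ d) / σ ^ 2 := by gcongr
        _ = _ := by ring
    have b2 : 8 * σ ^ 2 * (∑ i, (trunc Y f (L n) i / C i.1) ^ 2) / n ≤ 8 * σ ^ 2 * |c| * N ^ d := by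
      calc _ ≤ 8 * σ ^ 2 * (|c| * n) / n := by
            gcongr
            exact hA.trans (mul_le_mul_of_nonneg_right (le_abs_self c) hn'.le)
        _ = 8 * σ ^ 2 * |c| * 1 := by field_simp
        _ ≤ _ := by
            gcongr
            exact hN1.trans hNd
    have b3 : (8 * K * a / σ ^ 2 + 8 * σ ^ 2 * |c| + a + 1) * N ^ d ≤
        (M ^ 2 - e) * N ^ d / (16 * σ ^ 2) := by
      rw [le_div_iff₀ (by positivity)]
      have : (8 * K * a / σ ^ 2 + 8 * σ ^ 2 * |c| + a + 1) * (16 * σ ^ 2) ≤ M ^ 2 - e := by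
        rw [hq] at hMq
        linarith
      calc _ = (8 * K * a / σ ^ 2 + 8 * σ ^ 2 * |c| + a + 1) * (16 * σ ^ 2) * N ^ d := by ring
        _ ≤ _ := by gcongr
    linarith

theorem hasExponentialTail_harmonicPosterior {d n : ℕ} (L : ℕ) (Y : HarmonicFamily d) (hn : 1 ≤ n)
    {σ : ℝ} (hσ : 0 < σ) {C : ℕ → ℝ} (hC : ∀ ℓ, 0 < C ℓ) (B : Set (L2 d)) :
    HasExponentialTail Y σ C (harmonicPosterior Y σ C L (n := n)) B :=
  fun f hf => ⟨f, hf, ae_of_all _ fun w _ _ hK t => harmonicPosterior_tail_le hn hσ hC f w hK t⟩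

theorem hasExponentialTail_regressionPosterior {d n : ℕ} (L : ℕ) (hd : 1 ≤ d)
    {Y : HarmonicFamily d} (hY : IsSphericalHarmonicBasis Y) (hn : 1 ≤ n)
    {σ : ℝ} (hσ : 0 < σ) {C : ℕ → ℝ} (hC : ∀ ℓ, 0 < C ℓ) (β R : ℝ) :
    HasExponentialTail Y σ C (regressionPosterior Y σ C L (n := n)) (sobolevBall Y β R) := by
  intro f hf
  -- The scores that drive this posterior are those of the remainder, not of f.
  refine ⟨remainder Y L f, remainder_mem_sobolevBall L hd hY hf, ?_⟩
  have h : ∀ᵐ x ∂(unif d), remainder Y L f x = f x - synth Y (trunc Y f L) x := by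
    filter_upwards [Lp.coeFn_sub f (toL2 (synth Y (trunc Y f L))),
      ContinuousMap.coeFn_toLp (p := 2) (𝕜 := ℝ) (unif d) (synth Y (trunc Y f L))] with x h1 h2
    rw [remainder, h1, Pi.sub_apply, h2]
  filter_upwards [ae_pi_fst (n := n) σ h] with w hw hG K hK t
  exact regressionPosterior_tail_le hd hY hn hσ hC f w hw hG hK t

end SphereRegression

end


/-! ### The corollary -/

open SphereRegression in
theorem corollary3p2
    (d : ℕ) (hd : 1 ≤ d) (σ : ℝ) (hσ : 0 < σ)
    (α β : ℝ) (hα : (d : ℝ) / 2 < α) (hαβ : α = β)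
    (Y : HarmonicFamily d) (hY : IsSphericalHarmonicBasis Y)
    (R : ℝ) (hR : 0 < R)
    (ρ : ℕ → ℝ) (hρ : ∀ n, ρ n = (n : ℝ) ^ (-β / (2 * β + d))) :
    -- the minimax risk over the Sobolev ball is of exact order `ρ_n²`
    (∃ c C : ℝ, 0 < c ∧ 0 < C ∧ ∀ n : ℕ, 1 ≤ n →
      ENNReal.ofReal (c * ρ n ^ 2) ≤ minimaxRisk σ n (sobolevBall Y β R) ∧
      minimaxRisk σ n (sobolevBall Y β R) ≤ ENNReal.ofReal (C * ρ n ^ 2)) ∧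
    -- no sequence of estimators achieves a uniformly faster rate
    (∀ T : (n : ℕ) → Data d n → L2 d, (∀ n, StronglyMeasurable (T n)) →
      ∀ r : ℕ → ℝ, r =o[atTop] ρ →
        ∀ᶠ n in atTop,
          ENNReal.ofReal (r n ^ 2) < worstCaseRisk σ n (sobolevBall Y β R) (T n)) ∧
    -- the posterior contracts at the rate `ρ_n`
    (∀ (C : ℕ → ℝ) (c₁ c₂ : ℝ), 0 < c₁ → 0 < c₂ →
      (∀ ℓ, c₁ * (1 + eigenval d ℓ) ^ (-α) ≤ C ℓ ∧ C ℓ ≤ c₂ * (1 + eigenval d ℓ) ^ (-α)) →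
      ∀ L : ℕ → ℕ,
        (fun n => (L n : ℝ)) =Θ[atTop] (fun n : ℕ => (n : ℝ) ^ (1 / (2 * α + d))) →
        ContractsUniformly Y σ L (fun n => harmonicPosterior Y σ C (L n))
          (sobolevBall Y β R) ρ ∧
        ContractsUniformly Y σ L (fun n => regressionPosterior Y σ C (L n))
          (sobolevBall Y β R) ρ) := by
  subst hαβ
  obtain rfl : ρ = fun n : ℕ => (n : ℝ) ^ (-α / (2 * α + d)) := funext hρ
  have hα0 : 0 < α := lt_of_le_of_lt (by positivity) hα
  refine ⟨⟨lowerConst d σ α R, (R ^ 2 + σ ^ 2) * (2 * (d + 1) ^ d * 2 ^ d) + R ^ 2,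
    lowerConst_pos d hσ hR, by positivity, fun n hn => ?_⟩, fun T hT r hr => ?_, ?_⟩
  · simp only [rate_sq]
    exact ⟨le_iInf₂ fun T hT => rate_le_worstCaseRisk hd hY hn R hσ hα0 hT,
      minimaxRisk_le_rate hd hY hn σ R hα0⟩
  · exact eventually_sq_lt_worstCaseRisk hd hY hσ hα0 hR hT hr
  · intro C c₁ c₂ hc₁ _ hC L hL
    have hpos : ∀ ℓ, 0 < C ℓ := fun ℓ => lt_of_lt_of_le
      (mul_pos hc₁ (Real.rpow_pos_of_pos (one_add_eigenval_pos hd ℓ) _)) (hC ℓ).1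
    exact ⟨contractsUniformly_of_hasExponentialTail hd hY hσ hα hc₁ (fun ℓ => (hC ℓ).1) hL
        (fun n z S => bayes_apply_le_one _ _ S)
        fun n hn => hasExponentialTail_harmonicPosterior (L n) Y hn hσ hpos _,
      contractsUniformly_of_hasExponentialTail hd hY hσ hα hc₁ (fun ℓ => (hC ℓ).1) hL
        (fun n z S => bayes_apply_le_one _ _ S)
        fun n hn => hasExponentialTail_regressionPosterior (L n) hd hY hn hσ hpos α R⟩
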